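/- **Theorem (Solution norm estimation with optimal initial state preparation).** *Setting.* Let $A$ be an invertible complex $n\times n$ matrix and let $O_A$ be a unitary that block encodes $A/\alpha_A$, i.e. $A/\alpha_A=G^\dagger O_A G$ for a known isometry $G$, where $\alpha_A\ge\|A\|$. Let $O_b$ be a unitary with $O_b|0\rangle=|b\rangle$, let $\alpha_{A^{-1}}\ge\|A^{-1}\|$ be a known bound (spectral norms), and put $$\kappa=\alpha_A\alpha_{A^{-1}},\qquad p_{\mathrm{succ}}=\Big(\frac{\|A^{-1}|b\rangle\|}{\alpha_{A^{-1}}}\Big)^2 .$$ Let $0<\alpha_{p_{\mathrm{succ}}}\le p_{\mathrm{succ}}$ be a known lower bound. An algorithm knows $n$, $G$, $\alpha_A$, $\alpha_{A^{-1}}$, $\alpha_{p_{\mathrm{succ}}}$ and has access to $A$ and $b$ only by (controlled) queries to $O_A$, $O_b$ and their inverses. A number $u>0$ is a $c$-multiplicative approximation of $v>0$ if $1/c\le u/v\le c$. *Nested amplitude amplification.* A variable time algorithm consists of orthogonal projections $0=\Pi_0\le\Pi_1\le\dots\le\Pi_m=I$ on a workspace, an orthogonal projection $\Pi_b$ commuting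 with all $\Pi_j$, unitaries $A_1,\dots,A_m$ with $A_j\Pi_{j-1}=\Pi_{j-1}$, and a state $|\psi_0\rangle$. With the deterministic schedule of pre-merging parameter $l$, where $0\le l\le m$, that is $$2r_j+1=\begin{cases}3,& m-l+1\le j\le m,\\ 1,& 1\le j\le m-l,\end{cases}$$ it defines $\widetilde A_0=I$ and $$\widetilde A_j=\Big(-\big(I-2A_j\widetilde A_{j-1}|\psi_0\rangle\langle\psi_0|\widetilde A_{j-1}^\dagger A_j^\dagger\big)\big(I-2(I-\Pi_j\Pi_b)\big)\Big)^{r_j}A_j\widetilde A_{j-1},\qquad 1\le j\le m.$$ *Claim.* There are absolute constants $C>0$ and $c\ge1$ such that for all $n$, $G$, $\alpha_A$, $\alpha_{A^{-1}}$, $\alpha_{p_{\mathrm{succ}}}$ there is a quantum algorithm that, for all $A$, $|b\rangle$, $O_A$, $O_b$ as above, outputs with probability greater than $\frac12$ a number $y$ such that $y$ is a $c$-multiplicative approximation of $\|A^{-1}|b\rangle\|$, and hence $y/\alpha_{A^{-1}}$ is a $c$-multiplicative approximation of $\sqrt{p_{\mathrm{succ}}}$. In the worst case it makes at most $$C\,\frac{1}{\sqrt{\alpha_{p_{\mathrm{succ}}}}}\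 \text{ queries to } O_b,\qquad C\,\kappa\,\log^2\!\Big(2+\frac{1}{\sqrt{\alpha_{p_{\mathrm{succ}}}}}\Big)\log^2\!\Big(2+\log\Big(2+\frac{1}{\sqrt{\alpha_{p_{\mathrm{succ}}}}}\Big)\Big)\ \text{ queries to } O_A$$ (inverses included), which is $\mathbf O\big(\alpha_{p_{\mathrm{succ}}}^{-1/2}\big)$ and $\mathbf O\big(\kappa\log^2(\alpha_{p_{\mathrm{succ}}}^{-1/2})\,(\log\log)^2(\alpha_{p_{\mathrm{succ}}}^{-1/2})\big)$. The algorithm uses a variable time algorithm whose initial state $|\psi_0\rangle$ is prepared with one query to $O_b$ and whose input algorithms $A_j$ (which may depend on $l$) query only $O_A$: for $l=1,2,\dots$ up to some maximal value that is at most $m$, it estimates the success amplitude $\|(I-\Pi_b)\widetilde A_m|\psi_0\rangle\|$ of the nested amplitude amplification with the deterministic schedule of pre-merging parameter $l$, by preparing $\widetilde A_m|\psi_0\rangle$ repeatedly and measuring the flag; at the first $l$ at which the estimated amplitude reaches a threshold it stops and outputs a value determined by $l$ (if the threshold is never reached, it outputs a fixed value). -/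

import Mathlib

open scoped Matrix Kronecker ComplexOrder

noncomputable section

namespace QLS

/-! ### Oracle circuits

`σ` indexes a basis of the space of the linear system, `β` a basis of the space on which the block
encoding `O_A` acts, and `W` a basis of the workspace of the algorithm. -/

section Circuits

variable {σ β W : Type} [Fintype σ] [DecidableEq σ] [Fintype β] [DecidableEq β]
  [Fintype W] [DecidableEq W]

/-- One gate on the workspace: an oracle-independent unitary, or one (controlled) use of the oracle
`O_A`, or of the oracle `O_b`, or of the inverse of one of them. In a query gate the workspace basis
is split as `(register × k-dimensional spectator) ⊕ rest`; the oracle acts on the register and the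
gate is the identity on the rest (the part where the control is off). -/
inductive Gate (σ β W : Type) [Fintype W] [DecidableEq W] : Type
  | free (U : Matrix.unitaryGroup W ℂ) : Gate σ β W
  | queryA (k r : ℕ) (e : (β × Fin k) ⊕ Fin r ≃ W) (inverse : Bool) : Gate σ β W
  | queryB (k r : ℕ) (e : (σ × Fin k) ⊕ Fin r ≃ W) (inverse : Bool) : Gate σ β W

/-- The operator `(O ⊗ 1) ⊕ 1` on the workspace, with `O` replaced by `O†` if `inverse`. -/
def queryMatrix {α : Type} [Fintype α] [DecidableEq α] (O : Matrix.unitaryGroup α ℂ) (k r : ℕ)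
    (e : (α × Fin k) ⊕ Fin r ≃ W) (inverse : Bool) : Matrix W W ℂ :=
  Matrix.reindex e e
    (Matrix.fromBlocks
      ((bif inverse then (O : Matrix α α ℂ)ᴴ else (O : Matrix α α ℂ)) ⊗ₖ
        (1 : Matrix (Fin k) (Fin k) ℂ))
      0 0 1)

/-- The operator of a gate for given oracles. -/
def Gate.eval (OA : Matrix.unitaryGroup β ℂ) (OB : Matrix.unitaryGroup σ ℂ) :
    Gate σ β W → Matrix W W ℂ
  | .free U => U
  | .queryA k r e inverse => queryMatrix OA k r e inverse
  | .queryB k r e inverse => queryMatrix OB k r e inverse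

/-- The inverse gate. -/
def Gate.adj : Gate σ β W → Gate σ β W
  | .free U => .free U⁻¹
  | .queryA k r e inverse => .queryA k r e (!inverse)
  | .queryB k r e inverse => .queryB k r e (!inverse)

/-- The number of uses of `O_A` and its inverse in a gate. -/
def Gate.costA : Gate σ β W → ℕ
  | .queryA _ _ _ _ => 1
  | _ => 0

/-- The number of uses of `O_b` and its inverse in a gate. -/
def Gate.costB : Gate σ β W → ℕ
  | .queryB _ _ _ _ => 1
  | _ => 0

/-- A quantum circuit with oracle gates; the head of the list is applied first. -/
abbrev Circuit (σ β W : Type) [Fintype W] [DecidableEq W] : Type := List (Gate σ β W)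

/-- The operator of a circuit for given oracles. -/
def Circuit.eval (OA : Matrix.unitaryGroup β ℂ) (OB : Matrix.unitaryGroup σ ℂ) :
    Circuit σ β W → Matrix W W ℂ
  | [] => 1
  | g :: c => Circuit.eval OA OB c * g.eval OA OB

/-- The inverse circuit. -/
def Circuit.adj (c : Circuit σ β W) : Circuit σ β W := (c.map Gate.adj).reverse

/-- The number of queries to `O_A` and its inverse. -/
def Circuit.costA (c : Circuit σ β W) : ℕ := (c.map Gate.costA).sum

/-- The number of queries to `O_b` and its inverse. -/
def Circuit.costB (c : Circuit σ β W) : ℕ := (c.map Gate.costB).sum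

/-! ### Adaptive quantum query algorithms -/

/-- A quantum query algorithm with classical control and a real output: it either halts with an
output, or it prepares the basis state `x`, runs the circuit `c`, performs the two-outcome
measurement `{P, 1 - P}` (outcome `true` for `P`), and continues depending on the outcome. -/
inductive QAlg (σ β W : Type) [Fintype W] [DecidableEq W] : Type
  | done (y : ℝ) : QAlg σ β W
  | step (c : Circuit σ β W) (x : W) (P : Matrix W W ℂ) (hP : IsStarProjection P)
      (next : Bool → QAlg σ β W) : QAlg σ β W

/-- The Euclidean norm of the `x`-th column of a matrix, i.e. `‖M |x⟩‖`. -/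
def colNorm (M : Matrix W W ℂ) (x : W) : ℝ := ‖WithLp.toLp 2 (M *ᵥ Pi.single x 1)‖

/-- The probability that the output of the algorithm satisfies `S`, for given oracles. -/
def QAlg.prob (OA : Matrix.unitaryGroup β ℂ) (OB : Matrix.unitaryGroup σ ℂ) (S : Set ℝ) :
    QAlg σ β W → ℝ
  | .done y => S.indicator 1 y
  | .step c x P _ next =>
      colNorm (P * c.eval OA OB) x ^ 2 * QAlg.prob OA OB S (next true) +
        colNorm ((1 - P) * c.eval OA OB) x ^ 2 * QAlg.prob OA OB S (next false)

/-- The number of queries to `O_A` and its inverse, in the worst case over measurement outcomes. -/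
def QAlg.costA : QAlg σ β W → ℕ
  | .done _ => 0
  | .step c _ _ _ next => c.costA + max (QAlg.costA (next true)) (QAlg.costA (next false))

/-- The number of queries to `O_b` and its inverse, in the worst case over measurement outcomes. -/
def QAlg.costB : QAlg σ β W → ℕ
  | .done _ => 0
  | .step c _ _ _ next => c.costB + max (QAlg.costB (next true)) (QAlg.costB (next false))

/-- The reflection `2 P - 1` about the image of an orthogonal projection, as a unitary. -/
def reflection (P : Matrix W W ℂ) (hP : IsStarProjection P) : Matrix.unitaryGroup W ℂ :=
  ⟨2 * P - 1, hP.two_mul_sub_one_mem_unitary⟩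

/-- The orthogonal projection `|x⟩⟨x|` onto a basis vector. -/
def basisProj (x : W) : Matrix W W ℂ := Matrix.single x x 1

theorem isStarProjection_basisProj (x : W) : IsStarProjection (basisProj x) := by
  refine ⟨?_, ?_⟩
  · simp [IsIdempotentElem, basisProj]
  · simp [IsSelfAdjoint, basisProj, Matrix.star_eq_conjTranspose, Matrix.conjTranspose_single]

end Circuits

/-! ### Solution norm estimation by nested variable time amplitude amplification -/

/-- The data of a solution norm estimation algorithm that runs a variable time nested amplitude
amplification with deterministic schedule for increasing pre-merging parameter
`l = 1, 2, ..., levels`. None of the data depends on the oracles. -/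
structure VTAAEstimator (σ β W : Type) [Fintype σ] [DecidableEq σ] [Fintype β] [DecidableEq β]
    [Fintype W] [DecidableEq W] where
  /-- the number of stages of the variable time algorithm -/
  m : ℕ
  /-- the clock projections `Π_0, ..., Π_m` (extended by `1` beyond `m`) -/
  clock : ℕ → Matrix W W ℂ
  /-- the flag projection `Π_b`, onto the states that are marked as failed -/
  flag : Matrix W W ℂ
  clock_proj : ∀ j, IsStarProjection (clock j)
  flag_proj : IsStarProjection flag
  clock_zero : clock 0 = 0
  clock_top : ∀ j, m ≤ j → clock j = 1
  /-- the clock projections increase in the positive semidefinite order -/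
  clock_mono : ∀ j, (clock (j + 1) - clock j).PosSemidef
  flag_comm : ∀ j, Commute (clock j) flag
  /-- the basis state from which the initial state is prepared -/
  start : W
  /-- the preparation of the initial state `|ψ₀⟩` of the variable time algorithm -/
  prep : Circuit σ β W
  /-- `|ψ₀⟩` is prepared with one query to `O_b` -/
  prep_costB : prep.costB = 1
  prep_costA : prep.costA = 0
  /-- `input l j` is the input algorithm `A_j` that is used with pre-merging parameter `l` -/
  input : ℕ → ℕ → Circuit σ β W
  /-- the input algorithms query `O_A` only -/
  input_costB : ∀ l j, (input l j).costB = 0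
  /-- `A_j Π_{j-1} = Π_{j-1}` for `1 ≤ j ≤ m`, whatever the oracles are -/
  input_clock : ∀ (OA : Matrix.unitaryGroup β ℂ) (OB : Matrix.unitaryGroup σ ℂ) (l j : ℕ),
    j < m → (input l (j + 1)).eval OA OB * clock j = clock j
  /-- the largest value of the pre-merging parameter -/
  levels : ℕ
  one_le_levels : 1 ≤ levels
  levels_le : levels ≤ m
  /-- the number of repetitions in the amplitude estimation with pre-merging parameter `l` -/
  runs : ℕ → ℕ
  /-- the value with which the estimated amplitude is compared -/
  threshold : ℝ
  /-- the output of the algorithm if it stops at `l` -/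
  output : ℕ → ℝ

namespace VTAAEstimator

variable {σ β W : Type} [Fintype σ] [DecidableEq σ] [Fintype β] [DecidableEq β]
  [Fintype W] [DecidableEq W] (E : VTAAEstimator σ β W)

theorem isStarProjection_clock_mul_flag (j : ℕ) : IsStarProjection (E.clock j * E.flag) := by
  refine ⟨?_, ?_⟩
  · exact (E.clock_proj j).isIdempotentElem.mul_of_commute (E.flag_comm j)
      E.flag_proj.isIdempotentElem
  · exact ((E.clock_proj j).isSelfAdjoint.commute_iff E.flag_proj.isSelfAdjoint).1 (E.flag_comm j)

/-- The deterministic schedule with pre-merging parameter `l`: the number of amplification steps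
`2 r_j + 1` is `3` for `m - l + 1 ≤ j ≤ m`, and `1` for `1 ≤ j ≤ m - l`. -/
def schedule (l j : ℕ) : ℕ := if E.m - l + 1 ≤ j then 1 else 0

/-- `r` rounds of amplitude amplification at stage `j`, where `V` prepares
`|φ⟩ = V |start⟩ = A_j Ã_{j-1} |ψ₀⟩`: the operator of the circuit is
`(-(1 - 2 |φ⟩⟨φ|) (1 - 2 (1 - Π_j Π_b)))^r V`, since `-(1 - 2 |φ⟩⟨φ|) = V (2 |start⟩⟨start| - 1) V†`
and `1 - 2 (1 - Π_j Π_b) = 2 Π_j Π_b - 1`. -/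
def amplify (V : Circuit σ β W) (j : ℕ) : ℕ → Circuit σ β W
  | 0 => V
  | r + 1 =>
      amplify V j r ++
        ([Gate.free (reflection (E.clock j * E.flag) (E.isStarProjection_clock_mul_flag j))] ++
          V.adj ++
          [Gate.free (reflection (basisProj E.start) (isStarProjection_basisProj E.start))] ++ V)

/-- The circuit that prepares `Ã_j |ψ₀⟩` from `|start⟩`, where `Ã_j` are the amplified algorithms of
the nested amplitude amplification with the deterministic schedule of parameter `l`. -/
def amplified (l : ℕ) : ℕ → Circuit σ β W
  | 0 => E.prep
  | j + 1 => E.amplify (amplified l j ++ E.input l (j + 1)) (j + 1) (E.schedule l (j + 1))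

/-- Prepare `Ã_m |ψ₀⟩` with pre-merging parameter `l` and measure whether the flag is good (outcome
`1 - Π_b`), `k` times; then continue depending on the number of good outcomes, which is `good` so
far. -/
def sample (l : ℕ) (next : ℕ → QAlg σ β W) : (k good : ℕ) → QAlg σ β W
  | 0, good => next good
  | k + 1, good =>
      .step (E.amplified l E.m) E.start (1 - E.flag) E.flag_proj.one_sub
        (fun b => sample l next k (bif b then good + 1 else good))

open Classical in
/-- For `l, l + 1, l + 2, ...` (at most `fuel` values): estimate the success amplitude of the nested
amplitude amplification with pre-merging parameter `l` by the square root of the observed success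
frequency, and stop with output `E.output l` when it reaches the threshold. -/
def loop : (fuel l : ℕ) → QAlg σ β W
  | 0, l => .done (E.output l)
  | fuel + 1, l =>
      E.sample l
        (fun good =>
          if E.threshold ≤ √((good : ℝ) / (E.runs l : ℝ)) then .done (E.output l)
          else loop fuel (l + 1))
        (E.runs l) 0

/-- The estimation algorithm: `l = 1, 2, ..., levels`. -/
def algorithm : QAlg σ β W := E.loop E.levels 1

end VTAAEstimator

/-! ### Linear systems -/

/-- `u > 0` is a `c`-multiplicative approximation of `v > 0`. -/
def IsMultApprox (c u v : ℝ) : Prop := 0 < u ∧ 0 < v ∧ 1 / c ≤ u / v ∧ u / v ≤ c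

/-- The solution norm `‖A⁻¹ b‖`. -/
def solNorm {σ : Type} [Fintype σ] [DecidableEq σ] (A : Matrix σ σ ℂ) (b : EuclideanSpace ℂ σ) :
    ℝ :=
  ‖Matrix.toEuclideanCLM (𝕜 := ℂ) A⁻¹ b‖

/-- The success probability `p_succ = (‖A⁻¹ b‖ / α_{A⁻¹})²`. -/
def psucc {σ : Type} [Fintype σ] [DecidableEq σ] (A : Matrix σ σ ℂ) (b : EuclideanSpace ℂ σ)
    (αinv : ℝ) : ℝ :=
  (solNorm A b / αinv) ^ 2

/-- A linear system `A x = b` with oracles: `O_A` block encodes `A / α_A` through the isometry `G`,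
that is `A / α_A = G† O_A G`; `O_b |0⟩ = |b⟩`; `α_{A⁻¹} ≥ ‖A⁻¹‖`; and `α_p ≤ p_succ`. -/
structure IsInstance {σ β : Type} [Fintype σ] [DecidableEq σ] [Fintype β] [DecidableEq β]
    (zero : σ) (G : Matrix β σ ℂ) (αA αinv αp : ℝ)
    (A : Matrix σ σ ℂ) (b : EuclideanSpace ℂ σ)
    (OA : Matrix.unitaryGroup β ℂ) (OB : Matrix.unitaryGroup σ ℂ) : Prop where
  invertible : IsUnit A
  norm_le : ‖Matrix.toEuclideanCLM (𝕜 := ℂ) A‖ ≤ αA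
  norm_inv_le : ‖Matrix.toEuclideanCLM (𝕜 := ℂ) A⁻¹‖ ≤ αinv
  block_encoding : Gᴴ * (OA : Matrix β β ℂ) * G = (αA : ℂ)⁻¹ • A
  state_prep : b = WithLp.toLp 2 ((OB : Matrix σ σ ℂ) *ᵥ Pi.single zero 1)
  le_psucc : αp ≤ psucc A b αinv

end QLS

end

/-!
Write `κ = α_A α_{A⁻¹}`, `B = A / α_A = Gᴴ O_A G`, and let `s_p ∈ [1 / κ, 1]` be the singular values
of `B`. If `β_p` are the coefficients of `b` in an eigenbasis of `B Bᴴ`, then `p_succ` is the mean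
of `1 / (κ s_p)²` with the weights `|β_p|²` (`IsInstance.exists_spectral`). It is therefore enough
to build a variable time algorithm whose success probability on an eigenvector with singular value
`s` is `1 / (κ s)²` up to constants, and to find out how many amplified stages make its success
amplitude a constant.

*The variable time algorithm.* Stage `j` of `m` applies a filter with cutoff `s ≈ 3 ^ (m - j) / κ`;
what does not pass stops, and is declared good with amplitude `3 ^ (j - m)` and failed otherwise.
The filter is the uniform average of the compressed powers `Gᴴ R ^ k G`, `k ≤ K`, of the qubitized
walk `R`, a product of two reflections; on an eigenvector with `s = sin η` this power is
`cos (2 k η)` (`walkOp_pow_eigenvector`). All coefficients of this linear combination being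
nonnegative, no phases have to be computed, and the average is both at least `1 - O(K² s²)` and at
most `1 / (K s)` (`chebFilter`). These two crude bounds suffice, because the mass that stays active
for `i` stages too long is a product of `i` geometrically decreasing factors; the probability of
success is then `1 / (κ s)²` up to constants (`goodMass_bounds`). Since only the singular values
below `1 / (κ √α_p)` matter, `m` is of the order of `log (1 / √α_p)`, and stage `j` costs
`O(κ 3 ^ (j - m))` queries to `O_A`, so that all amplified stages have the same total cost `O(κ)`.

*Nested amplification.* Amplification at a stage multiplies the part of the state that has not
failed by exactly `3 - 4 a²`, where `a` is its norm (`good_amplify_one`), and later stages act on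
this part only. If `S` is the success amplitude without amplification, the success amplitude with
parameter `l` is thus at most `3 ^ l S`, and the relative loss is at most a multiple of the sum of
the `a²` over the stages. Because stopped computations are attenuated at once, summation by parts
bounds this sum by a multiple of `9 ^ l S²`, however the mass is distributed over the stages
(`sum_goodMass_le`). Hence the success amplitude is between `22/27` and `1` times `3 ^ l S` as long
as `3 ^ l S ≤ 1` (`successAmp_bounds`). The initial state is active with amplitude `1 / 3` only,
which gives `3 S ≤ 1`.

*The stopping rule.* Let `L` be the last level with `3 ^ L S ≤ 1`. Constantly many samples contain a
good one with probability at least `3 / 4` at level `L`, while the probability that one occurs at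
level `l < L` is at most a multiple of `9 ^ (l - L)`, so that stopping before `L - 2` is unlikely
(`half_lt_prob_algorithm`). The level at which the algorithm stops thus determines `S`, and with it
`√p_succ`, up to constants. With constantly many samples per level, the queries to `O_b` form a
geometric sum `O(3 ^ m) = O(1 / √α_p)`, and those to `O_A` add up to `O(κ m²)`.
-/

set_option linter.unusedSectionVars false

noncomputable section

namespace QLS

/-! ### Norms of vectors and circuit operators -/

section Norms

variable {ι κ : Type} [Fintype ι] [Fintype κ]

/-- The Euclidean norm of a complex vector that is given as a plain function. -/
def vnorm (v : ι → ℂ) : ℝ := ‖WithLp.toLp 2 v‖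

theorem vnorm_sq (v : ι → ℂ) : vnorm v ^ 2 = ∑ i, ‖v i‖ ^ 2 := by
  simp [vnorm, EuclideanSpace.norm_sq_eq]

theorem vnorm_nonneg (v : ι → ℂ) : 0 ≤ vnorm v := norm_nonneg _

theorem ofReal_vnorm_sq (v : ι → ℂ) : ((vnorm v ^ 2 : ℝ) : ℂ) = star v ⬝ᵥ v := by
  rw [vnorm_sq, dotProduct]
  push_cast
  refine Finset.sum_congr rfl fun i _ => ?_
  simp [← Complex.conj_mul']

theorem vnorm_eq_zero {v : ι → ℂ} : vnorm v = 0 ↔ v = 0 := by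
  simp [vnorm]

theorem vnorm_smul (c : ℂ) (v : ι → ℂ) : vnorm (c • v) = ‖c‖ * vnorm v := by
  simp [vnorm, norm_smul]

/-- A matrix with orthonormal columns preserves the Euclidean norm. -/
theorem vnorm_mulVec_of_isometry [DecidableEq κ] {U : Matrix ι κ ℂ} (hU : Uᴴ * U = 1)
    (v : κ → ℂ) : vnorm (U *ᵥ v) = vnorm v := by
  have h : ((vnorm (U *ᵥ v) ^ 2 : ℝ) : ℂ) = (vnorm v ^ 2 : ℝ) := by
    rw [ofReal_vnorm_sq, ofReal_vnorm_sq, Matrix.star_mulVec, Matrix.dotProduct_mulVec,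
      Matrix.vecMul_vecMul, hU, Matrix.vecMul_one]
  exact (pow_left_inj₀ (vnorm_nonneg _) (vnorm_nonneg _) two_ne_zero).1 (by exact_mod_cast h)

theorem vnorm_single [DecidableEq ι] (x : ι) : vnorm (Pi.single x (1 : ℂ)) = 1 := by
  simp [vnorm]

/-- For an orthogonal projection `P`, `⟨v, P v⟩ = ‖P v‖²`. -/
theorem star_dotProduct_proj_mulVec {P : Matrix ι ι ℂ} (hP : IsStarProjection P) (v : ι → ℂ) :
    star v ⬝ᵥ (P *ᵥ v) = ((vnorm (P *ᵥ v) ^ 2 : ℝ) : ℂ) := by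
  have h1 : Pᴴ = P := hP.isSelfAdjoint
  have h2 : P * P = P := hP.isIdempotentElem
  rw [ofReal_vnorm_sq, Matrix.star_mulVec, Matrix.dotProduct_mulVec, Matrix.dotProduct_mulVec,
    Matrix.vecMul_vecMul, h1, h2]

theorem vnorm_sq_add_compl [DecidableEq ι] {P : Matrix ι ι ℂ} (hP : IsStarProjection P)
    (v : ι → ℂ) :
    vnorm (P *ᵥ v) ^ 2 + vnorm ((1 - P) *ᵥ v) ^ 2 = vnorm v ^ 2 := by
  have h : ((vnorm (P *ᵥ v) ^ 2 + vnorm ((1 - P) *ᵥ v) ^ 2 : ℝ) : ℂ) = (vnorm v ^ 2 : ℝ) := by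
    rw [Complex.ofReal_add, ← star_dotProduct_proj_mulVec hP,
      ← star_dotProduct_proj_mulVec hP.one_sub, ofReal_vnorm_sq, ← dotProduct_add,
      ← Matrix.add_mulVec]
    simp
  exact_mod_cast h

end Norms

section Circuits

variable {σ β W : Type} [Fintype σ] [DecidableEq σ] [Fintype β] [DecidableEq β]
  [Fintype W] [DecidableEq W] (OA : Matrix.unitaryGroup β ℂ) (OB : Matrix.unitaryGroup σ ℂ)

theorem colNorm_eq_vnorm (M : Matrix W W ℂ) (x : W) :
    colNorm M x = vnorm (M *ᵥ Pi.single x 1) := rfl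

theorem queryMatrix_conjTranspose {α : Type} [Fintype α] [DecidableEq α]
    (O : Matrix.unitaryGroup α ℂ) (k r : ℕ) (e : (α × Fin k) ⊕ Fin r ≃ W) (inverse : Bool) :
    (queryMatrix O k r e inverse)ᴴ = queryMatrix O k r e (!inverse) := by
  unfold queryMatrix
  rw [Matrix.conjTranspose_reindex, Matrix.fromBlocks_conjTranspose,
    Matrix.conjTranspose_kronecker]
  cases inverse <;> simp

theorem queryMatrix_mem {α : Type} [Fintype α] [DecidableEq α]
    (O : Matrix.unitaryGroup α ℂ) (k r : ℕ) (e : (α × Fin k) ⊕ Fin r ≃ W) (inverse : Bool) :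
    (queryMatrix O k r e inverse)ᴴ * queryMatrix O k r e inverse = 1 := by
  have h1 : (O : Matrix α α ℂ)ᴴ * (O : Matrix α α ℂ) = 1 :=
    Matrix.UnitaryGroup.star_mul_self O
  have h2 : (O : Matrix α α ℂ) * (O : Matrix α α ℂ)ᴴ = 1 :=
    mul_eq_one_comm.1 h1
  rw [queryMatrix_conjTranspose]
  unfold queryMatrix
  rw [Matrix.reindex_apply, Matrix.reindex_apply, Matrix.submatrix_mul_equiv,
    Matrix.fromBlocks_multiply, ← Matrix.mul_kronecker_mul]
  cases inverse <;> simp [h1, h2]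

theorem Gate.eval_adj (g : Gate σ β W) : g.adj.eval OA OB = (g.eval OA OB)ᴴ := by
  cases g with
  | free U => rfl
  | queryA k r e i => exact (queryMatrix_conjTranspose _ _ _ _ _).symm
  | queryB k r e i => exact (queryMatrix_conjTranspose _ _ _ _ _).symm

theorem Gate.eval_isometry (g : Gate σ β W) : (g.eval OA OB)ᴴ * g.eval OA OB = 1 := by
  cases g with
  | free U => exact Matrix.UnitaryGroup.star_mul_self U
  | queryA k r e i => exact queryMatrix_mem _ _ _ _ _
  | queryB k r e i => exact queryMatrix_mem _ _ _ _ _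

theorem Circuit.eval_append (c d : Circuit σ β W) :
    Circuit.eval OA OB (c ++ d) = Circuit.eval OA OB d * Circuit.eval OA OB c := by
  induction c with
  | nil => simp [Circuit.eval]
  | cons g c ih => rw [List.cons_append, Circuit.eval, Circuit.eval, ih, Matrix.mul_assoc]

theorem Circuit.eval_singleton (g : Gate σ β W) : Circuit.eval OA OB [g] = g.eval OA OB := by
  simp [Circuit.eval]

theorem Circuit.eval_adj (c : Circuit σ β W) :
    Circuit.eval OA OB c.adj = (Circuit.eval OA OB c)ᴴ := by
  induction c with
  | nil => simp [Circuit.adj, Circuit.eval]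
  | cons g c ih =>
    have : Circuit.adj (g :: c) = Circuit.adj c ++ [g.adj] := by simp [Circuit.adj]
    rw [this, Circuit.eval_append, ih, Circuit.eval_singleton, Gate.eval_adj, Circuit.eval,
      Matrix.conjTranspose_mul]

theorem Circuit.eval_isometry (c : Circuit σ β W) :
    (Circuit.eval OA OB c)ᴴ * Circuit.eval OA OB c = 1 := by
  induction c with
  | nil => simp [Circuit.eval]
  | cons g c ih =>
    rw [Circuit.eval, Matrix.conjTranspose_mul, Matrix.mul_assoc,
      ← Matrix.mul_assoc _ _ (g.eval _ _),
      ih, Matrix.one_mul, Gate.eval_isometry]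

theorem Circuit.costA_append (c d : Circuit σ β W) :
    Circuit.costA (c ++ d) = c.costA + d.costA := by simp [Circuit.costA]

theorem Circuit.costB_append (c d : Circuit σ β W) :
    Circuit.costB (c ++ d) = c.costB + d.costB := by simp [Circuit.costB]

theorem Circuit.costA_adj (c : Circuit σ β W) : c.adj.costA = c.costA := by
  have : (Gate.costA ∘ Gate.adj : Gate σ β W → ℕ) = Gate.costA := by
    funext g; cases g <;> rfl
  simp [Circuit.costA, Circuit.adj, this]

theorem Circuit.costB_adj (c : Circuit σ β W) : c.adj.costB = c.costB := by
  have : (Gate.costB ∘ Gate.adj : Gate σ β W → ℕ) = Gate.costB := by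
    funext g; cases g <;> rfl
  simp [Circuit.costB, Circuit.adj, this]

end Circuits

namespace VTAAEstimator

variable {σ β W : Type} [Fintype σ] [DecidableEq σ] [Fintype β] [DecidableEq β]
  [Fintype W] [DecidableEq W] (E : VTAAEstimator σ β W)
  (OA : Matrix.unitaryGroup β ℂ) (OB : Matrix.unitaryGroup σ ℂ)

/-! ### Nested amplitude amplification rescales the good part -/

/-- `Π_j Π_b`, the projection onto the states that have failed by stage `j`. -/
def failed (j : ℕ) : Matrix W W ℂ := E.clock j * E.flag

/-- The state `A_j ⋯ A_1 |ψ₀⟩` of the variable time algorithm without amplification. -/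
def plainState (l : ℕ) : ℕ → W → ℂ
  | 0 => Circuit.eval OA OB E.prep *ᵥ Pi.single E.start 1
  | j + 1 => Circuit.eval OA OB (E.input l (j + 1)) *ᵥ plainState l j

/-- The norm of the part of `A_j ⋯ A_1 |ψ₀⟩` that has not failed by stage `j`. -/
def plainAmp (l j : ℕ) : ℝ := vnorm ((1 - E.failed j) *ᵥ E.plainState OA OB l j)

/-- The factor by which nested amplification up to stage `j` multiplies the part of the state that
has not failed. -/
def gain (l : ℕ) : ℕ → ℝ
  | 0 => 1
  | j + 1 => if E.schedule l (j + 1) = 0 then gain l j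
      else gain l j * (3 - 4 * (gain l j * E.plainAmp OA OB l (j + 1)) ^ 2)

theorem isStarProjection_failed (j : ℕ) : IsStarProjection (E.failed j) :=
  E.isStarProjection_clock_mul_flag j

theorem clock_mul_clock_succ (j : ℕ) : E.clock (j + 1) * E.clock j = E.clock j := by
  suffices h : (1 - E.clock (j + 1)) * E.clock j = 0 by
    rw [Matrix.sub_mul, Matrix.one_mul, sub_eq_zero] at h
    exact h.symm
  refine Matrix.ext_of_mulVec_single fun x => ?_
  rw [← Matrix.mulVec_mulVec, Matrix.zero_mulVec]
  set u := E.clock j *ᵥ Pi.single x 1 with hu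
  have hPu : E.clock j *ᵥ u = u := by
    rw [hu, Matrix.mulVec_mulVec, (E.clock_proj j).isIdempotentElem.eq]
  -- on the range of the smaller projection the larger one preserves the norm
  have h1 := (E.clock_mono j).dotProduct_mulVec_nonneg u
  rw [Matrix.sub_mulVec, dotProduct_sub, star_dotProduct_proj_mulVec (E.clock_proj _),
    star_dotProduct_proj_mulVec (E.clock_proj _), hPu, ← Complex.ofReal_sub] at h1
  have h2 := Complex.zero_le_real.1 h1
  have h3 := vnorm_sq_add_compl (E.clock_proj (j + 1)) u
  have h4 : vnorm ((1 - E.clock (j + 1)) *ᵥ u) ^ 2 = 0 := by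
    nlinarith [sq_nonneg (vnorm ((1 - E.clock (j + 1)) *ᵥ u))]
  exact vnorm_eq_zero.1 (pow_eq_zero_iff two_ne_zero |>.1 h4)

theorem failed_mul_failed_succ (j : ℕ) : E.failed (j + 1) * E.failed j = E.failed j := by
  unfold failed
  rw [Matrix.mul_assoc, ← Matrix.mul_assoc E.flag, ← (E.flag_comm j).eq,
    Matrix.mul_assoc (E.clock j),
    E.flag_proj.isIdempotentElem.eq, ← Matrix.mul_assoc, clock_mul_clock_succ]

theorem failed_top : E.failed E.m = E.flag := by
  rw [failed, E.clock_top _ le_rfl, Matrix.one_mul]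

/-- An input algorithm acts on the part of the state that has not failed only. -/
theorem good_input (l : ℕ) {j : ℕ} (hj : j < E.m) (v : W → ℂ) :
    (1 - E.failed (j + 1)) *ᵥ (Circuit.eval OA OB (E.input l (j + 1)) *ᵥ v) =
      (1 - E.failed (j + 1)) *ᵥ (Circuit.eval OA OB (E.input l (j + 1)) *ᵥ
        ((1 - E.failed j) *ᵥ v)) := by
  have h : (1 - E.failed (j + 1)) * (Circuit.eval OA OB (E.input l (j + 1)) * E.failed j) = 0 := by
    have : Circuit.eval OA OB (E.input l (j + 1)) * E.failed j = E.failed j := by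
      rw [failed, ← Matrix.mul_assoc, E.input_clock OA OB l j hj]
    rw [this, Matrix.sub_mul, failed_mul_failed_succ, Matrix.one_mul, sub_self]
  simp only [Matrix.mulVec_mulVec, Matrix.mul_sub, Matrix.mul_one]
  rw [h, sub_zero]

/-- One round of amplitude amplification multiplies the good part of a unit vector by `3 - 4 a²`,
where `a` is its norm. -/
theorem good_amplify_one (V : Circuit σ β W) (j : ℕ) :
    (1 - E.failed j) *ᵥ (Circuit.eval OA OB (E.amplify V j 1) *ᵥ Pi.single E.start 1) =
      ((3 - 4 * vnorm ((1 - E.failed j) *ᵥ (Circuit.eval OA OB V *ᵥ Pi.single E.start 1)) ^ 2 : ℝ)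
        : ℂ) • ((1 - E.failed j) *ᵥ (Circuit.eval OA OB V *ᵥ Pi.single E.start 1)) := by
  set U := Circuit.eval OA OB V with hU
  set K := E.failed j with hK
  set φ := U *ᵥ Pi.single E.start 1 with hφ
  have hKP : IsStarProjection K := E.isStarProjection_failed j
  have hUU : U * Uᴴ = 1 := mul_eq_one_comm.1 (Circuit.eval_isometry OA OB V)
  have hφ1 : vnorm φ = 1 := by
    rw [hφ, vnorm_mulVec_of_isometry (Circuit.eval_isometry OA OB V), vnorm_single]
  have hev : Circuit.eval OA OB (E.amplify V j 1) =
      U * (2 * basisProj E.start - 1) * Uᴴ * (2 * K - 1) * U := by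
    simp only [amplify, Circuit.eval_append, Circuit.eval_singleton, Circuit.eval_adj, Gate.eval,
      reflection, Matrix.mul_assoc]
    rfl
  -- `⟨φ, (2 K - 1) φ⟩ = 1 - 2 ‖(1 - K) φ‖²`
  have hw : star φ ⬝ᵥ ((2 * K - 1) *ᵥ φ) =
      ((1 - 2 * vnorm ((1 - K) *ᵥ φ) ^ 2 : ℝ) : ℂ) := by
    have h3 := vnorm_sq_add_compl hKP φ
    rw [hφ1] at h3
    have h4 : star φ ⬝ᵥ φ = 1 := by rw [← ofReal_vnorm_sq, hφ1]; simp
    rw [two_mul, Matrix.sub_mulVec, Matrix.add_mulVec, dotProduct_sub, dotProduct_add,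
      star_dotProduct_proj_mulVec hKP, Matrix.one_mulVec, h4,
      show vnorm (K *ᵥ φ) ^ 2 = 1 - vnorm ((1 - K) *ᵥ φ) ^ 2 by linarith]
    push_cast
    ring
  have hb : ∀ w : W → ℂ, (2 * basisProj E.start - 1) *ᵥ w =
      (2 * w E.start) • Pi.single E.start 1 - w := by
    intro w
    rw [two_mul, Matrix.sub_mulVec, Matrix.add_mulVec, Matrix.one_mulVec]
    have : basisProj E.start *ᵥ w = w E.start • Pi.single E.start 1 := by
      ext i
      simp [basisProj, Matrix.mulVec, dotProduct, Matrix.single_apply, Pi.single_apply,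
        ite_and, eq_comm]
    rw [this, ← add_smul]; ring_nf
  have hst : (Uᴴ *ᵥ ((2 * K - 1) *ᵥ φ)) E.start = star φ ⬝ᵥ ((2 * K - 1) *ᵥ φ) := by
    rw [hφ, Matrix.star_mulVec, ← Matrix.dotProduct_mulVec]
    simp
  have hmain : Circuit.eval OA OB (E.amplify V j 1) *ᵥ Pi.single E.start 1 =
      ((2 * (1 - 2 * vnorm ((1 - K) *ᵥ φ) ^ 2) : ℝ) : ℂ) • φ - (2 * K - 1) *ᵥ φ := by
    rw [hev]
    simp only [← Matrix.mulVec_mulVec]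
    rw [← hφ, hb, hst, hw, Matrix.mulVec_sub, Matrix.mulVec_smul, ← hφ, Matrix.mulVec_mulVec _ U,
      hUU, Matrix.one_mulVec]
    push_cast
    rfl
  have hgood : (1 - K) * (2 * K - 1) = -(1 - K) := by
    have := hKP.isIdempotentElem.eq
    calc (1 - K) * (2 * K - 1) = 3 * K - 1 - 2 * (K * K) := by noncomm_ring
      _ = -(1 - K) := by rw [this]; noncomm_ring
  rw [hmain, Matrix.mulVec_sub, Matrix.mulVec_smul, Matrix.mulVec_mulVec φ, hgood,
    Matrix.neg_mulVec,
    sub_neg_eq_add]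
  push_cast
  module

/-- Nested amplification only rescales the part of the state that has not failed. -/
theorem good_amplified (l : ℕ) {j : ℕ} (hj : j ≤ E.m) :
    (1 - E.failed j) *ᵥ (Circuit.eval OA OB (E.amplified l j) *ᵥ Pi.single E.start 1) =
      (E.gain OA OB l j : ℂ) • ((1 - E.failed j) *ᵥ E.plainState OA OB l j) := by
  induction j with
  | zero => simp [amplified, gain, plainState]
  | succ j ih =>
    have hstep : (1 - E.failed (j + 1)) *ᵥ
        (Circuit.eval OA OB (E.amplified l j ++ E.input l (j + 1)) *ᵥ Pi.single E.start 1) =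
        (E.gain OA OB l j : ℂ) • ((1 - E.failed (j + 1)) *ᵥ E.plainState OA OB l (j + 1)) := by
      rw [Circuit.eval_append, ← Matrix.mulVec_mulVec, E.good_input OA OB l hj,
        ih (Nat.le_of_succ_le hj), plainState, E.good_input OA OB l hj (E.plainState OA OB l j),
        Matrix.mulVec_smul, Matrix.mulVec_smul]
    rw [amplified]
    by_cases hs : E.schedule l (j + 1) = 0
    · rw [gain, if_pos hs, hs, amplify, hstep]
    · have hs1 : E.schedule l (j + 1) = 1 := by
        unfold schedule at hs ⊢
        split_ifs at hs ⊢ <;> simp_all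
      rw [gain, if_neg hs, hs1, good_amplify_one, hstep, smul_smul, ← Complex.ofReal_mul]
      congr 2
      rw [vnorm_smul, Complex.norm_real, mul_pow, mul_pow, Real.norm_eq_abs, sq_abs, plainAmp]
      ring

theorem colNorm_amplified (l : ℕ) :
    colNorm ((1 - E.flag) * Circuit.eval OA OB (E.amplified l E.m)) E.start =
      |E.gain OA OB l E.m| * E.plainAmp OA OB l E.m := by
  rw [colNorm_eq_vnorm, ← Matrix.mulVec_mulVec, ← E.failed_top, E.good_amplified OA OB l le_rfl,
    vnorm_smul, Complex.norm_real, Real.norm_eq_abs, plainAmp]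

end VTAAEstimator

/-! ### Size of the amplified amplitude -/

/-- Amplification with the exact factor `3 - 4 a²` per stage is amplification by `3` per stage up to
a relative loss that is at most `4/3` times the sum of the squared amplitudes. -/
theorem gain_bounds (g n : ℕ → ℝ) (l : ℕ) (h0 : g 0 = 1)
    (hg : ∀ t < l, g (t + 1) = g t * (3 - 4 * (g t * n t) ^ 2))
    (hn : ∑ t ∈ Finset.range l, 9 ^ t * n t ^ 2 ≤ 5 / 36) :
    ∀ t ≤ l, g t ≤ 3 ^ t ∧
      3 ^ t * (1 - 4 / 3 * ∑ s ∈ Finset.range t, 9 ^ s * n s ^ 2) ≤ g t := by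
  intro t
  induction t with
  | zero => intro _; simp [h0]
  | succ t ih =>
    intro ht
    obtain ⟨h1, h2⟩ := ih (Nat.le_of_succ_le ht)
    have hsum : ∀ k ≤ l, ∑ s ∈ Finset.range k, 9 ^ s * n s ^ 2 ≤ 5 / 36 := fun k hk =>
      (Finset.sum_le_sum_of_subset_of_nonneg (Finset.range_mono hk)
        fun i _ _ => by positivity).trans hn
    have hs1 := hsum _ ht
    rw [Finset.sum_range_succ] at hs1 ⊢
    set s := ∑ s ∈ Finset.range t, 9 ^ s * n s ^ 2 with hs
    have hs0 : 0 ≤ s := Finset.sum_nonneg fun i _ => by positivity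
    have hp : (0 : ℝ) < 3 ^ t := by positivity
    have hx0 : 0 ≤ 9 ^ t * n t ^ 2 := by positivity
    have hg0 : 0 ≤ g t := le_trans (by apply mul_nonneg hp.le; linarith) h2
    have h9 : (9 : ℝ) ^ t = (3 ^ t) ^ 2 := by rw [← pow_mul, mul_comm, pow_mul]; norm_num
    have hx : (g t * n t) ^ 2 ≤ 9 ^ t * n t ^ 2 := by
      rw [mul_pow, h9]
      exact mul_le_mul_of_nonneg_right (pow_le_pow_left₀ hg0 h1 2) (sq_nonneg _)
    rw [hg t ht, pow_succ]
    set x := 9 ^ t * n t ^ 2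
    refine ⟨mul_le_mul h1 (by nlinarith [sq_nonneg (g t * n t)]) (by linarith) hp.le, ?_⟩
    calc 3 ^ t * 3 * (1 - 4 / 3 * (s + x))
        ≤ (3 ^ t * (1 - 4 / 3 * s)) * (3 - 4 * x) := by
          nlinarith [mul_nonneg hp.le (mul_nonneg hs0 hx0)]
      _ ≤ g t * (3 - 4 * x) := mul_le_mul_of_nonneg_right h2 (by linarith)
      _ ≤ g t * (3 - 4 * (g t * n t) ^ 2) := mul_le_mul_of_nonneg_left (by linarith) hg0

namespace VTAAEstimator

variable {σ β W : Type} [Fintype σ] [DecidableEq σ] [Fintype β] [DecidableEq β]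
  [Fintype W] [DecidableEq W] (E : VTAAEstimator σ β W)
  (OA : Matrix.unitaryGroup β ℂ) (OB : Matrix.unitaryGroup σ ℂ)

theorem gain_eq_one (l : ℕ) {j : ℕ} (hj : j ≤ E.m - l) : E.gain OA OB l j = 1 := by
  induction j with
  | zero => rfl
  | succ j ih =>
    rw [gain, if_pos, ih (by omega)]
    simp only [schedule]
    rw [if_neg (by omega)]

/-- The success amplitude of the nested amplitude amplification with pre-merging parameter `l`. -/
def successAmp (l : ℕ) : ℝ :=
  colNorm ((1 - E.flag) * Circuit.eval OA OB (E.amplified l E.m)) E.start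

theorem successAmp_bounds {l : ℕ} (hl : l ≤ E.m)
    (hsum : ∑ j ∈ Finset.range E.m, 9 ^ (j + 1) * E.plainAmp OA OB l (j + 1) ^ 2 ≤
      5 / 4 * (9 ^ E.m * E.plainAmp OA OB l E.m ^ 2))
    (hS : 3 ^ l * E.plainAmp OA OB l E.m ≤ 1) :
    22 / 27 * (3 ^ l * E.plainAmp OA OB l E.m) ≤ E.successAmp OA OB l ∧
      E.successAmp OA OB l ≤ 3 ^ l * E.plainAmp OA OB l E.m := by
  obtain ⟨d, hd⟩ := Nat.exists_eq_add_of_le' hl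
  set N := E.plainAmp OA OB l with hN
  have hS0 : 0 ≤ N E.m := vnorm_nonneg _
  have hn : ∑ t ∈ Finset.range l, 9 ^ t * N (d + t + 1) ^ 2 ≤ 5 / 36 := by
    have h1 : ∑ t ∈ Finset.range l, (9 : ℝ) ^ (d + t + 1) * N (d + t + 1) ^ 2 ≤
        ∑ j ∈ Finset.range E.m, 9 ^ (j + 1) * N (j + 1) ^ 2 := by
      rw [hd, Finset.sum_range_add]
      exact le_add_of_nonneg_left (Finset.sum_nonneg fun i _ => by positivity)
    have h2 : ∑ t ∈ Finset.range l, (9 : ℝ) ^ (d + t + 1) * N (d + t + 1) ^ 2 =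
        9 ^ (d + 1) * ∑ t ∈ Finset.range l, 9 ^ t * N (d + t + 1) ^ 2 := by
      rw [Finset.mul_sum]
      exact Finset.sum_congr rfl fun t _ => by ring
    have h3 : (9 : ℝ) ^ E.m * N E.m ^ 2 ≤ 9 ^ d := by
      have : (3 ^ l * N E.m) ^ 2 ≤ 1 := pow_le_one₀ (by positivity) hS
      have h9 : (9 : ℝ) ^ l = (3 ^ l) ^ 2 := by rw [← pow_mul, mul_comm, pow_mul]; norm_num
      rw [mul_pow, ← h9] at this
      calc (9 : ℝ) ^ E.m * N E.m ^ 2 = 9 ^ d * (9 ^ l * N E.m ^ 2) := by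
            rw [hd, pow_add]; simp only [← hd]; ring
        _ ≤ 9 ^ d := mul_le_of_le_one_right (by positivity) this
    rw [h2] at h1
    have h4 : (0 : ℝ) < 9 ^ d := by positivity
    have h5 : 9 ^ (d + 1) * ∑ t ∈ Finset.range l, 9 ^ t * N (d + t + 1) ^ 2 ≤
        9 ^ (d + 1) * (5 / 36) := by
      rw [pow_succ (9 : ℝ) d] at h1 ⊢
      linarith
    exact le_of_mul_le_mul_left h5 (by positivity)
  have hb := gain_bounds (fun t => E.gain OA OB l (d + t)) (fun t => N (d + t + 1)) l
    (E.gain_eq_one OA OB l (by omega))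
    (fun t ht => by
      change E.gain OA OB l (d + t + 1) = _
      rw [gain, if_neg]
      simp only [schedule]
      rw [if_pos (by omega)]
      exact one_ne_zero) hn l le_rfl
  simp only [← hd] at hb
  have hg : 3 ^ l * (22 / 27) ≤ E.gain OA OB l E.m :=
    le_trans (mul_le_mul_of_nonneg_left (by linarith) (by positivity)) hb.2
  have hg0 : 0 ≤ E.gain OA OB l E.m := le_trans (by positivity) hg
  rw [successAmp, colNorm_amplified, abs_of_nonneg hg0]
  constructor
  · calc 22 / 27 * (3 ^ l * N E.m) = 3 ^ l * (22 / 27) * N E.m := by ring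
      _ ≤ _ := mul_le_mul_of_nonneg_right hg hS0
  · exact mul_le_mul_of_nonneg_right hb.1 hS0

/-! ### Output distribution of the estimation algorithm -/

theorem prob_nonneg (S : Set ℝ) (q : QAlg σ β W) : 0 ≤ QAlg.prob OA OB S q := by
  induction q with
  | done y => exact Set.indicator_nonneg (fun _ _ => zero_le_one) _
  | step c x P hP next ih =>
    exact add_nonneg (mul_nonneg (sq_nonneg _) (ih true)) (mul_nonneg (sq_nonneg _) (ih false))

theorem successAmp_sq_le_one (l : ℕ) : E.successAmp OA OB l ^ 2 ≤ 1 := by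
  have h := vnorm_sq_add_compl E.flag_proj.one_sub
    (Circuit.eval OA OB (E.amplified l E.m) *ᵥ Pi.single E.start 1)
  rw [vnorm_mulVec_of_isometry (Circuit.eval_isometry OA OB _), vnorm_single] at h
  rw [successAmp, colNorm_eq_vnorm, ← Matrix.mulVec_mulVec]
  nlinarith [sq_nonneg (vnorm ((1 - (1 - E.flag)) *ᵥ
    (Circuit.eval OA OB (E.amplified l E.m) *ᵥ Pi.single E.start 1)))]

theorem prob_step (S : Set ℝ) (l : ℕ) (next : Bool → QAlg σ β W) :
    QAlg.prob OA OB S (.step (E.amplified l E.m) E.start (1 - E.flag) E.flag_proj.one_sub next) =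
      E.successAmp OA OB l ^ 2 * QAlg.prob OA OB S (next true) +
        (1 - E.successAmp OA OB l ^ 2) * QAlg.prob OA OB S (next false) := by
  have h := vnorm_sq_add_compl E.flag_proj.one_sub
    (Circuit.eval OA OB (E.amplified l E.m) *ᵥ Pi.single E.start 1)
  rw [vnorm_mulVec_of_isometry (Circuit.eval_isometry OA OB _), vnorm_single, one_pow] at h
  rw [QAlg.prob, successAmp, colNorm_eq_vnorm, colNorm_eq_vnorm, ← Matrix.mulVec_mulVec,
    ← Matrix.mulVec_mulVec, ← h]
  ring

/-- If the continuation only depends on whether a good outcome has occurred, the outcome of the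
sampling is decided by the probability that none of the samples is good. -/
theorem prob_sample (S : Set ℝ) (l : ℕ) (next : ℕ → QAlg σ β W) (y : ℝ)
    (hy : ∀ g, QAlg.prob OA OB S (next (g + 1)) = y) (k : ℕ) :
    (∀ g, QAlg.prob OA OB S (E.sample l next k (g + 1)) = y) ∧
      QAlg.prob OA OB S (E.sample l next k 0) =
        (1 - E.successAmp OA OB l ^ 2) ^ k * QAlg.prob OA OB S (next 0) +
          (1 - (1 - E.successAmp OA OB l ^ 2) ^ k) * y := by
  induction k with
  | zero => simp [sample, hy]
  | succ k ih =>
    refine ⟨fun g => ?_, ?_⟩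
    · rw [sample, prob_step]
      simp only [cond_true, cond_false, ih.1]
      ring
    · rw [sample, prob_step]
      simp only [cond_true, cond_false, ih.1, ih.2, pow_succ]
      ring

/-- One level of the loop, when the threshold is so low that one good outcome reaches it. -/
theorem prob_loop_succ (S : Set ℝ) {l : ℕ} (hr : E.runs l ≠ 0) (h0 : 0 < E.threshold)
    (h1 : E.threshold ≤ √(1 / E.runs l)) (fuel : ℕ) :
    QAlg.prob OA OB S (E.loop (fuel + 1) l) =
      (1 - E.successAmp OA OB l ^ 2) ^ E.runs l * QAlg.prob OA OB S (E.loop fuel (l + 1)) +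
        (1 - (1 - E.successAmp OA OB l ^ 2) ^ E.runs l) * S.indicator 1 (E.output l) := by
  rw [loop, (E.prob_sample OA OB S l _ (S.indicator 1 (E.output l)) _ _).2]
  · rw [if_neg (by simpa using h0)]
  · intro g
    rw [if_pos, QAlg.prob]
    refine h1.trans (Real.sqrt_le_sqrt ?_)
    gcongr
    push_cast
    linarith [(Nat.cast_nonneg g : (0 : ℝ) ≤ g)]

/-- The algorithm stops at `L`, `L - 1` or `L - 2` with probability greater than `1/2` if the
success amplitude is bounded below at `L` and decreases geometrically below `L`. -/
theorem half_lt_prob_algorithm (S : Set ℝ) (L : ℕ) (hL1 : 1 ≤ L) (hL : L ≤ E.levels)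
    (hr : ∀ l, E.runs l = 32) (h0 : 0 < E.threshold) (h1 : E.threshold ≤ √(1 / 32))
    (hup : ∀ l ≤ L, E.successAmp OA OB l ^ 2 ≤ 9 ^ l / 9 ^ L)
    (hlow : (22 / 81) ^ 2 ≤ E.successAmp OA OB L ^ 2)
    (hS : ∀ l ≤ L, L ≤ l + 2 → E.output l ∈ S) :
    1 / 2 < E.algorithm.prob OA OB S := by
  have hstep : ∀ l fuel, QAlg.prob OA OB S (E.loop (fuel + 1) l) =
      (1 - E.successAmp OA OB l ^ 2) ^ 32 * QAlg.prob OA OB S (E.loop fuel (l + 1)) +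
        (1 - (1 - E.successAmp OA OB l ^ 2) ^ 32) * S.indicator 1 (E.output l) := by
    intro l fuel
    have := E.prob_loop_succ OA OB S (l := l) (by simp [hr]) h0 (by simpa [hr] using h1) fuel
    rwa [hr] at this
  have hr0 : ∀ l, 0 ≤ (1 - E.successAmp OA OB l ^ 2) ^ 32 := fun l =>
    pow_nonneg (by linarith [E.successAmp_sq_le_one OA OB l]) _
  have hr1 : ∀ l, (1 - E.successAmp OA OB l ^ 2) ^ 32 ≤ 1 := fun l =>
    pow_le_one₀ (by linarith [E.successAmp_sq_le_one OA OB l])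
      (by linarith [sq_nonneg (E.successAmp OA OB l)])
  have hin : ∀ l ≤ L, L ≤ l + 2 → S.indicator (1 : ℝ → ℝ) (E.output l) = 1 := fun l h h' => by
    rw [Set.indicator_of_mem (hS l h h')]; rfl
  -- within the window, stopping is right and at `L` it is likely
  have hwin : ∀ d ≤ 2, d ≤ L → ∀ fuel, d < fuel →
      3 / 4 ≤ QAlg.prob OA OB S (E.loop fuel (L - d)) := by
    intro d
    induction d with
    | zero =>
      intro _ _ fuel hf
      obtain ⟨f, rfl⟩ : ∃ f, fuel = f + 1 := ⟨fuel - 1, by omega⟩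
      rw [Nat.sub_zero, hstep, hin L le_rfl (by omega)]
      have h2 : (1 - E.successAmp OA OB L ^ 2) ^ 32 ≤ 1 / 4 := by
        refine (pow_le_pow_left₀ (by linarith [E.successAmp_sq_le_one OA OB L])
          (sub_le_sub_left hlow 1) 32).trans ?_
        norm_num
      nlinarith [mul_nonneg (hr0 L) (prob_nonneg OA OB S (E.loop f (L + 1)))]
    | succ d ih =>
      intro h2 h3 fuel hf
      obtain ⟨f, rfl⟩ : ∃ f, fuel = f + 1 := ⟨fuel - 1, by omega⟩
      have := ih (by omega) (by omega) f (by omega)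
      rw [hstep, hin _ (by omega) (by omega), show L - (d + 1) + 1 = L - d by omega]
      nlinarith [hr0 (L - (d + 1)), hr1 (L - (d + 1))]
  -- below the window, the probabilities of stopping add up to at most `4 / 81`
  have hbelow : ∀ d ≤ L, 2 ≤ d → ∀ fuel, d < fuel →
      3 / 4 - 4 / 81 + 4 * (9 ^ (L - d) / 9 ^ L) ≤ QAlg.prob OA OB S (E.loop fuel (L - d)) := by
    intro d
    induction d with
    | zero => intro _ h; omega
    | succ d ih =>
      intro h2 h3 fuel hf
      rcases Nat.lt_or_ge d 2 with hd | hd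
      · refine le_trans (le_of_eq ?_) (hwin (d + 1) (by omega) h2 fuel hf)
        have hd1 : d = 1 := by omega
        subst hd1
        obtain ⟨k, rfl⟩ : ∃ k, L = k + 2 := ⟨L - 2, by omega⟩
        rw [show k + 2 - (1 + 1) = k by omega, pow_add]
        field_simp
        norm_num
      · obtain ⟨f, rfl⟩ : ∃ f, fuel = f + 1 := ⟨fuel - 1, by omega⟩
        have hi := ih (by omega) hd f (by omega)
        rw [hstep, show L - (d + 1) + 1 = L - d by omega]
        obtain ⟨k, hk⟩ : ∃ k, L - d = k + 1 := ⟨L - d - 1, by omega⟩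
        have hk' : L - (d + 1) = k := by omega
        rw [hk, pow_succ] at hi
        rw [hk, hk']
        have hpk := hup k (by omega)
        have hbern : 1 - 32 * E.successAmp OA OB k ^ 2 ≤ (1 - E.successAmp OA OB k ^ 2) ^ 32 := by
          have := one_add_mul_le_pow (a := -E.successAmp OA OB k ^ 2)
            (by linarith [E.successAmp_sq_le_one OA OB k]) 32
          push_cast at this
          rw [sub_eq_add_neg]
          linarith
        have hq : (9 : ℝ) ^ k * 9 / 9 ^ L ≤ 1 / 81 := by
          rw [div_le_div_iff₀ (by positivity) (by norm_num), ← pow_succ, ← hk,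
            show (81 : ℝ) = 9 ^ 2 by norm_num, ← pow_add, one_mul]
          exact pow_le_pow_right₀ (by norm_num) (by omega)
        have hi0 : (0 : ℝ) ≤ S.indicator 1 (E.output k) :=
          Set.indicator_nonneg (fun _ _ => zero_le_one) _
        set r := (1 - E.successAmp OA OB k ^ 2) ^ 32
        set B := 3 / 4 - 4 / 81 + 4 * ((9 : ℝ) ^ k * 9 / 9 ^ L) with hB
        have hB1 : B ≤ 1 := by rw [hB]; linarith
        have h5 : B - (1 - r) ≤ r * B := by nlinarith [hr1 k]
        have h6 : r * B ≤ r * QAlg.prob OA OB S (E.loop f (k + 1)) :=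
          mul_le_mul_of_nonneg_left hi (hr0 k)
        have h7 : 0 ≤ (1 - r) * S.indicator 1 (E.output k) :=
          mul_nonneg (by linarith [hr1 k]) hi0
        have h8 : (9 : ℝ) ^ k * 9 / 9 ^ L = 9 * (9 ^ k / 9 ^ L) := by ring
        linarith
  rw [algorithm]
  rcases Nat.lt_or_ge (L - 1) 2 with h | h
  · have := hwin (L - 1) (by omega) (by omega) E.levels (by omega)
    rw [show L - (L - 1) = 1 by omega] at this
    linarith
  · have := hbelow (L - 1) (by omega) h E.levels (by omega)
    rw [show L - (L - 1) = 1 by omega] at this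
    have h9 : (0 : ℝ) ≤ 4 * (9 ^ 1 / 9 ^ L) := by positivity
    linarith

/-! ### Query complexity of the estimation algorithm -/

theorem costA_amplify (V : Circuit σ β W) (j r : ℕ) :
    (E.amplify V j r).costA = (2 * r + 1) * V.costA := by
  induction r with
  | zero => simp [amplify]
  | succ r ih =>
    have h : ∀ U, Circuit.costA [(Gate.free U : Gate σ β W)] = 0 := fun U => rfl
    simp only [amplify, Circuit.costA_append, ih, Circuit.costA_adj, h]
    ring

theorem costB_amplify (V : Circuit σ β W) (j r : ℕ) :
    (E.amplify V j r).costB = (2 * r + 1) * V.costB := by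
  induction r with
  | zero => simp [amplify]
  | succ r ih =>
    have h : ∀ U, Circuit.costB [(Gate.free U : Gate σ β W)] = 0 := fun U => rfl
    simp only [amplify, Circuit.costB_append, ih, Circuit.costB_adj, h]
    ring

theorem costB_amplified (l j : ℕ) :
    (E.amplified l j).costB = 3 ^ (j - (E.m - l)) := by
  induction j with
  | zero => simp [amplified, E.prep_costB]
  | succ j ih =>
    rw [amplified, costB_amplify, Circuit.costB_append, ih, E.input_costB, add_zero, schedule]
    split_ifs with h
    · rw [show j + 1 - (E.m - l) = j - (E.m - l) + 1 by omega, pow_succ]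
      ring
    · rw [show j + 1 - (E.m - l) = 0 by omega, show j - (E.m - l) = 0 by omega]
      norm_num

/-- If the cost of the input algorithms grows at most like `3 ^ j`, all stages contribute equally to
the cost of the nested amplification. -/
theorem costA_amplified_le {l : ℕ} {κ : ℝ}
    (hc : ∀ j < E.m, ((E.input l (j + 1)).costA : ℝ) * 3 ^ E.m ≤ κ * 3 ^ (j + 1)) {j : ℕ}
    (hj : j ≤ E.m) : ((E.amplified l j).costA : ℝ) * 3 ^ E.m ≤ 3 * κ * j * 3 ^ j := by
  induction j with
  | zero => simp [amplified, E.prep_costA]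
  | succ j ih =>
    have h1 := ih (by omega)
    have h2 := hc j (by omega)
    rw [amplified, costA_amplify, Circuit.costA_append]
    have h3 : ((2 * E.schedule l (j + 1) + 1 : ℕ) : ℝ) ≤ 3 := by
      unfold schedule; split_ifs <;> norm_num
    rw [Nat.cast_mul, mul_assoc]
    calc _ ≤ 3 * (((Circuit.costA (E.amplified l j) + Circuit.costA (E.input l (j + 1)) : ℕ) : ℝ)
            * 3 ^ E.m) := mul_le_mul_of_nonneg_right h3 (by positivity)
      _ ≤ _ := by
        push_cast
        rw [pow_succ] at h2 ⊢
        linarith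

theorem costA_sample_le (l : ℕ) (next : ℕ → QAlg σ β W) (D : ℕ)
    (hD : ∀ g, (next g).costA ≤ D) (k g : ℕ) :
    (E.sample l next k g).costA ≤ k * (E.amplified l E.m).costA + D := by
  induction k generalizing g with
  | zero => simpa [sample] using hD g
  | succ k ih =>
    rw [sample, QAlg.costA, Nat.succ_mul]
    have := max_le (ih (bif true then g + 1 else g)) (ih (bif false then g + 1 else g))
    omega

theorem costB_sample_le (l : ℕ) (next : ℕ → QAlg σ β W) (D : ℕ)
    (hD : ∀ g, (next g).costB ≤ D) (k g : ℕ) :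
    (E.sample l next k g).costB ≤ k * (E.amplified l E.m).costB + D := by
  induction k generalizing g with
  | zero => simpa [sample] using hD g
  | succ k ih =>
    rw [sample, QAlg.costB, Nat.succ_mul]
    have := max_le (ih (bif true then g + 1 else g)) (ih (bif false then g + 1 else g))
    omega

theorem costA_loop_le (fuel l : ℕ) :
    (E.loop fuel l).costA ≤
      ∑ i ∈ Finset.range fuel, E.runs (l + i) * (E.amplified (l + i) E.m).costA := by
  induction fuel generalizing l with
  | zero => simp [loop, QAlg.costA]
  | succ fuel ih =>
    rw [loop, Finset.sum_range_succ', add_comm (Finset.sum _ _), add_zero]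
    refine E.costA_sample_le l _ _ (fun g => ?_) _ _
    split_ifs
    · simp [QAlg.costA]
    · simpa only [add_right_comm, ← add_assoc] using ih (l + 1)

theorem costB_loop_le (fuel l : ℕ) :
    (E.loop fuel l).costB ≤
      ∑ i ∈ Finset.range fuel, E.runs (l + i) * (E.amplified (l + i) E.m).costB := by
  induction fuel generalizing l with
  | zero => simp [loop, QAlg.costB]
  | succ fuel ih =>
    rw [loop, Finset.sum_range_succ', add_comm (Finset.sum _ _), add_zero]
    refine E.costB_sample_le l _ _ (fun g => ?_) _ _
    split_ifs
    · simp [QAlg.costB]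
    · simpa only [add_right_comm, ← add_assoc] using ih (l + 1)

theorem costB_algorithm_le (hr : ∀ l, E.runs l = 32) (hL : E.levels = E.m) :
    E.algorithm.costB ≤ 48 * 3 ^ E.m := by
  refine (E.costB_loop_le _ _).trans ?_
  have h : ∀ n, ∑ i ∈ Finset.range n, 32 * 3 ^ (1 + i) ≤ 48 * 3 ^ n := by
    intro n
    induction n with
    | zero => simp
    | succ n ih =>
      rw [Finset.sum_range_succ]
      calc _ ≤ 48 * 3 ^ n + 32 * 3 ^ (1 + n) := Nat.add_le_add_right ih _
        _ = 48 * 3 ^ (n + 1) := by ring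
  rw [hL]
  refine le_trans (le_of_eq (Finset.sum_congr rfl fun i hi => ?_)) (h E.m)
  have := Finset.mem_range.1 hi
  rw [hr, E.costB_amplified, show E.m - (E.m - (1 + i)) = 1 + i by omega]

theorem costA_algorithm_le {κ : ℝ} (hr : ∀ l, E.runs l = 32) (hL : E.levels = E.m)
    (hc : ∀ l, ∀ j < E.m, ((E.input l (j + 1)).costA : ℝ) * 3 ^ E.m ≤ κ * 3 ^ (j + 1)) :
    (E.algorithm.costA : ℝ) ≤ 96 * κ * E.m ^ 2 := by
  have h1 : (E.algorithm.costA : ℝ) ≤ (∑ i ∈ Finset.range E.levels,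
      E.runs (1 + i) * (E.amplified (1 + i) E.m).costA : ℕ) := by
    exact_mod_cast E.costA_loop_le _ _
  refine h1.trans ?_
  push_cast
  rw [hL]
  calc _ ≤ ∑ _i ∈ Finset.range E.m, 96 * κ * E.m := by
        refine Finset.sum_le_sum fun i _ => ?_
        have h2 := E.costA_amplified_le (hc (1 + i)) le_rfl
        have h3 := le_of_mul_le_mul_right h2 (by positivity)
        rw [hr]
        push_cast
        linarith
    _ = 96 * κ * E.m ^ 2 := by
        rw [Finset.sum_const, Finset.card_range, nsmul_eq_mul]
        ring

end VTAAEstimator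

/-! ### Good mass of a variable time process -/

/-- The good mass after stage `n` if `μ j` is the mass that is still active after stage `j`, and if
the fraction `9 ^ (j + 1) / 9 ^ m` of the mass that stops at stage `j + 1` is good. -/
def goodMass (μ : ℕ → ℝ) (m n : ℕ) : ℝ :=
  μ n + ∑ j ∈ Finset.range n, 9 ^ (j + 1) / 9 ^ m * (μ j - μ (j + 1))

theorem goodMass_top (μ : ℕ → ℝ) (m : ℕ) :
    9 ^ m * goodMass μ m m = μ 0 + 8 * ∑ j ∈ Finset.range m, 9 ^ j * μ j := by
  have h : ∀ n, ∑ j ∈ Finset.range n, (9 : ℝ) ^ (j + 1) * (μ j - μ (j + 1)) =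
      μ 0 + 8 * ∑ j ∈ Finset.range n, 9 ^ j * μ j - 9 ^ n * μ n := by
    intro n
    induction n with
    | zero => simp
    | succ n ih =>
      rw [Finset.sum_range_succ, ih, Finset.sum_range_succ]
      ring
  have h2 : ∑ j ∈ Finset.range m, (9 : ℝ) ^ (j + 1) / 9 ^ m * (μ j - μ (j + 1)) =
      (∑ j ∈ Finset.range m, (9 : ℝ) ^ (j + 1) * (μ j - μ (j + 1))) / 9 ^ m := by
    rw [Finset.sum_div]
    exact Finset.sum_congr rfl fun j _ => by ring
  rw [goodMass, h2, h]
  field_simp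
  ring

/-- The amplitudes before amplification are dominated by a geometric sequence in an averaged sense,
by summation by parts. -/
theorem sum_goodMass_le {μ : ℕ → ℝ} (hμ : ∀ j, μ (j + 1) ≤ μ j) (h0 : ∀ j, 0 ≤ μ j) (m : ℕ) :
    ∑ j ∈ Finset.range m, 9 ^ (j + 1) * goodMass μ m (j + 1) ≤
      5 / 4 * (9 ^ m * goodMass μ m m) := by
  have hle : ∀ n ≤ m, goodMass μ m n ≤ μ n + goodMass μ m m := by
    intro n hn
    have : ∑ j ∈ Finset.range n, (9 : ℝ) ^ (j + 1) / 9 ^ m * (μ j - μ (j + 1)) ≤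
        ∑ j ∈ Finset.range m, (9 : ℝ) ^ (j + 1) / 9 ^ m * (μ j - μ (j + 1)) :=
      Finset.sum_le_sum_of_subset_of_nonneg (Finset.range_mono hn)
        fun j _ _ => mul_nonneg (by positivity) (sub_nonneg.2 (hμ j))
    simp only [goodMass]
    linarith [h0 m]
  have htop := goodMass_top μ m
  cases m with
  | zero => simpa [goodMass] using h0 0
  | succ m =>
    set S := goodMass μ (m + 1) (m + 1) with hS
    have hs : ∀ n, ∑ j ∈ Finset.range n, (9 : ℝ) ^ (j + 1) ≤ 9 ^ (n + 1) / 8 := by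
      intro n
      induction n with
      | zero => norm_num
      | succ n ih => rw [Finset.sum_range_succ, pow_succ (9 : ℝ) (n + 1)]; linarith
    have hS0 : 0 ≤ S := by
      have : 0 ≤ 9 ^ (m + 1) * S := by
        rw [htop]
        exact add_nonneg (h0 _) (mul_nonneg (by norm_num)
          (Finset.sum_nonneg fun j _ => mul_nonneg (by positivity) (h0 j)))
      exact nonneg_of_mul_nonneg_right this (by positivity)
    rw [Finset.sum_range_succ]
    have h1 : ∑ j ∈ Finset.range m, (9 : ℝ) ^ (j + 1) * goodMass μ (m + 1) (j + 1) ≤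
        ∑ j ∈ Finset.range m, ((9 : ℝ) ^ (j + 1) * μ (j + 1) + 9 ^ (j + 1) * S) := by
      refine Finset.sum_le_sum fun j hj => ?_
      rw [← mul_add]
      have := Finset.mem_range.1 hj
      exact mul_le_mul_of_nonneg_left (hle _ (by omega)) (by positivity)
    rw [Finset.sum_add_distrib, ← Finset.sum_mul] at h1
    have h2 := mul_le_mul_of_nonneg_right (hs m) hS0
    rw [Finset.sum_range_succ'] at htop
    have := h0 0
    simp only [pow_zero, one_mul] at htop
    linarith

/-- If stage `j + 1` of a variable time process with unit mass stops almost nothing while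
`Q ≫ 9 ^ (j + 1)` and almost everything when `Q ≪ 9 ^ (j + 1)`, its good mass is `Q / 9 ^ m` up to
constants. -/
theorem goodMass_bounds {F μ : ℕ → ℝ} {m : ℕ} {Q : ℝ} (hQ : 0 < Q) (hQm : Q ≤ 9 ^ m)
    (hμ0 : μ 0 = 1) (hμ : ∀ j, μ (j + 1) = μ j * F j) (hF0 : ∀ j, 0 ≤ F j) (hF1 : ∀ j, F j ≤ 1)
    (hup : ∀ j < m, F j ≤ Q / 9 ^ (j + 1)) (hlow : ∀ j < m, 1 - 4 * (9 ^ (j + 1) / Q) ≤ F j) :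
    Q / 81 ≤ 9 ^ m * goodMass μ m m ∧ 9 ^ m * goodMass μ m m ≤ 81 + 180 * Q := by
  have hμn : ∀ j, 0 ≤ μ j ∧ μ j ≤ 1 := by
    intro j
    induction j with
    | zero => simp [hμ0]
    | succ j ih =>
      rw [hμ]
      exact ⟨mul_nonneg ih.1 (hF0 j), mul_le_one₀ ih.2 (hF0 j) (hF1 j)⟩
  rw [goodMass_top, hμ0]
  constructor
  · have hsum0 : 0 ≤ ∑ j ∈ Finset.range m, 9 ^ j * μ j :=
      Finset.sum_nonneg fun j _ => mul_nonneg (by positivity) (hμn j).1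
    rcases le_or_gt Q 81 with h | h
    · linarith
    obtain ⟨n, hn1, hn2⟩ := exists_nat_pow_near (show (1 : ℝ) ≤ Q by linarith)
      (show (1 : ℝ) < 9 by norm_num)
    have hn0 : 2 ≤ n := by
      by_contra hc
      have : (9 : ℝ) ^ (n + 1) ≤ 9 ^ 2 := pow_le_pow_right₀ (by norm_num) (by omega)
      linarith
    obtain ⟨j, rfl⟩ : ∃ j, n = j + 1 := ⟨n - 1, by omega⟩
    have hjm : j < m := by
      have := (pow_le_pow_iff_right₀ (show (1 : ℝ) < 9 by norm_num)).1 (hn1.trans hQm)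
      omega
    -- the mass that is active after stage `j`, where `9 ^ j` is within a constant of `Q`
    have hact : ∀ i ≤ m, 1 - 9 / 2 * (9 ^ i / Q) ≤ μ i := by
      intro i
      induction i with
      | zero => intro _; rw [hμ0]; linarith [show (0 : ℝ) ≤ 9 / 2 * (9 ^ 0 / Q) by positivity]
      | succ i ih =>
        intro hi
        have h1 := ih (by omega)
        have h2 := hlow i (by omega)
        have h3 : μ i * (1 - F i) ≤ 1 - F i :=
          mul_le_of_le_one_left (by linarith [hF1 i]) (hμn i).2
        have h4 : (9 : ℝ) ^ (i + 1) / Q = 9 * (9 ^ i / Q) := by rw [pow_succ]; ring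
        rw [hμ]
        rw [h4] at h2 ⊢
        linarith
    have h1 := hact j hjm.le
    have h2 : (9 : ℝ) ^ j / Q ≤ 1 / 9 := by
      rw [div_le_div_iff₀ hQ (by norm_num), ← pow_succ, one_mul]; exact hn1
    have h3 : Q ≤ 9 ^ j * 81 := by rw [pow_succ, pow_succ] at hn2; linarith
    have h4 : 9 ^ j * μ j ≤ ∑ j ∈ Finset.range m, 9 ^ j * μ j :=
      Finset.single_le_sum (f := fun j => 9 ^ j * μ j)
        (fun i _ => mul_nonneg (by positivity) (hμn i).1) (Finset.mem_range.2 hjm)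
    have h5 : (9 : ℝ) ^ j * (1 / 2) ≤ 9 ^ j * μ j :=
      mul_le_mul_of_nonneg_left (by linarith) (by positivity)
    linarith
  · -- the summands are dominated by the increments of `q ↦ q / (1 + q)` along `q = Q / 9 ^ j`
    have hsum : ∀ n, n + 2 ≤ m + 1 → ∑ j ∈ Finset.range (n + 2), 9 ^ j * μ j ≤
        10 + 45 / 2 * Q * (1 - (Q / 9 ^ (n + 2)) / (1 + Q / 9 ^ (n + 2))) := by
      intro n
      induction n with
      | zero =>
        intro _
        have : (Q / 9 ^ (0 + 2)) / (1 + Q / 9 ^ (0 + 2)) ≤ 1 :=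
          div_le_one_of_le₀ (by linarith) (by positivity)
        have h1 : 0 ≤ 45 / 2 * Q * (1 - (Q / 9 ^ (0 + 2)) / (1 + Q / 9 ^ (0 + 2))) :=
          mul_nonneg (by positivity) (by linarith)
        simp only [Finset.sum_range_succ, Finset.sum_range_zero]
        norm_num at h1 ⊢
        linarith [(hμn 1).2, hμ0]
      | succ n ih =>
        intro hn
        have h1 := ih (by omega)
        rw [show n + 1 + 2 = n + 2 + 1 by omega, Finset.sum_range_succ]
        set q := Q / 9 ^ (n + 2 + 1) with hq
        have hq0 : 0 < q := by positivity
        have hq9 : Q / 9 ^ (n + 2) = 9 * q := by rw [hq, pow_succ (9 : ℝ) (n + 2)]; field_simp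
        have hq81 : Q / 9 ^ (n + 1) = 81 * q := by
          rw [hq, pow_succ (9 : ℝ) (n + 2), pow_succ (9 : ℝ) (n + 1)]; field_simp; norm_num
        have hQq : (9 : ℝ) ^ (n + 2) = Q / (9 * q) := by rw [← hq9]; field_simp
        have hμ2 : μ (n + 2) ≤ 9 * q ∧ μ (n + 2) ≤ 9 * q * (81 * q) := by
          have ha := hup (n + 1) (by omega)
          have hb := hup n (by omega)
          rw [show n + 1 + 1 = n + 2 by omega, hq9] at ha
          rw [hq81] at hb
          have hc : μ (n + 1) ≤ 81 * q := by
            rw [hμ]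
            exact (mul_le_of_le_one_left (hF0 n) (hμn n).2).trans hb
          rw [hμ (n + 1)]
          exact ⟨(mul_le_of_le_one_left (hF0 _) (hμn _).2).trans ha,
            by rw [mul_comm (9 * q)]; exact mul_le_mul hc ha (hF0 _) (by positivity)⟩
        have h2 : μ (n + 2) ≤ 9 * q * (45 / 2) * (9 * q / (1 + 9 * q) - q / (1 + q)) := by
          have h3 : 9 * q / (1 + 9 * q) - q / (1 + q) = 8 * q / ((1 + 9 * q) * (1 + q)) := by
            field_simp; ring
          rw [h3, ← mul_div_assoc, le_div_iff₀ (by positivity)]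
          rcases le_or_gt (9 * q) 1 with h | h
          · calc μ (n + 2) * ((1 + 9 * q) * (1 + q))
                ≤ 9 * q * (81 * q) * (2 * (10 / 9)) :=
                  mul_le_mul hμ2.2 (mul_le_mul (by linarith) (by linarith) (by positivity)
                    (by norm_num)) (by positivity) (by positivity)
              _ ≤ _ := by nlinarith
          · calc μ (n + 2) * ((1 + 9 * q) * (1 + q))
                ≤ 1 * ((18 * q) * (10 * q)) :=
                  mul_le_mul (hμn _).2 (mul_le_mul (by linarith) (by linarith) (by positivity)
                    (by positivity)) (by positivity) (by positivity)
              _ ≤ _ := by nlinarith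
        have h4 : 9 ^ (n + 2) * μ (n + 2) ≤
            45 / 2 * Q * (9 * q / (1 + 9 * q) - q / (1 + q)) := by
          calc 9 ^ (n + 2) * μ (n + 2)
              ≤ 9 ^ (n + 2) * (9 * q * (45 / 2) * (9 * q / (1 + 9 * q) - q / (1 + q))) :=
                mul_le_mul_of_nonneg_left h2 (by positivity)
            _ = _ := by rw [hQq]; field_simp
        rw [hq9] at h1
        linarith
    have hfin : ∑ j ∈ Finset.range m, 9 ^ j * μ j ≤ 10 + 45 / 2 * Q := by
      rcases Nat.lt_or_ge m 2 with h | h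
      · refine (Finset.sum_le_sum_of_subset_of_nonneg (t := Finset.range 2)
          (Finset.range_mono h.le) fun i _ _ => mul_nonneg (by positivity) (hμn i).1).trans ?_
        simp only [Finset.sum_range_succ, Finset.sum_range_zero]
        linarith [(hμn 1).2]
      · obtain ⟨n, rfl⟩ := Nat.exists_eq_add_of_le' h
        have := hsum n (by omega)
        have h2 : 0 ≤ 45 / 2 * Q * ((Q / 9 ^ (n + 2)) / (1 + Q / 9 ^ (n + 2))) := by positivity
        linarith
    linarith

/-! ### The uniform average of Chebyshev polynomials as a filter -/

/-- The average of `T_{2k}(cos η)`, `0 ≤ k ≤ K`: a filter in `s = sin η` that is close to `1` for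
`s ≪ 1 / K` and decays like `1 / (K s)`. -/
def chebFilter (K : ℕ) (η : ℝ) : ℝ :=
  (∑ k ∈ Finset.range (K + 1), Real.cos (2 * k * η)) / (K + 1)

theorem chebFilter_sq_le_one (K : ℕ) (η : ℝ) : chebFilter K η ^ 2 ≤ 1 := by
  rw [sq_le_one_iff_abs_le_one, chebFilter, abs_div, abs_of_pos (by positivity : (0 : ℝ) < K + 1),
    div_le_one (by positivity)]
  refine (Finset.abs_sum_le_sum_abs _ _).trans ((Finset.sum_le_card_nsmul _ _ 1
    fun k _ => Real.abs_cos_le_one _).trans ?_)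
  simp

theorem chebFilter_sq_mul_le (K : ℕ) (η : ℝ) :
    chebFilter K η ^ 2 * ((K + 1) ^ 2 * Real.sin η ^ 2) ≤ 1 := by
  have h : ∀ n : ℕ, 2 * Real.sin η * ∑ k ∈ Finset.range (n + 1), Real.cos (2 * k * η) =
      Real.sin ((2 * n + 1) * η) + Real.sin η := by
    intro n
    induction n with
    | zero => simp; ring
    | succ n ih =>
      rw [Finset.sum_range_succ, mul_add, ih]
      push_cast
      have h1 : (2 * ((n : ℝ) + 1) + 1) * η = 2 * (n + 1) * η + η := by ring
      have h2 : (2 * (n : ℝ) + 1) * η = 2 * (n + 1) * η - η := by ring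
      rw [h1, h2, Real.sin_add, Real.sin_sub]
      ring
  have h1 : chebFilter K η ^ 2 * ((K + 1) ^ 2 * Real.sin η ^ 2) =
      (2 * Real.sin η * ∑ k ∈ Finset.range (K + 1), Real.cos (2 * k * η)) ^ 2 / 4 := by
    rw [chebFilter]
    generalize ∑ k ∈ Finset.range (K + 1), Real.cos (2 * k * η) = s
    field_simp
    ring
  rw [h1, h]
  nlinarith [Real.sin_sq_le_one η, Real.sin_sq_le_one ((2 * K + 1) * η),
    sq_nonneg (Real.sin ((2 * K + 1) * η) - Real.sin η)]

theorem sin_nat_mul_sq_le (k : ℕ) (η : ℝ) : Real.sin (k * η) ^ 2 ≤ k ^ 2 * Real.sin η ^ 2 := by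
  have h : |Real.sin (k * η)| ≤ k * |Real.sin η| := by
    induction k with
    | zero => simp
    | succ k ih =>
      push_cast
      rw [add_mul, one_mul, Real.sin_add]
      refine (abs_add_le _ _).trans ?_
      rw [abs_mul, abs_mul]
      have h1 := mul_le_of_le_one_right (abs_nonneg (Real.sin (k * η))) (Real.abs_cos_le_one η)
      have h2 := mul_le_of_le_one_left (abs_nonneg (Real.sin η)) (Real.abs_cos_le_one (k * η))
      linarith
  rw [← sq_abs, ← sq_abs (Real.sin η), ← mul_pow]
  exact pow_le_pow_left₀ (abs_nonneg _) h 2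

theorem one_sub_le_chebFilter_sq (K : ℕ) (η : ℝ) :
    1 - 4 * (K ^ 2 * Real.sin η ^ 2) ≤ chebFilter K η ^ 2 := by
  have h : 1 - 2 * (K ^ 2 * Real.sin η ^ 2) ≤ chebFilter K η := by
    rw [chebFilter, le_div_iff₀ (by positivity)]
    have : (Finset.range (K + 1)).card • (1 - 2 * (K ^ 2 * Real.sin η ^ 2)) ≤
        ∑ k ∈ Finset.range (K + 1), Real.cos (2 * k * η) := by
      refine Finset.card_nsmul_le_sum _ _ _ fun k hk => ?_
      have hk1 : (k : ℝ) ≤ K := by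
        exact_mod_cast Nat.lt_succ_iff.1 (Finset.mem_range.1 hk)
      have h1 := sin_nat_mul_sq_le k η
      have h2 : (k : ℝ) ^ 2 * Real.sin η ^ 2 ≤ K ^ 2 * Real.sin η ^ 2 := by gcongr
      rw [mul_assoc, Real.cos_two_mul, Real.cos_sq']
      linarith
    simpa [mul_comm] using this
  nlinarith [sq_nonneg (chebFilter K η - 1)]

/-! ### Product vectors, controlled operators and reflections -/

section Tensor

variable {ι κ : Type} [Fintype ι] [DecidableEq ι] [Fintype κ] [DecidableEq κ]

/-- The product vector `v ⊗ y`. -/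
def tens (v : ι → ℂ) (y : κ → ℂ) : ι × κ → ℂ := fun p => v p.1 * y p.2

theorem kronecker_mulVec_tens (A : Matrix ι ι ℂ) (B : Matrix κ κ ℂ) (v : ι → ℂ) (y : κ → ℂ) :
    (A ⊗ₖ B) *ᵥ tens v y = tens (A *ᵥ v) (B *ᵥ y) := by
  ext ⟨i, k⟩
  simp only [Matrix.mulVec, dotProduct, tens, Fintype.sum_prod_type, Matrix.kroneckerMap_apply,
    Finset.sum_mul_sum]
  exact Finset.sum_congr rfl fun a _ => Finset.sum_congr rfl fun b _ => by ring

theorem star_tens_dotProduct (v v' : ι → ℂ) (y y' : κ → ℂ) :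
    star (tens v y) ⬝ᵥ tens v' y' = (star v ⬝ᵥ v') * (star y ⬝ᵥ y') := by
  simp only [dotProduct, tens, Fintype.sum_prod_type, Finset.sum_mul_sum, Pi.star_apply, star_mul']
  exact Finset.sum_congr rfl fun a _ => Finset.sum_congr rfl fun b _ => by ring

theorem add_tens (v v' : ι → ℂ) (y : κ → ℂ) : tens (v + v') y = tens v y + tens v' y := by
  ext p; simp [tens, add_mul]

theorem tens_smul (c : ℂ) (v : ι → ℂ) (y : κ → ℂ) : tens v (c • y) = c • tens v y := by
  ext p; simp [tens, mul_left_comm]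

theorem smul_tens (c : ℂ) (v : ι → ℂ) (y : κ → ℂ) : tens (c • v) y = c • tens v y := by
  ext p; simp [tens, mul_assoc]

theorem zero_tens (y : κ → ℂ) : tens (0 : ι → ℂ) y = 0 := by
  ext p; simp [tens]

theorem single_tens_single (i : ι) (k : κ) :
    tens (Pi.single i 1) (Pi.single k 1) = Pi.single (i, k) (1 : ℂ) := by
  ext ⟨a, b⟩
  simp only [tens, Pi.single_apply, Prod.mk.injEq]
  split_ifs <;> simp_all

/-- The operator `U` controlled on the range of the projection `P` on the first factor. -/
def ctrl (P : Matrix ι ι ℂ) (U : Matrix κ κ ℂ) : Matrix (ι × κ) (ι × κ) ℂ :=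
  P ⊗ₖ U + (1 - P) ⊗ₖ 1

theorem ctrl_mul {P : Matrix ι ι ℂ} (hP : IsStarProjection P) (U V : Matrix κ κ ℂ) :
    ctrl P U * ctrl P V = ctrl P (U * V) := by
  unfold ctrl
  rw [Matrix.mul_add, Matrix.add_mul, Matrix.add_mul, ← Matrix.mul_kronecker_mul,
    ← Matrix.mul_kronecker_mul, ← Matrix.mul_kronecker_mul, ← Matrix.mul_kronecker_mul,
    hP.isIdempotentElem.eq, hP.one_sub.isIdempotentElem.eq, hP.mul_one_sub_self,
    hP.one_sub_mul_self]
  simp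

theorem ctrl_one (P : Matrix ι ι ℂ) : ctrl P (1 : Matrix κ κ ℂ) = 1 := by
  rw [ctrl, ← Matrix.add_kronecker]
  simp

theorem ctrl_conjTranspose {P : Matrix ι ι ℂ} (hP : IsStarProjection P) (U : Matrix κ κ ℂ) :
    (ctrl P U)ᴴ = ctrl P Uᴴ := by
  have h : Pᴴ = P := hP.isSelfAdjoint
  simp [ctrl, Matrix.conjTranspose_kronecker, h]

theorem ctrl_isometry {P : Matrix ι ι ℂ} (hP : IsStarProjection P) {U : Matrix κ κ ℂ}
    (hU : Uᴴ * U = 1) : (ctrl P U)ᴴ * ctrl P U = 1 := by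
  rw [ctrl_conjTranspose hP, ctrl_mul hP, hU, ctrl_one]

theorem ctrl_mulVec_tens (P : Matrix ι ι ℂ) (U : Matrix κ κ ℂ) (v : ι → ℂ) (y : κ → ℂ) :
    ctrl P U *ᵥ tens v y = tens (P *ᵥ v) (U *ᵥ y) + tens (v - P *ᵥ v) y := by
  rw [ctrl, Matrix.add_mulVec, kronecker_mulVec_tens, kronecker_mulVec_tens, Matrix.sub_mulVec,
    Matrix.one_mulVec, Matrix.one_mulVec]

theorem ctrl_mulVec_tens_of_mulVec_eq_zero {P : Matrix ι ι ℂ} (U : Matrix κ κ ℂ) {v : ι → ℂ}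
    (hv : P *ᵥ v = 0) (y : κ → ℂ) : ctrl P U *ᵥ tens v y = tens v y := by
  rw [ctrl_mulVec_tens, hv, zero_tens, sub_zero, zero_add]

theorem ctrl_mulVec_tens_of_mulVec_eq_self {P : Matrix ι ι ℂ} (U : Matrix κ κ ℂ) {v : ι → ℂ}
    (hv : P *ᵥ v = v) (y : κ → ℂ) : ctrl P U *ᵥ tens v y = tens v (U *ᵥ y) := by
  rw [ctrl_mulVec_tens, hv, sub_self, zero_tens, add_zero]

theorem basisProj_mulVec (x : ι) (v : ι → ℂ) :
    basisProj x *ᵥ v = v x • Pi.single x (1 : ℂ) := by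
  ext i
  simp [basisProj, Matrix.mulVec, dotProduct, Matrix.single_apply, Pi.single_apply, ite_and,
    eq_comm]

/-- The orthogonal projection onto the line spanned by `v` (zero if `v = 0`). -/
def lineProj (v : ι → ℂ) : Matrix ι ι ℂ := (star v ⬝ᵥ v)⁻¹ • Matrix.vecMulVec v (star v)

theorem lineProj_mulVec (v x : ι → ℂ) :
    lineProj v *ᵥ x = ((star v ⬝ᵥ v)⁻¹ * (star v ⬝ᵥ x)) • v := by
  rw [lineProj, Matrix.smul_mulVec, Matrix.vecMulVec_mulVec, op_smul_eq_smul, smul_smul]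

theorem isStarProjection_lineProj (v : ι → ℂ) : IsStarProjection (lineProj v) := by
  refine ⟨?_, ?_⟩
  · rw [IsIdempotentElem, lineProj, Matrix.smul_mul, Matrix.mul_smul,
    Matrix.vecMulVec_mul_vecMulVec,
      Matrix.vecMulVec_smul, smul_smul, smul_smul]
    congr 1
    rcases eq_or_ne (star v ⬝ᵥ v) 0 with h | h
    · simp [h]
    · field_simp
  · rw [IsSelfAdjoint, Matrix.star_eq_conjTranspose, lineProj, Matrix.conjTranspose_smul,
      Matrix.conjTranspose_vecMulVec, star_star, ← ofReal_vnorm_sq, ← Complex.ofReal_inv]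
    congr 1
    exact Complex.conj_ofReal _

/-- The reflection about the bisector of two unit vectors with real inner product exchanges them. -/
theorem reflection_bisector {x y : ι → ℂ} (hx : star x ⬝ᵥ x = 1) (hy : star y ⬝ᵥ y = 1)
    (hxy : star x ⬝ᵥ y = star y ⬝ᵥ x) (h : 1 + star y ⬝ᵥ x ≠ 0) :
    (2 * lineProj (x + y) - 1) *ᵥ x = y := by
  have h2 : star (x + y) ⬝ᵥ (x + y) = 2 * (1 + star y ⬝ᵥ x) := by
    simp only [star_add, add_dotProduct, dotProduct_add, hx, hy, hxy]; ring
  have h1 : star (x + y) ⬝ᵥ x = 1 + star y ⬝ᵥ x := by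
    simp only [star_add, add_dotProduct, hx]
  rw [two_mul, Matrix.sub_mulVec, Matrix.add_mulVec, lineProj_mulVec, h1, h2, Matrix.one_mulVec,
    mul_inv, mul_assoc, inv_mul_cancel₀ h]
  ext i
  simp
  ring

theorem two_mul_sub_one_isometry {P : Matrix ι ι ℂ} (hP : IsStarProjection P) :
    (2 * P - 1)ᴴ * (2 * P - 1) = 1 :=
  (Unitary.mem_iff.1 hP.two_mul_sub_one_mem_unitary).1

theorem one_sub_two_mul_isometry {P : Matrix ι ι ℂ} (hP : IsStarProjection P) :
    (1 - 2 * P)ᴴ * (1 - 2 * P) = 1 := by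
  rw [← neg_sub (2 * P), Matrix.conjTranspose_neg, neg_mul_neg, two_mul_sub_one_isometry hP]

theorem isometry_mul {U V : Matrix ι ι ℂ} (hU : Uᴴ * U = 1) (hV : Vᴴ * V = 1) :
    (U * V)ᴴ * (U * V) = 1 := by
  rw [Matrix.conjTranspose_mul, Matrix.mul_assoc, ← Matrix.mul_assoc Uᴴ, hU, Matrix.one_mul, hV]

theorem kronecker_one_isometry {U : Matrix ι ι ℂ} (hU : Uᴴ * U = 1) :
    (U ⊗ₖ (1 : Matrix κ κ ℂ))ᴴ * (U ⊗ₖ (1 : Matrix κ κ ℂ)) = 1 := by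
  rw [Matrix.conjTranspose_kronecker, ← Matrix.mul_kronecker_mul, hU]
  simp

/-- The projection `V Vᴴ` onto the range of an isometry `V`. -/
theorem isStarProjection_mul_conjTranspose {V : Matrix ι κ ℂ} (hV : Vᴴ * V = 1) :
    IsStarProjection (V * Vᴴ) := by
  refine ⟨?_, ?_⟩
  · rw [IsIdempotentElem, Matrix.mul_assoc, ← Matrix.mul_assoc Vᴴ, hV, Matrix.one_mul]
  · rw [IsSelfAdjoint, Matrix.star_eq_conjTranspose, Matrix.conjTranspose_mul,
      Matrix.conjTranspose_conjTranspose]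

end Tensor

/-! ### Qubitized walk and its Chebyshev moments -/

section Walk

variable {σ β : Type} [Fintype σ] [DecidableEq σ] [Fintype β] [DecidableEq β]

/-- The product `(2 P - 1) (1 - 2 O P Oᴴ)` of two reflections, where `P = G Gᴴ`. -/
def walkOp (G : Matrix β σ ℂ) (O : Matrix β β ℂ) : Matrix β β ℂ :=
  (2 * (G * Gᴴ) - 1) * (O * (1 - 2 * (G * Gᴴ)) * Oᴴ)

/-- The compressions of the powers of the walk operator satisfy the Chebyshev recurrence. -/
theorem walkOp_recurrence {G : Matrix β σ ℂ} (hG : Gᴴ * G = 1) {O : Matrix β β ℂ}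
    (hO : O * Oᴴ = 1) (k : ℕ) :
    Gᴴ * walkOp G O ^ (k + 2) + Gᴴ * walkOp G O ^ k =
      (2 : ℂ) • ((1 - 2 * ((Gᴴ * O * G) * (Gᴴ * O * G)ᴴ)) * (Gᴴ * walkOp G O ^ (k + 1))) := by
  have hO' : Oᴴ * O = 1 := mul_eq_one_comm.1 hO
  set R := walkOp G O with hR
  set S : Matrix β β ℂ := O * (1 - 2 * (G * Gᴴ)) * Oᴴ with hS
  have hP := isStarProjection_mul_conjTranspose hG
  have hPP : (2 * (G * Gᴴ) - 1) * (2 * (G * Gᴴ) - 1) = 1 := by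
    have := hP.isIdempotentElem.eq
    calc (2 * (G * Gᴴ) - 1) * (2 * (G * Gᴴ) - 1)
        = 4 * ((G * Gᴴ) * (G * Gᴴ)) - 4 * (G * Gᴴ) + 1 := by noncomm_ring
      _ = 1 := by rw [this]; noncomm_ring
  have hSS : S * S = 1 := by
    have h1 : (1 - 2 * (G * Gᴴ)) * (1 - 2 * (G * Gᴴ)) = 1 := by
      rw [← neg_sub, neg_mul_neg, hPP]
    calc S * S = O * (1 - 2 * (G * Gᴴ)) * (Oᴴ * O) * (1 - 2 * (G * Gᴴ)) * Oᴴ := by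
          rw [hS]; simp only [Matrix.mul_assoc]
      _ = O * ((1 - 2 * (G * Gᴴ)) * (1 - 2 * (G * Gᴴ))) * Oᴴ := by
          rw [hO', Matrix.mul_one]; simp only [Matrix.mul_assoc]
      _ = 1 := by rw [h1, Matrix.mul_one, hO]
  have hGP : Gᴴ * (2 * (G * Gᴴ) - 1) = Gᴴ := by
    have : Gᴴ * (G * Gᴴ) = Gᴴ := by rw [← Matrix.mul_assoc, hG, Matrix.one_mul]
    rw [two_mul, Matrix.mul_sub, Matrix.mul_add, this, Matrix.mul_one]
    abel
  have hRS : R = (2 * (G * Gᴴ) - 1) * S := rfl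
  have h1 : Gᴴ * R ^ (k + 2) = Gᴴ * S * R ^ (k + 1) := by
    rw [pow_succ' R (k + 1)]
    nth_rewrite 1 [hRS]
    rw [← Matrix.mul_assoc, ← Matrix.mul_assoc, hGP]
  have h2 : Gᴴ * R ^ k = Gᴴ * S * (2 * (G * Gᴴ) - 1) * R ^ (k + 1) := by
    rw [pow_succ' R k]
    nth_rewrite 2 [hRS]
    calc Gᴴ * R ^ k = Gᴴ * (S * (((2 * (G * Gᴴ) - 1) * (2 * (G * Gᴴ) - 1)) * S)) * R ^ k := by
          rw [hPP, Matrix.one_mul, hSS, Matrix.mul_one]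
      _ = _ := by simp only [Matrix.mul_assoc]
  have h3 : Gᴴ * S * G = 1 - 2 * ((Gᴴ * O * G) * (Gᴴ * O * G)ᴴ) := by
    rw [hS, two_mul, two_mul]
    simp only [Matrix.mul_sub, Matrix.sub_mul, Matrix.mul_add, Matrix.add_mul, Matrix.mul_one,
      Matrix.conjTranspose_mul, Matrix.conjTranspose_conjTranspose, hO]
    simp only [Matrix.mul_assoc, hG]
  rw [h1, h2, ← h3, ← Matrix.add_mul]
  have h4 : Gᴴ * S + Gᴴ * S * (2 * (G * Gᴴ) - 1) = (2 : ℂ) • (Gᴴ * S * G * Gᴴ) := by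
    rw [two_mul, Matrix.mul_sub, Matrix.mul_add, Matrix.mul_one, two_smul]
    simp only [Matrix.mul_assoc]
    abel
  rw [h4, Matrix.smul_mul]
  simp only [Matrix.mul_assoc]

/-- On an eigenvector of `(Gᴴ O G) (Gᴴ O G)ᴴ` with eigenvalue `sin² η`, the compressed `k`-th power
of the walk operator is `cos (2 k η)`. -/
theorem walkOp_pow_eigenvector {G : Matrix β σ ℂ} (hG : Gᴴ * G = 1) {O : Matrix β β ℂ}
    (hO : O * Oᴴ = 1) {e : σ → ℂ} {η : ℝ}
    (he : ((Gᴴ * O * G) * (Gᴴ * O * G)ᴴ) *ᵥ e = ((Real.sin η ^ 2 : ℝ) : ℂ) • e) (k : ℕ) :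
    (Gᴴ * walkOp G O ^ k * G) *ᵥ e = (Real.cos (2 * k * η) : ℂ) • e := by
  set M := (Gᴴ * O * G) * (Gᴴ * O * G)ᴴ with hM
  have hcos : 1 - 2 * Real.sin η ^ 2 = Real.cos (2 * η) := by
    rw [Real.cos_two_mul, Real.cos_sq']; ring
  have h1M : (1 - 2 * M) *ᵥ e = (Real.cos (2 * η) : ℂ) • e := by
    rw [← hcos, two_mul, Matrix.sub_mulVec, Matrix.add_mulVec, he, Matrix.one_mulVec]
    push_cast
    module
  suffices h : ∀ k : ℕ, (Gᴴ * walkOp G O ^ k * G) *ᵥ e = (Real.cos (2 * k * η) : ℂ) • e ∧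
      (Gᴴ * walkOp G O ^ (k + 1) * G) *ᵥ e = (Real.cos (2 * (k + 1 : ℕ) * η) : ℂ) • e from (h k).1
  intro k
  induction k with
  | zero =>
    refine ⟨by simp [hG], ?_⟩
    have hGP : Gᴴ * (2 * (G * Gᴴ) - 1) = Gᴴ := by
      have : Gᴴ * (G * Gᴴ) = Gᴴ := by rw [← Matrix.mul_assoc, hG, Matrix.one_mul]
      rw [two_mul, Matrix.mul_sub, Matrix.mul_add, this, Matrix.mul_one]
      abel
    have : Gᴴ * walkOp G O ^ (0 + 1) * G = 1 - 2 * M := by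
      rw [zero_add, pow_one, walkOp, ← Matrix.mul_assoc, hGP, hM, two_mul, two_mul]
      simp only [Matrix.mul_sub, Matrix.sub_mul, Matrix.mul_add, Matrix.add_mul, Matrix.mul_one,
        Matrix.conjTranspose_mul, Matrix.conjTranspose_conjTranspose, hO]
      simp only [Matrix.mul_assoc, hG]
    rw [this, h1M]
    norm_num
  | succ k ih =>
    refine ⟨ih.2, ?_⟩
    have hrec := congrArg (fun X => (X * G) *ᵥ e) (walkOp_recurrence hG hO k)
    simp only [Matrix.add_mul, Matrix.add_mulVec, Matrix.smul_mul, Matrix.smul_mulVec] at hrec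
    rw [Matrix.mul_assoc (1 - 2 * ((Gᴴ * O * G) * (Gᴴ * O * G)ᴴ)), ← hM,
      ← Matrix.mulVec_mulVec _ (1 - 2 * M),
      ih.1, ih.2, Matrix.mulVec_smul, h1M] at hrec
    rw [show k + 1 + 1 = k + 2 by omega, eq_sub_of_add_eq hrec]
    have hc : Real.cos (2 * (k + 2 : ℕ) * η) =
        2 * Real.cos (2 * η) * Real.cos (2 * (k + 1 : ℕ) * η) - Real.cos (2 * k * η) := by
      push_cast
      have h1 : 2 * ((k : ℝ) + 2) * η = 2 * (k + 1) * η + 2 * η := by ring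
      have h2 : 2 * (k : ℝ) * η = 2 * (k + 1) * η - 2 * η := by ring
      rw [h1, h2, Real.cos_add, Real.cos_sub]
      ring
    rw [hc]
    push_cast
    module

end Walk

/-! ### Maps that adjoin a fixed vector -/

section ColTens

variable {ι κ σ : Type} [Fintype ι] [DecidableEq ι] [Fintype κ] [DecidableEq κ] [Fintype σ]
  [DecidableEq σ]

/-- The matrix of `z ↦ a ⊗ B z`. -/
def colTens (a : ι → ℂ) (B : Matrix κ σ ℂ) : Matrix (ι × κ) σ ℂ :=
  Matrix.of fun p s => a p.1 * B p.2 s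

theorem colTens_mulVec (a : ι → ℂ) (B : Matrix κ σ ℂ) (z : σ → ℂ) :
    colTens a B *ᵥ z = tens a (B *ᵥ z) := by
  ext p
  simp [colTens, tens, Matrix.mulVec, dotProduct, Finset.mul_sum, mul_assoc]

theorem colTens_conjTranspose_mulVec (a : ι → ℂ) (B : Matrix κ σ ℂ) (v : ι → ℂ) (y : κ → ℂ) :
    (colTens a B)ᴴ *ᵥ tens v y = (star a ⬝ᵥ v) • (Bᴴ *ᵥ y) := by
  ext s
  simp only [colTens, tens, Matrix.mulVec, dotProduct, Fintype.sum_prod_type, Matrix.of_apply,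
    Matrix.conjTranspose_apply, Pi.smul_apply, smul_eq_mul, Finset.sum_mul_sum, Pi.star_apply,
    star_mul']
  exact Finset.sum_congr rfl fun a _ => Finset.sum_congr rfl fun b _ => by ring

theorem colTens_isometry {a : ι → ℂ} {B : Matrix κ σ ℂ} (ha : star a ⬝ᵥ a = 1)
    (hB : Bᴴ * B = 1) : (colTens a B)ᴴ * colTens a B = 1 := by
  refine Matrix.ext_of_mulVec_single fun s => ?_
  rw [← Matrix.mulVec_mulVec, colTens_mulVec, colTens_conjTranspose_mulVec, ha, one_smul,
    Matrix.mulVec_mulVec, hB]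

end ColTens

/-! ### The variable time algorithm -/

/-- The values of the clock register: `none` while the algorithm is active, `some (j, good)` if it
has stopped at stage `j`, where `good` tells whether it succeeded. Failures at stage `0` are part of
the initial state. -/
abbrev Level (m : ℕ) : Type := Option (Fin (m + 1) × Bool)

/-- The workspace: clock, ancilla and block encoding register, plus a copy of the space of the
linear system in which `O_b` prepares `|b⟩`. -/
abbrev Space (σ β : Type) (m N : ℕ) : Type := (Level m × (Fin (N + 1) × β)) ⊕ σ

section Ops

variable {σ β : Type} [Fintype σ] [DecidableEq σ] [Fintype β] [DecidableEq β] {m N : ℕ}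

/-- The extension by the identity of an operator on the first three registers. -/
def mainOp (U : Matrix (Level m × (Fin (N + 1) × β)) (Level m × (Fin (N + 1) × β)) ℂ) :
    Matrix (Space σ β m N) (Space σ β m N) ℂ :=
  Matrix.fromBlocks U 0 0 1

theorem mainOp_mul (U V : Matrix (Level m × (Fin (N + 1) × β)) (Level m × (Fin (N + 1) × β)) ℂ) :
    (mainOp U * mainOp V : Matrix (Space σ β m N) (Space σ β m N) ℂ) = mainOp (U * V) := by
  simp [mainOp, Matrix.fromBlocks_multiply]

theorem mainOp_isometry
    {U : Matrix (Level m × (Fin (N + 1) × β)) (Level m × (Fin (N + 1) × β)) ℂ}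
    (hU : Uᴴ * U = 1) :
    (mainOp U : Matrix (Space σ β m N) (Space σ β m N) ℂ)ᴴ * mainOp U = 1 := by
  simp [mainOp, Matrix.fromBlocks_multiply, Matrix.fromBlocks_conjTranspose, hU]

theorem mainOp_mulVec
    (U : Matrix (Level m × (Fin (N + 1) × β)) (Level m × (Fin (N + 1) × β)) ℂ)
    (ψ : Level m × (Fin (N + 1) × β) → ℂ) (χ : σ → ℂ) :
    mainOp U *ᵥ Sum.elim ψ χ = Sum.elim (U *ᵥ ψ) χ := by
  simp [mainOp, Matrix.fromBlocks_mulVec]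

/-- An oracle-independent gate on the first three registers. -/
def mainGate (U : Matrix (Level m × (Fin (N + 1) × β)) (Level m × (Fin (N + 1) × β)) ℂ)
    (hU : Uᴴ * U = 1) : Gate σ β (Space σ β m N) :=
  .free ⟨mainOp U, Matrix.mem_unitaryGroup_iff'.2 (mainOp_isometry hU)⟩

/-- The application of `O_A` or its inverse to the block encoding register. -/
def oracleGate (σ β : Type) [Fintype σ] [DecidableEq σ] [Fintype β] [DecidableEq β] (m N : ℕ)
    (inverse : Bool) : Gate σ β (Space σ β m N) :=
  .queryA (Fintype.card (Level m × Fin (N + 1))) (Fintype.card σ)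
    (Equiv.sumCongr
      (((Equiv.prodComm _ _).trans
        (Equiv.prodCongr (Fintype.equivFin (Level m × Fin (N + 1))).symm (Equiv.refl β))).trans
          (Equiv.prodAssoc _ _ _))
      (Fintype.equivFin σ).symm) inverse

theorem oracleGate_eval (OA : Matrix.unitaryGroup β ℂ) (OB : Matrix.unitaryGroup σ ℂ)
    (inverse : Bool) :
    (oracleGate σ β m N inverse).eval OA OB =
      mainOp (1 ⊗ₖ (1 ⊗ₖ (bif inverse then (OA : Matrix β β ℂ)ᴴ else (OA : Matrix β β ℂ)))) := by
  ext w w'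
  rcases w with ⟨r, a, y⟩ | s <;> rcases w' with ⟨r', a', y'⟩ | s'
  · simp only [oracleGate, Gate.eval, queryMatrix, mainOp]
    by_cases hr : r = r' <;> by_cases ha : a = a' <;> simp [hr, ha]
  · simp [oracleGate, Gate.eval, queryMatrix, mainOp]
  · simp [oracleGate, Gate.eval, queryMatrix, mainOp]
  · simp [oracleGate, Gate.eval, queryMatrix, mainOp, Matrix.one_apply]

/-- The application of `O_b` to the copy of the space of the linear system. -/
def stateGate (σ β : Type) [Fintype σ] [DecidableEq σ] [Fintype β] [DecidableEq β] (m N : ℕ) :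
    Gate σ β (Space σ β m N) :=
  .queryB 1 (Fintype.card (Level m × (Fin (N + 1) × β)))
    ((Equiv.sumComm _ _).trans (Equiv.sumCongr
      (Fintype.equivFin (Level m × (Fin (N + 1) × β))).symm (Equiv.prodUnique σ (Fin 1)))) false

theorem stateGate_eval (OA : Matrix.unitaryGroup β ℂ) (OB : Matrix.unitaryGroup σ ℂ) :
    (stateGate σ β m N).eval OA OB = Matrix.fromBlocks 1 0 0 (OB : Matrix σ σ ℂ) := by
  ext w w'
  rcases w with p | s <;> rcases w' with p' | s' <;>
    simp [stateGate, Gate.eval, queryMatrix, Matrix.one_apply]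

/-- The unitary that exchanges the copy of the space of the linear system with its image under an
isometry `V`. -/
def moveOp (V : Matrix (Level m × (Fin (N + 1) × β)) σ ℂ) :
    Matrix (Space σ β m N) (Space σ β m N) ℂ :=
  Matrix.fromBlocks (1 - V * Vᴴ) V Vᴴ 0

theorem moveOp_isometry {V : Matrix (Level m × (Fin (N + 1) × β)) σ ℂ} (hV : Vᴴ * V = 1) :
    (moveOp V)ᴴ * moveOp V = 1 := by
  have hP := isStarProjection_mul_conjTranspose hV
  have h1 : (1 - V * Vᴴ) * V = 0 := by
    rw [Matrix.sub_mul, Matrix.mul_assoc, hV, Matrix.one_mul, Matrix.mul_one, sub_self]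
  have h2 : Vᴴ * (1 - V * Vᴴ) = 0 := by
    rw [Matrix.mul_sub, ← Matrix.mul_assoc, hV, Matrix.one_mul, Matrix.mul_one, sub_self]
  have h3 : (1 - V * Vᴴ)ᴴ = 1 - V * Vᴴ := hP.one_sub.isSelfAdjoint
  rw [moveOp, Matrix.fromBlocks_conjTranspose, Matrix.fromBlocks_multiply, h3,
    hP.one_sub.isIdempotentElem.eq, h1, Matrix.conjTranspose_conjTranspose, h2, hV]
  simp

/-! ### The filter as a linear combination of walk powers -/

/-- The uniform superposition of the first `K + 1` ancilla states. -/
def uniformVec (N K : ℕ) : Fin (N + 1) → ℂ :=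
  fun a => if (a : ℕ) ≤ K then ((1 / √(K + 1) : ℝ) : ℂ) else 0

theorem sum_fin_ite_le {M : Type} [AddCommMonoid M] {K : ℕ} (hK : K ≤ N) (f : ℕ → M) :
    ∑ a : Fin (N + 1), (if (a : ℕ) ≤ K then f a else 0) = ∑ k ∈ Finset.range (K + 1), f k := by
  rw [Fin.sum_univ_eq_sum_range (fun a => if a ≤ K then f a else 0), ← Finset.sum_filter]
  refine Finset.sum_congr ?_ fun _ _ => rfl
  ext k
  simp
  omega

theorem sq_sqrt_inv (K : ℕ) : ((1 / √(K + 1) : ℝ) : ℂ) * ((1 / √(K + 1) : ℝ) : ℂ) =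
    ((K : ℂ) + 1)⁻¹ := by
  rw [← Complex.ofReal_mul, div_mul_div_comm, Real.mul_self_sqrt (by positivity)]
  simp

theorem star_uniformVec_dotProduct_self {K : ℕ} (hK : K ≤ N) :
    star (uniformVec N K) ⬝ᵥ uniformVec N K = 1 := by
  have h : star (uniformVec N K) ⬝ᵥ uniformVec N K =
      ∑ a : Fin (N + 1), (if (a : ℕ) ≤ K then ((K : ℂ) + 1)⁻¹ else 0) := by
    refine Finset.sum_congr rfl fun a _ => ?_
    simp only [uniformVec, Pi.star_apply]
    split_ifs
    · rw [← sq_sqrt_inv]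
      congr 1
      exact Complex.conj_ofReal _
    · simp
  rw [h, sum_fin_ite_le hK fun _ => ((K : ℂ) + 1)⁻¹]
  have : (K : ℂ) + 1 ≠ 0 := by exact_mod_cast Nat.succ_ne_zero K
  simp [this]

/-- The reflection that exchanges the first ancilla state and the uniform superposition. -/
def prepOp (N K : ℕ) : Matrix (Fin (N + 1)) (Fin (N + 1)) ℂ :=
  2 * lineProj (Pi.single 0 1 + uniformVec N K) - 1

theorem prepOp_isometry (N K : ℕ) : (prepOp N K)ᴴ * prepOp N K = 1 :=
  two_mul_sub_one_isometry (isStarProjection_lineProj _)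

theorem prepOp_conjTranspose (N K : ℕ) : (prepOp N K)ᴴ = prepOp N K := by
  have h : ∀ v : Fin (N + 1) → ℂ, (lineProj v)ᴴ = lineProj v := fun v =>
    (isStarProjection_lineProj v).isSelfAdjoint
  simp [prepOp, two_mul, h]

theorem prepOp_mulVec_single {K : ℕ} (hK : K ≤ N) :
    prepOp N K *ᵥ Pi.single 0 1 = uniformVec N K := by
  have h0 : uniformVec N K 0 = ((1 / √(K + 1) : ℝ) : ℂ) := by simp [uniformVec]
  have hc : star (uniformVec N K 0) = uniformVec N K 0 := by
    rw [h0]; exact Complex.conj_ofReal _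
  refine reflection_bisector (by simp) (star_uniformVec_dotProduct_self hK) ?_ ?_
  · simp only [dotProduct_single, Pi.star_apply, mul_one, hc]
    rw [← Pi.single_star, single_dotProduct]
    simp
  · simp only [dotProduct_single, Pi.star_apply, mul_one, hc]
    rw [h0, ← Complex.ofReal_one, ← Complex.ofReal_add]
    exact Complex.ofReal_ne_zero.2 (by positivity)

/-- The projection onto the ancilla states `t, t + 1, ...`. -/
def geProj (N t : ℕ) : Matrix (Fin (N + 1)) (Fin (N + 1)) ℂ :=
  Matrix.diagonal fun a => if t ≤ (a : ℕ) then 1 else 0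

theorem isStarProjection_diagonal_ite {ι : Type} [Fintype ι] [DecidableEq ι] (p : ι → Prop)
    [DecidablePred p] :
    IsStarProjection (Matrix.diagonal fun i => if p i then (1 : ℂ) else 0) := by
  refine ⟨?_, ?_⟩
  · simp [IsIdempotentElem]
  · rw [IsSelfAdjoint, Matrix.star_eq_conjTranspose, Matrix.diagonal_conjTranspose]
    congr 1
    ext i
    simp only [Pi.star_apply]
    split_ifs <;> simp

theorem isStarProjection_geProj (N t : ℕ) : IsStarProjection (geProj N t) :=
  isStarProjection_diagonal_ite _

/-- The walk operator applied as often as the value of the ancilla says, but at most `t` times. -/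
def selectOp (N : ℕ) (R : Matrix β β ℂ) :
    ℕ → Matrix (Fin (N + 1) × β) (Fin (N + 1) × β) ℂ
  | 0 => 1
  | t + 1 => ctrl (geProj N (t + 1)) R * selectOp N R t

theorem selectOp_mulVec (R : Matrix β β ℂ) (t : ℕ) (a : Fin (N + 1)) (y : β → ℂ) :
    selectOp N R t *ᵥ tens (Pi.single a 1) y =
      tens (Pi.single a 1) (R ^ min (a : ℕ) t *ᵥ y) := by
  induction t with
  | zero => simp [selectOp]
  | succ t ih =>
    rw [selectOp, ← Matrix.mulVec_mulVec, ih]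
    rcases Nat.lt_or_ge (a : ℕ) (t + 1) with h | h
    · rw [ctrl_mulVec_tens_of_mulVec_eq_zero, min_eq_left (by omega), min_eq_left (by omega)]
      simp [geProj, Nat.lt_succ_iff.1 h]
    · rw [ctrl_mulVec_tens_of_mulVec_eq_self, min_eq_right (by omega), min_eq_right (by omega),
        Matrix.mulVec_mulVec, ← pow_succ']
      simp [geProj, Nat.lt_of_succ_le h]

theorem selectOp_isometry {R : Matrix β β ℂ} (hR : Rᴴ * R = 1) (t : ℕ) :
    (selectOp N R t)ᴴ * selectOp N R t = 1 := by
  induction t with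
  | zero => simp [selectOp]
  | succ t ih => exact isometry_mul (ctrl_isometry (isStarProjection_geProj _ _) hR) ih

/-- The linear combination of walk powers. -/
def filterOp (N : ℕ) (R : Matrix β β ℂ) (K : ℕ) :
    Matrix (Fin (N + 1) × β) (Fin (N + 1) × β) ℂ :=
  (prepOp N K ⊗ₖ 1) * selectOp N R K * (prepOp N K ⊗ₖ 1)

theorem filterOp_isometry {R : Matrix β β ℂ} (hR : Rᴴ * R = 1) (K : ℕ) :
    (filterOp N R K)ᴴ * filterOp N R K = 1 :=
  isometry_mul
    (isometry_mul (kronecker_one_isometry (prepOp_isometry N K)) (selectOp_isometry hR K))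
    (kronecker_one_isometry (prepOp_isometry N K))

/-- The isometry `z ↦ |0⟩ ⊗ G z`. -/
def encode (N : ℕ) (G : Matrix β σ ℂ) : Matrix (Fin (N + 1) × β) σ ℂ :=
  colTens (Pi.single 0 1) G

theorem encode_isometry {G : Matrix β σ ℂ} (hG : Gᴴ * G = 1) :
    (encode N G)ᴴ * encode N G = 1 :=
  colTens_isometry (by simp) hG

/-- The block of the filter between encoded states is the average of the compressed walk powers. -/
theorem encode_filterOp_encode (G : Matrix β σ ℂ) (R : Matrix β β ℂ) {K : ℕ} (hK : K ≤ N)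
    (z : σ → ℂ) :
    (encode N G)ᴴ *ᵥ (filterOp N R K *ᵥ (encode N G *ᵥ z)) =
      ((K : ℂ) + 1)⁻¹ • ∑ k ∈ Finset.range (K + 1), (Gᴴ * R ^ k * G) *ᵥ z := by
  have hE : ∀ y : β → ℂ, (prepOp N K ⊗ₖ (1 : Matrix β β ℂ)) *ᵥ tens (Pi.single 0 1) y =
      tens (uniformVec N K) y := by
    intro y
    rw [kronecker_mulVec_tens, prepOp_mulVec_single hK, Matrix.one_mulVec]
  have hE' : ∀ x, (encode N G)ᴴ *ᵥ ((prepOp N K ⊗ₖ (1 : Matrix β β ℂ)) *ᵥ x) =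
      (colTens (uniformVec N K) G)ᴴ *ᵥ x := by
    intro x
    have : (prepOp N K ⊗ₖ (1 : Matrix β β ℂ)) * encode N G = colTens (uniformVec N K) G := by
      refine Matrix.ext_of_mulVec_single fun s => ?_
      rw [← Matrix.mulVec_mulVec, encode, colTens_mulVec, colTens_mulVec, hE]
    rw [Matrix.mulVec_mulVec, ← this, Matrix.conjTranspose_mul, Matrix.conjTranspose_kronecker,
      prepOp_conjTranspose, Matrix.conjTranspose_one]
  have hu : ∀ y : β → ℂ, tens (uniformVec N K) y =
      ∑ a : Fin (N + 1), uniformVec N K a • tens (Pi.single a 1) y := by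
    intro y
    ext ⟨b, y'⟩
    simp [tens, Pi.single_apply]
  rw [filterOp, ← Matrix.mulVec_mulVec, ← Matrix.mulVec_mulVec, hE', encode, colTens_mulVec, hE, hu,
    Matrix.mulVec_sum, Matrix.mulVec_sum, Finset.smul_sum,
    ← sum_fin_ite_le hK fun k => ((K : ℂ) + 1)⁻¹ • (Gᴴ * R ^ k * G) *ᵥ z]
  refine Finset.sum_congr rfl fun a _ => ?_
  rw [Matrix.mulVec_smul, Matrix.mulVec_smul, selectOp_mulVec, colTens_conjTranspose_mulVec,
    smul_smul, dotProduct_single, mul_one, Pi.star_apply]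
  split_ifs with h
  · rw [min_eq_left h, uniformVec, if_pos h, ← sq_sqrt_inv, Matrix.mulVec_mulVec,
      Matrix.mulVec_mulVec]
    congr 2
    exact Complex.conj_ofReal _
  · simp [uniformVec, h]

end Ops

/-! ### The estimator -/

/-- The amplitude with which a computation that stops at stage `j` is declared good. -/
def stopAmp (m j : ℕ) : ℝ := 1 / 3 ^ (m - j)

theorem stopAmp_sq_le_one (m j : ℕ) : stopAmp m j ^ 2 ≤ 1 := by
  refine pow_le_one₀ (by unfold stopAmp; positivity) ?_
  exact div_le_one_of_le₀ (one_le_pow₀ (by norm_num)) (by positivity)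

theorem stopAmp_sq {m j : ℕ} (hj : j ≤ m) : stopAmp m j ^ 2 = 9 ^ j / 9 ^ m := by
  obtain ⟨d, rfl⟩ := Nat.exists_eq_add_of_le hj
  have h9 : ∀ n, (9 : ℝ) ^ n = (3 ^ n) ^ 2 := fun n => by
    rw [← pow_mul, mul_comm, pow_mul]; norm_num
  rw [stopAmp, Nat.add_sub_cancel_left, h9, h9, pow_add]
  field_simp

/-- The clock value `(j, good)`. -/
def stopLevel (m j : ℕ) (good : Bool) : Level m := some (⟨min j m, by omega⟩, good)

/-- The clock state into which a computation is moved that stops at stage `j`. -/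
def stopVec (m j : ℕ) : Level m → ℂ :=
  (stopAmp m j : ℂ) • Pi.single (stopLevel m j true) 1 +
    (√(1 - stopAmp m j ^ 2) : ℂ) • Pi.single (stopLevel m j false) 1

/-- The initial clock state: active with amplitude `1 / 3`, and failed otherwise. This keeps all
success amplitudes so small that amplification cannot overshoot at the first levels. -/
def startVec (m : ℕ) : Level m → ℂ :=
  (1 / 3 : ℂ) • Pi.single none 1 + ((√8 / 3 : ℝ) : ℂ) • Pi.single (stopLevel m 0 false) 1

theorem star_two_level_dotProduct {ι : Type} [Fintype ι] [DecidableEq ι] {i k : ι} (hik : i ≠ k)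
    (a b : ℝ) (hab : a ^ 2 + b ^ 2 = 1) :
    star ((a : ℂ) • Pi.single i (1 : ℂ) + (b : ℂ) • Pi.single k 1) ⬝ᵥ
      ((a : ℂ) • Pi.single i (1 : ℂ) + (b : ℂ) • Pi.single k 1) = 1 := by
  rw [← ofReal_vnorm_sq, vnorm_sq, ← Finset.add_sum_erase _ _ (Finset.mem_univ i),
    ← Finset.add_sum_erase _ _ (Finset.mem_erase.2 ⟨hik.symm, Finset.mem_univ k⟩),
    Finset.sum_eq_zero]
  · simp [hik, hik.symm, hab]
  · intro x hx
    simp only [Finset.mem_erase, Finset.mem_univ, and_true] at hx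
    simp [hx.1, hx.2]

theorem star_stopVec_dotProduct_self (m j : ℕ) : star (stopVec m j) ⬝ᵥ stopVec m j = 1 := by
  refine star_two_level_dotProduct (by simp [stopLevel]) _ _ ?_
  rw [Real.sq_sqrt (by linarith [stopAmp_sq_le_one m j])]
  ring

theorem star_startVec_dotProduct_self (m : ℕ) : star (startVec m) ⬝ᵥ startVec m = 1 := by
  have := star_two_level_dotProduct (i := (none : Level m)) (k := stopLevel m 0 false)
    (by simp [stopLevel]) (1 / 3) (√8 / 3)
    (by rw [div_pow (√8), Real.sq_sqrt (by norm_num)]; norm_num)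
  simpa [startVec] using this

section Estimator

variable {σ β : Type} [Fintype σ] [DecidableEq σ] [Fintype β] [DecidableEq β] {m N : ℕ}
  {G : Matrix β σ ℂ}

/-- Exchanges the active clock state with `stopVec` on the complement of the encoded states. -/
def stopOp (m N j : ℕ) (G : Matrix β σ ℂ) :
    Matrix (Level m × (Fin (N + 1) × β)) (Level m × (Fin (N + 1) × β)) ℂ :=
  ctrl (lineProj (Pi.single none 1 - stopVec m j)) (2 * (encode N G * (encode N G)ᴴ) - 1)

theorem stopOp_isometry (hG : Gᴴ * G = 1) (j : ℕ) : (stopOp m N j G)ᴴ * stopOp m N j G = 1 :=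
  ctrl_isometry (isStarProjection_lineProj _)
    (two_mul_sub_one_isometry (isStarProjection_mul_conjTranspose (encode_isometry hG)))

/-- `k` steps of the qubitized walk: step `t` is controlled on the clock being active and on the
ancilla being at least `t`; it uses `O_A` and its inverse once each. -/
def walkCircuit (m N : ℕ) (hG : Gᴴ * G = 1) : ℕ → Circuit σ β (Space σ β m N)
  | 0 => []
  | t + 1 => walkCircuit m N hG t ++
      [oracleGate σ β m N true,
        mainGate (ctrl (basisProj none) (ctrl (geProj N (t + 1)) (1 - 2 * (G * Gᴴ))))
          (ctrl_isometry (isStarProjection_basisProj _)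
            (ctrl_isometry (isStarProjection_geProj _ _)
              (one_sub_two_mul_isometry (isStarProjection_mul_conjTranspose hG)))),
        oracleGate σ β m N false,
        mainGate (ctrl (basisProj none) (ctrl (geProj N (t + 1)) (2 * (G * Gᴴ) - 1)))
          (ctrl_isometry (isStarProjection_basisProj _)
            (ctrl_isometry (isStarProjection_geProj _ _)
              (two_mul_sub_one_isometry (isStarProjection_mul_conjTranspose hG))))]

/-- The gate that prepares and unprepares the uniform superposition of `K + 1` ancilla states if the
clock is active. -/
def prepGate (σ β : Type) [Fintype σ] [DecidableEq σ] [Fintype β] [DecidableEq β] (m N K : ℕ) :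
    Gate σ β (Space σ β m N) :=
  mainGate (ctrl (basisProj none) (prepOp N K ⊗ₖ 1))
    (ctrl_isometry (isStarProjection_basisProj _) (kronecker_one_isometry (prepOp_isometry N K)))

/-- Stage `j`: apply the filter with `K` walk steps, and stop where it does not succeed. -/
def stageCircuit (m N : ℕ) (hG : Gᴴ * G = 1) (K j : ℕ) : Circuit σ β (Space σ β m N) :=
  [prepGate σ β m N K] ++ walkCircuit m N hG K ++
    [prepGate σ β m N K, mainGate (stopOp m N j G) (stopOp_isometry hG j)]

/-- The preparation of the initial state. -/
def prepCircuit (m N : ℕ) (hG : Gᴴ * G = 1) : Circuit σ β (Space σ β m N) :=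
  [stateGate σ β m N,
    .free ⟨moveOp (colTens (startVec m) (encode N G)), Matrix.mem_unitaryGroup_iff'.2
      (moveOp_isometry (colTens_isometry (star_startVec_dotProduct_self m) (encode_isometry hG)))⟩]

variable (OA : Matrix.unitaryGroup β ℂ) (OB : Matrix.unitaryGroup σ ℂ)

theorem mainGate_eval
    {U : Matrix (Level m × (Fin (N + 1) × β)) (Level m × (Fin (N + 1) × β)) ℂ} (hU : Uᴴ * U = 1) :
    (mainGate U hU : Gate σ β (Space σ β m N)).eval OA OB = mainOp U := rfl

theorem walkCircuit_eval (hG : Gᴴ * G = 1) (t : ℕ) :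
    Circuit.eval OA OB (walkCircuit m N hG t) =
      mainOp (ctrl (basisProj none) (selectOp N (walkOp G OA) t)) := by
  have hO : (OA : Matrix β β ℂ) * (OA : Matrix β β ℂ)ᴴ = 1 :=
    Matrix.mem_unitaryGroup_iff.1 OA.2
  -- conjugation by the oracle passes through the controls
  have hconj : ∀ {ι κ : Type} [Fintype ι] [DecidableEq ι] [Fintype κ] [DecidableEq κ]
      (P : Matrix ι ι ℂ) (U O O' : Matrix κ κ ℂ), O * O' = 1 →
      ((1 : Matrix ι ι ℂ) ⊗ₖ O) * ctrl P U * ((1 : Matrix ι ι ℂ) ⊗ₖ O') = ctrl P (O * U * O') := by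
    intro ι κ _ _ _ _ P U O O' h
    simp only [ctrl, Matrix.mul_add, Matrix.add_mul, ← Matrix.mul_kronecker_mul, Matrix.one_mul,
      Matrix.mul_one, h]
  have hO1 : ((1 : Matrix (Fin (N + 1)) (Fin (N + 1)) ℂ) ⊗ₖ (OA : Matrix β β ℂ)) *
      ((1 : Matrix (Fin (N + 1)) (Fin (N + 1)) ℂ) ⊗ₖ (OA : Matrix β β ℂ)ᴴ) = 1 := by
    rw [← Matrix.mul_kronecker_mul, hO]; simp
  induction t with
  | zero => simp [walkCircuit, Circuit.eval, selectOp, ctrl_one, mainOp]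
  | succ t ih =>
    rw [walkCircuit, Circuit.eval_append, ih]
    simp only [Circuit.eval, oracleGate_eval, mainGate_eval, cond_true, cond_false,
      Matrix.one_mul, mainOp_mul]
    congr 1
    rw [selectOp, ← ctrl_mul (isStarProjection_basisProj _)]
    congr 1
    rw [Matrix.mul_assoc (ctrl _ _), Matrix.mul_assoc (ctrl _ _), hconj _ _ _ _ hO1,
      hconj _ _ _ _ hO,
      ctrl_mul (isStarProjection_basisProj _), ctrl_mul (isStarProjection_geProj _ _), walkOp]

theorem stageCircuit_eval (hG : Gᴴ * G = 1) (K j : ℕ) :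
    Circuit.eval OA OB (stageCircuit m N hG K j) =
      mainOp (stopOp m N j G * ctrl (basisProj none) (filterOp N (walkOp G OA) K)) := by
  rw [stageCircuit, Circuit.eval_append, Circuit.eval_append, walkCircuit_eval]
  simp only [Circuit.eval, prepGate, mainGate_eval, Matrix.one_mul, mainOp_mul]
  rw [Matrix.mul_assoc, ctrl_mul (isStarProjection_basisProj _),
    ctrl_mul (isStarProjection_basisProj _), filterOp, Matrix.mul_assoc (prepOp N K ⊗ₖ 1)]

theorem walkCircuit_costA (hG : Gᴴ * G = 1) (t : ℕ) :
    (walkCircuit m N hG t : Circuit σ β (Space σ β m N)).costA = 2 * t := by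
  induction t with
  | zero => rfl
  | succ t ih =>
    rw [walkCircuit, Circuit.costA_append, ih]
    rfl

theorem walkCircuit_costB (hG : Gᴴ * G = 1) (t : ℕ) :
    (walkCircuit m N hG t : Circuit σ β (Space σ β m N)).costB = 0 := by
  induction t with
  | zero => rfl
  | succ t ih =>
    rw [walkCircuit, Circuit.costB_append, ih]
    rfl

theorem stageCircuit_costA (hG : Gᴴ * G = 1) (K j : ℕ) :
    (stageCircuit m N hG K j : Circuit σ β (Space σ β m N)).costA = 2 * K := by
  rw [stageCircuit, Circuit.costA_append, Circuit.costA_append, walkCircuit_costA]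
  simp [Circuit.costA, prepGate, mainGate, Gate.costA]

theorem stageCircuit_costB (hG : Gᴴ * G = 1) (K j : ℕ) :
    (stageCircuit m N hG K j : Circuit σ β (Space σ β m N)).costB = 0 := by
  rw [stageCircuit, Circuit.costB_append, Circuit.costB_append, walkCircuit_costB]
  simp [Circuit.costB, prepGate, mainGate, Gate.costB]

theorem stopOp_mulVec_of_stopped {j : ℕ} {r : Level m} (hr : r ≠ none)
    (h1 : ∀ good, r ≠ stopLevel m j good) (y : Fin (N + 1) × β → ℂ) :
    stopOp m N j G *ᵥ tens (Pi.single r 1) y = tens (Pi.single r 1) y := by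
  refine ctrl_mulVec_tens_of_mulVec_eq_zero _ ?_ _
  rw [lineProj_mulVec, dotProduct_single]
  simp [stopVec, hr, h1]

/-- A stage leaves the computations alone that have stopped earlier. -/
theorem stage_mulVec_of_stopped (K : ℕ) {j : ℕ} {r : Level m} (hr : r ≠ none)
    (h1 : ∀ good, r ≠ stopLevel m j good) (y : Fin (N + 1) × β → ℂ) :
    (stopOp m N j G * ctrl (basisProj none) (filterOp N (walkOp G OA) K)) *ᵥ
      tens (Pi.single r 1) y = tens (Pi.single r 1) y := by
  rw [← Matrix.mulVec_mulVec, ctrl_mulVec_tens_of_mulVec_eq_zero, stopOp_mulVec_of_stopped hr h1]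
  rw [basisProj_mulVec]
  simp [hr.symm]

/-- A clock value at which the computation has stopped by stage `j`. -/
def HasStopped (m j : ℕ) : Level m → Prop
  | none => False
  | some (k, _) => (k : ℕ) ≤ j

/-- A clock value at which the computation has failed. -/
def HasFailed (m : ℕ) : Level m → Prop
  | none => False
  | some (_, good) => good = false

open Classical in
/-- The projection onto the computations that have stopped by stage `j`; it is `0` for `j = 0` and
`1` for `j ≥ m`. -/
def clockProj (σ β : Type) [Fintype σ] [DecidableEq σ] [Fintype β] [DecidableEq β] (m N j : ℕ) :
    Matrix (Space σ β m N) (Space σ β m N) ℂ :=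
  Matrix.diagonal fun w =>
    if m ≤ j ∨ 0 < j ∧ Sum.elim (fun p => HasStopped m j p.1) (fun _ => False) w then 1 else 0

open Classical in
/-- The projection onto the failed computations. -/
def flagProj (σ β : Type) [Fintype σ] [DecidableEq σ] [Fintype β] [DecidableEq β] (m N : ℕ) :
    Matrix (Space σ β m N) (Space σ β m N) ℂ :=
  Matrix.diagonal fun w =>
    if Sum.elim (fun p => HasFailed m p.1) (fun _ => False) w then 1 else 0

open Classical in
theorem stage_mul_clockProj (hG : Gᴴ * G = 1) (K : ℕ) {j : ℕ} (hj : j < m) :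
    Circuit.eval OA OB (stageCircuit m N hG K (j + 1)) * clockProj σ β m N j =
      clockProj σ β m N j := by
  refine Matrix.ext_of_mulVec_single fun w => ?_
  have hd : clockProj σ β m N j *ᵥ Pi.single w 1 =
      if m ≤ j ∨ 0 < j ∧ Sum.elim (fun p => HasStopped m j p.1) (fun _ => False) w then
        Pi.single w 1 else 0 := by
    rw [clockProj, Matrix.diagonal_mulVec_single]
    split_ifs <;> simp
  rw [← Matrix.mulVec_mulVec, hd]
  split_ifs with h
  · rcases h with h | ⟨h0, h⟩
    · omega
    rcases w with ⟨r, p⟩ | s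
    · rcases r with _ | ⟨k, good⟩
      · exact h.elim
      have hk : (k : ℕ) ≤ j := h
      have hs : (Pi.single (Sum.inl (some (k, good), p)) 1 : Space σ β m N → ℂ) =
          Sum.elim (tens (Pi.single (some (k, good)) 1) (Pi.single p 1)) 0 := by
        rw [single_tens_single]
        ext (q | s)
        · simp [Pi.single_apply]
        · simp
      rw [hs, stageCircuit_eval, mainOp_mulVec, stage_mulVec_of_stopped]
      · simp
      · intro good'
        simp only [stopLevel, ne_eq, Option.some.injEq, Prod.mk.injEq, not_and]
        intro hk'
        have := congrArg Fin.val hk'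
        simp only at this
        omega
    · exact h.elim
  · simp

open Classical in
/-- The solution norm estimator with `m` stages, stage `j` of which uses `K j` walk steps. The
threshold is reached as soon as one of the samples is good. -/
def estimator (m N : ℕ) (hm : 1 ≤ m) (hG : Gᴴ * G = 1) (zero : σ) (K : ℕ → ℕ) (αinv : ℝ) :
    VTAAEstimator σ β (Space σ β m N) where
  m := m
  clock := clockProj σ β m N
  flag := flagProj σ β m N
  clock_proj j := isStarProjection_diagonal_ite _
  flag_proj := isStarProjection_diagonal_ite _
  clock_zero := by
    rw [clockProj, ← Matrix.diagonal_zero]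
    congr 1
    ext w
    rw [if_neg (by omega)]
  clock_top j hj := by
    rw [clockProj, ← Matrix.diagonal_one]
    congr 1
    ext w
    rw [if_pos (Or.inl hj)]
  clock_mono j := by
    rw [clockProj, clockProj, Matrix.diagonal_sub, Matrix.posSemidef_diagonal_iff]
    intro w
    have hmono : (m ≤ j ∨ 0 < j ∧ Sum.elim (fun p => HasStopped m j p.1) (fun _ => False) w) →
        (m ≤ j + 1 ∨ 0 < j + 1 ∧
          Sum.elim (fun p => HasStopped m (j + 1) p.1) (fun _ => False) w) := by
      rintro (h | ⟨h0, h⟩)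
      · exact Or.inl (by omega)
      · refine Or.inr ⟨by omega, ?_⟩
        rcases w with ⟨_ | ⟨k, good⟩, p⟩ | s
        · exact h
        · exact Nat.le_succ_of_le h
        · exact h
    split_ifs with h1 h2 h2
    · simp
    · simp
    · exact absurd (hmono h2) h1
    · simp
  flag_comm j := Matrix.commute_diagonal _ _
  start := Sum.inr zero
  prep := prepCircuit m N hG
  prep_costB := rfl
  prep_costA := rfl
  input _ j := stageCircuit m N hG (K j) j
  input_costB _ j := stageCircuit_costB hG (K j) j
  input_clock OA OB _ j hj := stage_mul_clockProj OA OB hG (K (j + 1)) hj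
  levels := m
  one_le_levels := hm
  levels_le := le_rfl
  runs _ := 32
  threshold := √(1 / 32)
  output l := αinv / 3 ^ l

end Estimator

/-! ### The state of the variable time algorithm -/

theorem vnorm_add_sq {ι : Type} [Fintype ι] {a b : ι → ℂ} (h : star a ⬝ᵥ b = 0) :
    vnorm (a + b) ^ 2 = vnorm a ^ 2 + vnorm b ^ 2 := by
  have h' : star b ⬝ᵥ a = 0 := by
    rw [Matrix.star_dotProduct, h, star_zero]
  have : ((vnorm (a + b) ^ 2 : ℝ) : ℂ) = ((vnorm a ^ 2 + vnorm b ^ 2 : ℝ) : ℂ) := by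
    rw [Complex.ofReal_add, ofReal_vnorm_sq, ofReal_vnorm_sq, ofReal_vnorm_sq, star_add,
      add_dotProduct, dotProduct_add, dotProduct_add, h, h']
    ring
  exact_mod_cast this

theorem vnorm_single_tens {ι κ : Type} [Fintype ι] [DecidableEq ι] [Fintype κ] [DecidableEq κ]
    (i : ι) (y : κ → ℂ) : vnorm (tens (Pi.single i 1) y) ^ 2 = vnorm y ^ 2 := by
  have : ((vnorm (tens (Pi.single i 1) y) ^ 2 : ℝ) : ℂ) = (vnorm y ^ 2 : ℝ) := by
    rw [ofReal_vnorm_sq, star_tens_dotProduct, ofReal_vnorm_sq]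
    simp
  exact_mod_cast this

section State

variable {σ β : Type} [Fintype σ] [DecidableEq σ] [Fintype β] [DecidableEq β] {m N : ℕ}
  {G : Matrix β σ ℂ}

/-- A state of the first three registers as a state of the whole workspace. -/
def embed (ψ : Level m × (Fin (N + 1) × β) → ℂ) : Space σ β m N → ℂ := Sum.elim ψ 0

theorem embed_zero : (embed 0 : Space σ β m N → ℂ) = 0 := by
  ext (p | s) <;> simp [embed]

theorem embed_add (ψ φ : Level m × (Fin (N + 1) × β) → ℂ) :
    (embed (ψ + φ) : Space σ β m N → ℂ) = embed ψ + embed φ := by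
  ext (p | s) <;> simp [embed]

theorem embed_smul (c : ℂ) (ψ : Level m × (Fin (N + 1) × β) → ℂ) :
    (embed (c • ψ) : Space σ β m N → ℂ) = c • embed ψ := by
  ext (p | s) <;> simp [embed]

theorem vnorm_embed_sq (ψ : Level m × (Fin (N + 1) × β) → ℂ) :
    vnorm (embed ψ : Space σ β m N → ℂ) ^ 2 = vnorm ψ ^ 2 := by
  rw [vnorm_sq, vnorm_sq]
  simp [embed]

/-- A computation stops exactly on the complement of the encoded states. -/
theorem stopOp_mulVec_active (j : ℕ) (y : Fin (N + 1) × β → ℂ) :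
    stopOp m N j G *ᵥ tens (Pi.single none 1) y =
      tens (Pi.single none 1) ((encode N G * (encode N G)ᴴ) *ᵥ y) +
        tens (stopVec m j) ((1 - encode N G * (encode N G)ᴴ) *ᵥ y) := by
  set P := encode N G * (encode N G)ᴴ with hP
  set s := stopVec m j with hs
  have hs0 : s none = 0 := by simp [hs, stopVec, stopLevel]
  have h1 : star (Pi.single none 1 - s) ⬝ᵥ (Pi.single none (1 : ℂ)) = 1 := by
    simp [hs0]
  have h2 : star (Pi.single none 1 - s) ⬝ᵥ (Pi.single none (1 : ℂ) - s) = 2 := by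
    rw [dotProduct_sub, h1, star_sub, sub_dotProduct, star_stopVec_dotProduct_self,
      ← Pi.single_star, single_dotProduct, hs0]
    norm_num
  rw [stopOp, ctrl_mulVec_tens, lineProj_mulVec, h1, h2, two_mul, Matrix.sub_mulVec,
    Matrix.add_mulVec, Matrix.sub_mulVec, Matrix.one_mulVec]
  ext p
  simp only [tens, Pi.add_apply, Pi.sub_apply, Pi.smul_apply, smul_eq_mul]
  ring

variable (G) in
/-- The encoded vector in the active part of the state after stage `j`. -/
def activeVec (N : ℕ) (R : Matrix β β ℂ) (K : ℕ → ℕ) (z : σ → ℂ) : ℕ → σ → ℂ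
  | 0 => z
  | j + 1 => (encode N G)ᴴ *ᵥ (filterOp N R (K (j + 1)) *ᵥ (encode N G *ᵥ activeVec N R K z j))

variable (G) in
/-- The part of the state that stops at stage `j + 1`. -/
def stopPart (N : ℕ) (R : Matrix β β ℂ) (K : ℕ → ℕ) (z : σ → ℂ) (j : ℕ) :
    Fin (N + 1) × β → ℂ :=
  (1 - encode N G * (encode N G)ᴴ) *ᵥ
    (filterOp N R (K (j + 1)) *ᵥ (encode N G *ᵥ activeVec G N R K z j))

theorem vnorm_stopPart_sq (hG : Gᴴ * G = 1) {R : Matrix β β ℂ} (hR : Rᴴ * R = 1) (K : ℕ → ℕ)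
    (z : σ → ℂ) (j : ℕ) :
    vnorm (stopPart G N R K z j) ^ 2 =
      vnorm (activeVec G N R K z j) ^ 2 - vnorm (activeVec G N R K z (j + 1)) ^ 2 := by
  have h := vnorm_sq_add_compl (isStarProjection_mul_conjTranspose (encode_isometry (N := N) hG))
    (filterOp N R (K (j + 1)) *ᵥ (encode N G *ᵥ activeVec G N R K z j))
  rw [vnorm_mulVec_of_isometry (filterOp_isometry hR _),
    vnorm_mulVec_of_isometry (encode_isometry hG), ← Matrix.mulVec_mulVec,
    vnorm_mulVec_of_isometry (encode_isometry hG)] at h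
  rw [stopPart, activeVec, ← h]
  ring

theorem stopLevel_ne {i j : ℕ} (hij : i < j) (hj : j ≤ m) (g g' : Bool) :
    stopLevel m i g ≠ stopLevel m j g' := by
  intro h
  simp only [stopLevel, Option.some.injEq, Prod.mk.injEq, Fin.mk.injEq] at h
  omega

theorem walkOp_isometry (hG : Gᴴ * G = 1) (OA : Matrix.unitaryGroup β ℂ) :
    (walkOp G (OA : Matrix β β ℂ))ᴴ * walkOp G OA = 1 := by
  have hP := isStarProjection_mul_conjTranspose hG
  have hO : (OA : Matrix β β ℂ)ᴴ * (OA : Matrix β β ℂ) = 1 := Matrix.UnitaryGroup.star_mul_self OA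
  have hO' : (OA : Matrix β β ℂ)ᴴᴴ * (OA : Matrix β β ℂ)ᴴ = 1 := by
    rw [Matrix.conjTranspose_conjTranspose]; exact mul_eq_one_comm.1 hO
  exact isometry_mul (two_mul_sub_one_isometry hP)
    (isometry_mul (isometry_mul hO (one_sub_two_mul_isometry hP)) hO')

variable (OA : Matrix.unitaryGroup β ℂ) (OB : Matrix.unitaryGroup σ ℂ)

theorem plainState_estimator (hm : 1 ≤ m) (hG : Gᴴ * G = 1) (zero : σ) (K : ℕ → ℕ) (αinv : ℝ)
    (l : ℕ) {j : ℕ} (hj : j ≤ m) {b : σ → ℂ} (hb : b = (OB : Matrix σ σ ℂ) *ᵥ Pi.single zero 1) :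
    (estimator m N hm hG zero K αinv).plainState OA OB l j =
      embed (tens (Pi.single none 1)
          (encode N G *ᵥ activeVec G N (walkOp G OA) K ((1 / 3 : ℂ) • b) j) +
        (((√8 / 3 : ℝ) : ℂ) • tens (Pi.single (stopLevel m 0 false) 1) (encode N G *ᵥ b) +
        ∑ i ∈ Finset.range j, tens (stopVec m (i + 1))
          (stopPart G N (walkOp G OA) K ((1 / 3 : ℂ) • b) i))) := by
  set R := walkOp G (OA : Matrix β β ℂ) with hR
  set z := (1 / 3 : ℂ) • b with hz
  induction j with
  | zero =>
    have h1 : (Pi.single (Sum.inr zero) 1 : Space σ β m N → ℂ) =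
        Sum.elim (0 : Level m × (Fin (N + 1) × β) → ℂ) (Pi.single zero 1) := by
      ext (p | s)
      · simp
      · simp [Pi.single_apply]
    change Circuit.eval OA OB (prepCircuit m N hG) *ᵥ Pi.single (Sum.inr zero) 1 = _
    simp only [prepCircuit, Circuit.eval, Matrix.one_mul, stateGate_eval]
    rw [← Matrix.mulVec_mulVec, h1, Matrix.fromBlocks_mulVec]
    simp only [Sum.elim_comp_inl, Sum.elim_comp_inr, Matrix.mulVec_zero, Matrix.zero_mulVec,
      add_zero, zero_add, ← hb, Gate.eval, moveOp, Matrix.fromBlocks_mulVec, colTens_mulVec]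
    congr 1
    rw [startVec, add_tens, smul_tens, smul_tens, activeVec, hz, Matrix.mulVec_smul, tens_smul]
    simp
  | succ j ih =>
    change Circuit.eval OA OB (stageCircuit m N hG (K (j + 1)) (j + 1)) *ᵥ
      (estimator m N hm hG zero K αinv).plainState OA OB l j = _
    have hfix : ∀ i < j + 1, ∀ g y,
        (stopOp m N (j + 1) G * ctrl (basisProj none) (filterOp N (walkOp G OA) (K (j + 1)))) *ᵥ
          tens (Pi.single (stopLevel m i g) 1) y = tens (Pi.single (stopLevel m i g) 1) y :=
      fun i hi g y => stage_mulVec_of_stopped OA _ (by simp [stopLevel])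
        (fun g' => stopLevel_ne hi hj _ _) _
    have hfix' : ∀ i < j + 1, ∀ y,
        (stopOp m N (j + 1) G * ctrl (basisProj none) (filterOp N (walkOp G OA) (K (j + 1)))) *ᵥ
          tens (stopVec m i) y = tens (stopVec m i) y := by
      intro i hi y
      rw [stopVec, add_tens, smul_tens, smul_tens, Matrix.mulVec_add, Matrix.mulVec_smul,
        Matrix.mulVec_smul, hfix i hi, hfix i hi]
    rw [ih (by omega), stageCircuit_eval, embed, mainOp_mulVec, Matrix.mulVec_add,
      Matrix.mulVec_add,
      Matrix.mulVec_smul, hfix 0 (by omega), Matrix.mulVec_sum,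
      Finset.sum_congr rfl fun i hi => hfix' (i + 1)
        (Nat.succ_lt_succ (Finset.mem_range.1 hi)) _,
      ← Matrix.mulVec_mulVec, ctrl_mulVec_tens_of_mulVec_eq_self, stopOp_mulVec_active,
      Finset.sum_range_succ, activeVec, stopPart,
      ← Matrix.mulVec_mulVec _ (encode N G) (encode N G)ᴴ, ← hR, embed]
    · congr 1
      abel
    · rw [basisProj_mulVec]; simp

theorem failed_mulVec_single (hm : 1 ≤ m) (hG : Gᴴ * G = 1) (zero : σ) (K : ℕ → ℕ) (αinv : ℝ)
    {j : ℕ} (hj0 : 0 < j) {r : Level m} (hr : HasFailed m r → HasStopped m j r)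
    [Decidable (HasFailed m r)] (y : Fin (N + 1) × β → ℂ) :
    (1 - (estimator m N hm hG zero K αinv).failed j) *ᵥ embed (tens (Pi.single r 1) y) =
      if HasFailed m r then 0 else embed (tens (Pi.single r 1) y) := by
  change (1 - clockProj σ β m N j * flagProj σ β m N) *ᵥ _ = _
  rw [clockProj, flagProj, Matrix.diagonal_mul_diagonal, Matrix.sub_mulVec, Matrix.one_mulVec]
  ext (⟨r', p⟩ | s)
  · by_cases hrr : r' = r
    · subst hrr
      by_cases hf : HasFailed m r'
      · simp [embed, Matrix.mulVec_diagonal, hf, hr hf, hj0]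
      · simp [embed, Matrix.mulVec_diagonal, hf]
    · split_ifs <;> simp [embed, Matrix.mulVec_diagonal, tens, hrr]
  · split_ifs <;> simp [embed, Matrix.mulVec_diagonal]

/-- The squared amplitude before amplification is the good mass of the filtered initial vector. -/
theorem plainAmp_estimator_sq (hm : 1 ≤ m) (hG : Gᴴ * G = 1) (zero : σ) (K : ℕ → ℕ) (αinv : ℝ)
    (l : ℕ) {j : ℕ} (hj0 : 0 < j) (hj : j ≤ m) {b : σ → ℂ}
    (hb : b = (OB : Matrix σ σ ℂ) *ᵥ Pi.single zero 1) :
    (estimator m N hm hG zero K αinv).plainAmp OA OB l j ^ 2 =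
      goodMass (fun i => vnorm (activeVec G N (walkOp G OA) K ((1 / 3 : ℂ) • b) i) ^ 2) m j := by
  set R := walkOp G (OA : Matrix β β ℂ) with hR
  set z := (1 / 3 : ℂ) • b with hz
  set E := estimator m N hm hG zero K αinv with hE
  classical
  have hstopVec : ∀ i ≤ j, ∀ y, (1 - E.failed j) *ᵥ embed (tens (stopVec m i) y) =
      (stopAmp m i : ℂ) • embed (tens (Pi.single (stopLevel m i true) 1) y) := by
    intro i hi y
    rw [stopVec, add_tens, smul_tens, smul_tens, embed_add, embed_smul, embed_smul,
      Matrix.mulVec_add,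
      Matrix.mulVec_smul, Matrix.mulVec_smul,
      failed_mulVec_single hm hG zero K αinv hj0 (fun h => by simp [HasFailed, stopLevel] at h),
      failed_mulVec_single hm hG zero K αinv hj0
        (r := stopLevel m i false) (fun _ => (min_le_left i m).trans hi),
      if_neg (by simp [HasFailed, stopLevel]), if_pos (by simp [HasFailed, stopLevel]), smul_zero,
      add_zero]
  have hsum : ∀ n ≤ j, (1 - E.failed j) *ᵥ embed (∑ i ∈ Finset.range n,
      tens (stopVec m (i + 1)) (stopPart G N R K z i)) =
      embed (∑ i ∈ Finset.range n, (stopAmp m (i + 1) : ℂ) •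
        tens (Pi.single (stopLevel m (i + 1) true) 1) (stopPart G N R K z i)) := by
    intro n
    induction n with
    | zero =>
      intro _
      simp [embed_zero]
    | succ n ih =>
      intro hn
      rw [Finset.sum_range_succ, Finset.sum_range_succ, embed_add, embed_add, Matrix.mulVec_add,
        ih (by omega), hstopVec _ hn, embed_smul]
  have hnorm : ∀ n ≤ j, vnorm (tens (Pi.single none 1) (encode N G *ᵥ activeVec G N R K z j) +
      ∑ i ∈ Finset.range n, (stopAmp m (i + 1) : ℂ) •
        tens (Pi.single (stopLevel m (i + 1) true) 1) (stopPart G N R K z i)) ^ 2 =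
      vnorm (activeVec G N R K z j) ^ 2 +
        ∑ i ∈ Finset.range n, stopAmp m (i + 1) ^ 2 * vnorm (stopPart G N R K z i) ^ 2 := by
    intro n
    induction n with
    | zero =>
      intro _
      simp only [Finset.range_zero, Finset.sum_empty, add_zero]
      rw [vnorm_single_tens, vnorm_mulVec_of_isometry (encode_isometry hG)]
    | succ n ih =>
      intro hn
      rw [Finset.sum_range_succ, Finset.sum_range_succ, ← add_assoc, vnorm_add_sq, ih (by omega),
        vnorm_smul, mul_pow, vnorm_single_tens, Complex.norm_real, Real.norm_eq_abs, sq_abs,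
        add_assoc]
      -- the clock values of different stages are orthogonal
      rw [star_add, add_dotProduct, dotProduct_smul, star_tens_dotProduct, star_sum,
        sum_dotProduct, Finset.sum_eq_zero]
      · simp [stopLevel]
      · intro i hi
        have := stopLevel_ne (m := m) (Nat.succ_lt_succ (Finset.mem_range.1 hi)) (hn.trans hj)
          true true
        rw [dotProduct_smul, star_smul, smul_dotProduct, star_tens_dotProduct, dotProduct_single]
        simp [Ne.symm this]
  have hfinal : (1 - E.failed j) *ᵥ E.plainState OA OB l j =
      embed (tens (Pi.single none 1) (encode N G *ᵥ activeVec G N R K z j) +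
        ∑ i ∈ Finset.range j, (stopAmp m (i + 1) : ℂ) •
          tens (Pi.single (stopLevel m (i + 1) true) 1) (stopPart G N R K z i)) := by
    rw [hE, plainState_estimator OA OB hm hG zero K αinv l hj hb, embed_add, embed_add,
      Matrix.mulVec_add,
      Matrix.mulVec_add, ← hE, ← hR, ← hz, hsum j le_rfl, embed_smul, Matrix.mulVec_smul,
      failed_mulVec_single hm hG zero K αinv hj0 (r := none) (fun h => False.elim h),
      failed_mulVec_single hm hG zero K αinv hj0 (r := stopLevel m 0 false)
        (fun _ => (min_le_left 0 m).trans (Nat.zero_le j)),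
      if_neg (show ¬ HasFailed m none from fun h => h), if_pos (by simp [HasFailed, stopLevel]),
        smul_zero, zero_add, embed_add]
  rw [VTAAEstimator.plainAmp, hfinal, vnorm_embed_sq, hnorm j le_rfl, goodMass]
  congr 1
  refine Finset.sum_congr rfl fun i hi => ?_
  have := Finset.mem_range.1 hi
  rw [stopAmp_sq (by omega), vnorm_stopPart_sq hG (walkOp_isometry hG OA)]

end State

/-! ### Spectral decomposition -/

section Spectral

variable {σ β : Type} [Fintype σ] [DecidableEq σ] [Fintype β] [DecidableEq β]

/-- An orthonormal family of plain vectors. -/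
def IsOrtho (e : σ → σ → ℂ) : Prop := ∀ p q, star (e p) ⬝ᵥ e q = if p = q then 1 else 0

theorem exists_eigenbasis {M : Matrix σ σ ℂ} (hM : M.IsHermitian) :
    ∃ (e : σ → σ → ℂ) (x : σ → ℝ), IsOrtho e ∧ (∀ p, M *ᵥ e p = (x p : ℂ) • e p) ∧
      ∀ v : σ → ℂ, ∃ c : σ → ℂ, v = ∑ p, c p • e p := by
  refine ⟨fun p => (hM.eigenvectorBasis p).ofLp, hM.eigenvalues, fun p q => ?_, fun p => ?_,
    fun v => ⟨fun p => hM.eigenvectorBasis.repr (WithLp.toLp 2 v) p, ?_⟩⟩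
  · have := orthonormal_iff_ite.1 hM.eigenvectorBasis.orthonormal p q
    rw [← this, EuclideanSpace.inner_eq_star_dotProduct, dotProduct_comm]
  · rw [hM.mulVec_eigenvectorBasis]
    ext i
    simp
  · have := congrArg WithLp.ofLp (hM.eigenvectorBasis.sum_repr (WithLp.toLp 2 v))
    rw [WithLp.ofLp_sum] at this
    simpa using this.symm

theorem star_sum_ortho_dotProduct {e : σ → σ → ℂ} (he : IsOrtho e) (a c : σ → ℂ) :
    star (∑ p, a p • e p) ⬝ᵥ (∑ p, c p • e p) = ∑ p, star (a p) * c p := by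
  rw [star_sum, sum_dotProduct]
  refine Finset.sum_congr rfl fun p _ => ?_
  rw [dotProduct_sum, Finset.sum_eq_single p]
  · rw [star_smul, smul_dotProduct, dotProduct_smul, he, if_pos rfl]
    simp
  · intro q _ hq
    rw [dotProduct_smul, star_smul, smul_dotProduct, he, if_neg hq.symm]
    simp
  · simp

theorem vnorm_sum_ortho_sq {e : σ → σ → ℂ} (he : IsOrtho e) (a : σ → ℂ) :
    vnorm (∑ p, a p • e p) ^ 2 = ∑ p, ‖a p‖ ^ 2 := by
  have : ((vnorm (∑ p, a p • e p) ^ 2 : ℝ) : ℂ) = ((∑ p, ‖a p‖ ^ 2 : ℝ) : ℂ) := by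
    rw [ofReal_vnorm_sq, star_sum_ortho_dotProduct he]
    push_cast
    exact Finset.sum_congr rfl fun p _ => Complex.conj_mul' _
  exact_mod_cast this

/-- In the eigenbasis each stage multiplies the active vector by the filter. -/
theorem activeVec_eq_sum {N : ℕ} {G : Matrix β σ ℂ} (hG : Gᴴ * G = 1) {O : Matrix β β ℂ}
    (hO : O * Oᴴ = 1) {K : ℕ → ℕ} (hK : ∀ j, K j ≤ N) {e : σ → σ → ℂ} {η : σ → ℝ}
    (he : ∀ p, ((Gᴴ * O * G) * (Gᴴ * O * G)ᴴ) *ᵥ e p =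
      ((Real.sin (η p) ^ 2 : ℝ) : ℂ) • e p) (c : σ → ℂ) (j : ℕ) :
    activeVec G N (walkOp G O) K (∑ p, c p • e p) j =
      ∑ p, (c p * ((∏ i ∈ Finset.range j, chebFilter (K (i + 1)) (η p) : ℝ) : ℂ)) • e p := by
  induction j with
  | zero => simp [activeVec]
  | succ j ih =>
    rw [activeVec, ih, encode_filterOp_encode G _ (hK (j + 1))]
    simp only [Matrix.mulVec_sum, Matrix.mulVec_smul, walkOp_pow_eigenvector hG hO (he _)]
    rw [Finset.sum_comm, Finset.smul_sum]
    refine Finset.sum_congr rfl fun p _ => ?_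
    simp only [smul_smul, ← Finset.sum_smul, ← Finset.mul_sum]
    congr 1
    rw [Finset.prod_range_succ, chebFilter]
    push_cast
    ring

theorem solNorm_eq_vnorm (A : Matrix σ σ ℂ) (b : EuclideanSpace ℂ σ) :
    solNorm A b = vnorm (A⁻¹ *ᵥ b.ofLp) := rfl

theorem vnorm_mulVec_le (A : Matrix σ σ ℂ) (v : σ → ℂ) :
    vnorm (A *ᵥ v) ≤ ‖Matrix.toEuclideanCLM (𝕜 := ℂ) A‖ * vnorm v :=
  (Matrix.toEuclideanCLM (𝕜 := ℂ) A).le_opNorm (WithLp.toLp 2 v)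

theorem norm_toEuclideanCLM_conjTranspose (A : Matrix σ σ ℂ) :
    ‖Matrix.toEuclideanCLM (𝕜 := ℂ) Aᴴ‖ = ‖Matrix.toEuclideanCLM (𝕜 := ℂ) A‖ := by
  rw [← Matrix.star_eq_conjTranspose, map_star, ContinuousLinearMap.star_eq_adjoint,
    LinearIsometryEquiv.norm_map]

/-- The squared norm of `A⁻¹ b` in terms of an eigenbasis of `A Aᴴ`. -/
theorem vnorm_inv_mulVec_sq {A : Matrix σ σ ℂ} (hA : IsUnit A) {e : σ → σ → ℂ} (he : IsOrtho e)
    {t : σ → ℝ} (ht : ∀ p, t p ≠ 0) (hAe : ∀ p, (A * Aᴴ) *ᵥ e p = (t p : ℂ) • e p)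
    (c : σ → ℂ) :
    vnorm (A⁻¹ *ᵥ ∑ p, c p • e p) ^ 2 = ∑ p, ‖c p‖ ^ 2 / t p := by
  set y := ∑ p, (c p / t p) • e p with hy
  have h1 : (A * Aᴴ) *ᵥ y = ∑ p, c p • e p := by
    rw [hy, Matrix.mulVec_sum]
    refine Finset.sum_congr rfl fun p _ => ?_
    rw [Matrix.mulVec_smul, hAe, smul_smul, div_mul_cancel₀]
    exact_mod_cast ht p
  have h2 : A⁻¹ *ᵥ ∑ p, c p • e p = Aᴴ *ᵥ y := by
    rw [← h1, Matrix.mulVec_mulVec, ← Matrix.mul_assoc,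
      Matrix.nonsing_inv_mul _ ((Matrix.isUnit_iff_isUnit_det A).1 hA), Matrix.one_mul]
  have h3 : ((vnorm (Aᴴ *ᵥ y) ^ 2 : ℝ) : ℂ) = ((∑ p, ‖c p‖ ^ 2 / t p : ℝ) : ℂ) := by
    rw [ofReal_vnorm_sq, Matrix.star_mulVec, Matrix.conjTranspose_conjTranspose,
      Matrix.dotProduct_mulVec, Matrix.vecMul_vecMul, ← Matrix.dotProduct_mulVec, h1, hy,
      star_sum_ortho_dotProduct he]
    push_cast
    refine Finset.sum_congr rfl fun p _ => ?_
    rw [← Complex.conj_mul', star_div₀]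
    simp only [RCLike.star_def, Complex.conj_ofReal]
    ring
  rw [h2]
  exact_mod_cast h3

/-- The spectral data of an instance: an orthonormal basis of eigenvectors with eigenvalues
`sin² η ∈ [1 / κ², 1]`, in which `p_succ` is a weighted mean of `1 / (κ² sin² η)`. -/
theorem IsInstance.exists_spectral {zero : σ} {G : Matrix β σ ℂ} {αA αinv αp : ℝ}
    {A : Matrix σ σ ℂ} {b : EuclideanSpace ℂ σ} {OA : Matrix.unitaryGroup β ℂ}
    {OB : Matrix.unitaryGroup σ ℂ} (hI : IsInstance zero G αA αinv αp A b OA OB) (hαA : 0 < αA) :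
    ∃ (e : σ → σ → ℂ) (η : σ → ℝ) (c : σ → ℂ), IsOrtho e ∧
      (∀ p, ((Gᴴ * (OA : Matrix β β ℂ) * G) * (Gᴴ * (OA : Matrix β β ℂ) * G)ᴴ) *ᵥ e p =
        ((Real.sin (η p) ^ 2 : ℝ) : ℂ) • e p) ∧
      b.ofLp = ∑ p, c p • e p ∧ (∑ p, ‖c p‖ ^ 2 = 1) ∧
      (∀ p, 1 ≤ (αA * αinv) ^ 2 * Real.sin (η p) ^ 2) ∧
      psucc A b αinv = ∑ p, ‖c p‖ ^ 2 / ((αA * αinv) ^ 2 * Real.sin (η p) ^ 2) := by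
  set M := (Gᴴ * (OA : Matrix β β ℂ) * G) * (Gᴴ * (OA : Matrix β β ℂ) * G)ᴴ with hM
  have hMH : M.IsHermitian := Matrix.isHermitian_mul_conjTranspose_self _
  obtain ⟨e, x, he, hx, hspan⟩ := exists_eigenbasis hMH
  have hαA' : (αA : ℂ) ≠ 0 := by exact_mod_cast hαA.ne'
  have hAM : A * Aᴴ = ((αA ^ 2 : ℝ) : ℂ) • M := by
    rw [hM, hI.block_encoding, Matrix.conjTranspose_smul, Matrix.smul_mul, Matrix.mul_smul,
      smul_smul, smul_smul]
    have : star (αA : ℂ)⁻¹ = (αA : ℂ)⁻¹ := by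
      rw [star_inv₀]; congr 1; exact Complex.conj_ofReal _
    rw [this]
    push_cast
    field_simp
    simp
  have hAe : ∀ p, (A * Aᴴ) *ᵥ e p = ((αA ^ 2 * x p : ℝ) : ℂ) • e p := by
    intro p
    rw [hAM, Matrix.smul_mulVec, hx, smul_smul, Complex.ofReal_mul]
  have hnorm : ∀ p, vnorm (Aᴴ *ᵥ e p) ^ 2 = αA ^ 2 * x p := by
    intro p
    have : ((vnorm (Aᴴ *ᵥ e p) ^ 2 : ℝ) : ℂ) = ((αA ^ 2 * x p : ℝ) : ℂ) := by
      rw [ofReal_vnorm_sq, Matrix.star_mulVec, Matrix.conjTranspose_conjTranspose,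
        Matrix.dotProduct_mulVec, Matrix.vecMul_vecMul, ← Matrix.dotProduct_mulVec, hAe,
        dotProduct_smul, he, if_pos rfl]
      simp
    exact_mod_cast this
  have he1 : ∀ p, vnorm (e p) = 1 := by
    intro p
    have h1 : ((vnorm (e p) ^ 2 : ℝ) : ℂ) = 1 := by rw [ofReal_vnorm_sq, he, if_pos rfl]
    have h2 : vnorm (e p) ^ 2 = 1 := by exact_mod_cast h1
    exact (pow_eq_one_iff_of_nonneg (vnorm_nonneg _) two_ne_zero).1 h2
  have hdet : IsUnit A.det := (Matrix.isUnit_iff_isUnit_det A).1 hI.invertible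
  have hx0 : ∀ p, 0 < x p := by
    intro p
    have h1 : 0 < vnorm (Aᴴ *ᵥ e p) ^ 2 := by
      refine pow_pos (lt_of_le_of_ne (vnorm_nonneg _) fun h => ?_) 2
      have h2 := vnorm_eq_zero.1 h.symm
      have h3 : e p = (Aᴴ)⁻¹ *ᵥ (Aᴴ *ᵥ e p) := by
        rw [Matrix.mulVec_mulVec, Matrix.nonsing_inv_mul _ (by
          rw [Matrix.det_conjTranspose]; exact hdet.star), Matrix.one_mulVec]
      rw [h2, Matrix.mulVec_zero] at h3
      have h4 := he1 p
      rw [h3, vnorm_eq_zero.2 rfl] at h4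
      exact zero_ne_one h4
    rw [hnorm] at h1
    exact pos_of_mul_pos_right h1 (by positivity)
  have hx1 : ∀ p, x p ≤ 1 := by
    intro p
    have h1 := vnorm_mulVec_le Aᴴ (e p)
    rw [norm_toEuclideanCLM_conjTranspose, he1, mul_one] at h1
    have h2 := pow_le_pow_left₀ (vnorm_nonneg _) (h1.trans hI.norm_le) 2
    rw [hnorm] at h2
    have : 0 < αA ^ 2 := by positivity
    nlinarith
  have hsin : ∀ p, Real.sin (Real.arcsin √(x p)) ^ 2 = x p := by
    intro p
    rw [Real.sin_arcsin (by linarith [Real.sqrt_nonneg (x p)]) (Real.sqrt_le_one.2 (hx1 p)),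
      Real.sq_sqrt (hx0 p).le]
  have ht : ∀ p, αA ^ 2 * x p ≠ 0 := fun p => mul_ne_zero (by positivity) (hx0 p).ne'
  obtain ⟨c, hc⟩ := hspan b.ofLp
  refine ⟨e, fun p => Real.arcsin √(x p), c, he, fun p => by rw [hsin, hx], hc, ?_, fun p => ?_, ?_⟩
  · rw [← vnorm_sum_ortho_sq he, ← hc, hI.state_prep]
    change vnorm ((OB : Matrix σ σ ℂ) *ᵥ Pi.single zero 1) ^ 2 = 1
    rw [vnorm_mulVec_of_isometry (Matrix.UnitaryGroup.star_mul_self OB), vnorm_single, one_pow]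
  · rw [hsin]
    have h1 := vnorm_mulVec_le A⁻¹ (e p)
    rw [he1, mul_one] at h1
    have h2 := pow_le_pow_left₀ (vnorm_nonneg _) (h1.trans hI.norm_inv_le) 2
    have h3 := vnorm_inv_mulVec_sq hI.invertible he ht hAe (Pi.single p 1)
    have h4 : ∑ q, (Pi.single p (1 : ℂ) : σ → ℂ) q • e q = e p := by
      rw [Finset.sum_eq_single p]
      · simp
      · intro q _ hq; simp [hq]
      · simp
    have h5 : ∑ q, ‖(Pi.single p (1 : ℂ) : σ → ℂ) q‖ ^ 2 / (αA ^ 2 * x q) = 1 / (αA ^ 2 * x p) := by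
      rw [Finset.sum_eq_single p]
      · simp
      · intro q _ hq; simp [hq]
      · simp
    rw [h4, h5] at h3
    rw [h3, div_le_iff₀ (mul_pos (by positivity) (hx0 p))] at h2
    linarith
  · rw [psucc, solNorm_eq_vnorm, div_pow, hc, vnorm_inv_mulVec_sq hI.invertible he ht hAe,
      Finset.sum_div]
    refine Finset.sum_congr rfl fun p _ => ?_
    rw [hsin, div_div]
    congr 1
    ring

end Spectral

/-! ### The success amplitude and the solution norm -/

theorem goodMass_le {μ : ℕ → ℝ} (hμ : ∀ j, μ (j + 1) ≤ μ j) (m : ℕ) :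
    goodMass μ m m ≤ μ 0 := by
  have h : ∑ j ∈ Finset.range m, (9 : ℝ) ^ (j + 1) / 9 ^ m * (μ j - μ (j + 1)) ≤
      ∑ j ∈ Finset.range m, (μ j - μ (j + 1)) := by
    refine Finset.sum_le_sum fun j hj => ?_
    refine mul_le_of_le_one_left (sub_nonneg.2 (hμ j)) (div_le_one_of_le₀ ?_ (by positivity))
    exact pow_le_pow_right₀ (by norm_num) (Finset.mem_range.1 hj)
  rw [Finset.sum_range_sub' μ] at h
  rw [goodMass]
  linarith

theorem goodMass_sum {ι : Type} [Fintype ι] (w : ι → ℝ) (μ : ι → ℕ → ℝ) (m n : ℕ) :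
    goodMass (fun j => ∑ p, w p * μ p j) m n = ∑ p, w p * goodMass (μ p) m n := by
  simp only [goodMass, mul_add, Finset.sum_add_distrib, ← Finset.sum_sub_distrib, Finset.mul_sum]
  congr 1
  rw [Finset.sum_comm]
  exact Finset.sum_congr rfl fun p _ => Finset.sum_congr rfl fun j _ => by ring

/-- The number of walk steps at stage `j` of `m`: the filter of stage `j` has its cutoff at the
singular value `3 ^ (m - j) / κ`. -/
def walkSteps (κ : ℝ) (m j : ℕ) : ℕ := ⌊κ / 3 ^ (m - j)⌋₊

theorem walkSteps_le {κ : ℝ} (hκ : 0 ≤ κ) (m j : ℕ) : walkSteps κ m j ≤ ⌊κ⌋₊ :=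
  Nat.floor_le_floor (div_le_self hκ (one_le_pow₀ (by norm_num)))

theorem walkSteps_cost {κ : ℝ} (hκ : 0 ≤ κ) {m j : ℕ} (hj : j ≤ m) :
    (walkSteps κ m j : ℝ) * 3 ^ m ≤ κ * 3 ^ j := by
  obtain ⟨d, rfl⟩ := Nat.exists_eq_add_of_le hj
  have h := Nat.floor_le (show 0 ≤ κ / 3 ^ d by positivity)
  rw [le_div_iff₀ (by positivity)] at h
  rw [walkSteps, Nat.add_sub_cancel_left, pow_add]
  calc _ = (⌊κ / 3 ^ d⌋₊ * 3 ^ d : ℝ) * 3 ^ j := by ring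
    _ ≤ _ := mul_le_mul_of_nonneg_right h (by positivity)

/-- For a single eigenvector the good mass of the filtered process is `1 / (κ² sin² η)` up to
constants and a cutoff. -/
theorem goodMass_filter_bounds {κ η : ℝ} (hκ : 0 ≤ κ) (hX : 1 ≤ κ ^ 2 * Real.sin η ^ 2) (m : ℕ) :
    9 ^ m / (κ ^ 2 * Real.sin η ^ 2) / 81 ≤ 9 ^ m * goodMass (fun j =>
        (∏ i ∈ Finset.range j, chebFilter (walkSteps κ m (i + 1)) η) ^ 2) m m ∧
      9 ^ m * goodMass (fun j =>
        (∏ i ∈ Finset.range j, chebFilter (walkSteps κ m (i + 1)) η) ^ 2) m m ≤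
          81 + 180 * (9 ^ m / (κ ^ 2 * Real.sin η ^ 2)) := by
  have hX0 : 0 < κ ^ 2 * Real.sin η ^ 2 := by linarith
  have h9 : ∀ n, (9 : ℝ) ^ n = (3 ^ n) ^ 2 := fun n => by
    rw [← pow_mul, mul_comm, pow_mul]; norm_num
  refine goodMass_bounds (F := fun j => chebFilter (walkSteps κ m (j + 1)) η ^ 2) (by positivity)
    (div_le_self (by positivity) hX) (by simp) (fun j => ?_) (fun j => sq_nonneg _)
    (fun j => chebFilter_sq_le_one _ _) (fun j hj => ?_) (fun j hj => ?_)
  · rw [Finset.prod_range_succ, mul_pow]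
  · obtain ⟨d, rfl⟩ := Nat.exists_eq_add_of_le (Nat.succ_le_of_lt hj)
    have h1 := chebFilter_sq_mul_le (walkSteps κ (j + 1 + d) (j + 1)) η
    have h2 : κ / 3 ^ d ≤ walkSteps κ (j + 1 + d) (j + 1) + 1 := by
      rw [walkSteps, Nat.add_sub_cancel_left]
      exact (Nat.lt_floor_add_one _).le
    have h3 : (κ / 3 ^ d) ^ 2 * Real.sin η ^ 2 ≤
        ((walkSteps κ (j + 1 + d) (j + 1) : ℝ) + 1) ^ 2 * Real.sin η ^ 2 :=
      mul_le_mul_of_nonneg_right (pow_le_pow_left₀ (by positivity) h2 2) (sq_nonneg _)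
    have h4 := (mul_le_mul_of_nonneg_left h3
      (sq_nonneg (chebFilter (walkSteps κ (j + 1 + d) (j + 1)) η))).trans h1
    have h5 : 9 ^ (j + 1 + d) / (κ ^ 2 * Real.sin η ^ 2) / 9 ^ (j + 1) =
        1 / ((κ / 3 ^ d) ^ 2 * Real.sin η ^ 2) := by
      rw [div_pow, ← h9, pow_add]
      field_simp
    rw [Nat.succ_eq_add_one, h5, le_div_iff₀]
    · exact h4
    · have : (κ / 3 ^ d) ^ 2 * Real.sin η ^ 2 = κ ^ 2 * Real.sin η ^ 2 / (3 ^ d) ^ 2 := by ring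
      rw [this]
      positivity
  · obtain ⟨d, rfl⟩ := Nat.exists_eq_add_of_le (Nat.succ_le_of_lt hj)
    refine le_trans (sub_le_sub_left (mul_le_mul_of_nonneg_left ?_ (by norm_num)) 1)
      (one_sub_le_chebFilter_sq _ _)
    have h2 : (walkSteps κ (j + 1 + d) (j + 1) : ℝ) ≤ κ / 3 ^ d := by
      rw [walkSteps, Nat.add_sub_cancel_left]
      exact Nat.floor_le (by positivity)
    have h5 : 9 ^ (j + 1) / (9 ^ (j + 1 + d) / (κ ^ 2 * Real.sin η ^ 2)) =
        (κ / 3 ^ d) ^ 2 * Real.sin η ^ 2 := by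
      rw [div_pow, ← h9, pow_add (9 : ℝ) (j + 1) d]
      field_simp
    rw [Nat.succ_eq_add_one, h5]
    exact mul_le_mul_of_nonneg_right (pow_le_pow_left₀ (by positivity) h2 2) (sq_nonneg _)

section Final

variable {σ β : Type} [Fintype σ] [DecidableEq σ] [Fintype β] [DecidableEq β]

/-- The estimator with the walk lengths `walkSteps`. -/
def solNormEstimator (m : ℕ) (hm : 1 ≤ m) {G : Matrix β σ ℂ} (hG : Gᴴ * G = 1) (zero : σ)
    (κ αinv : ℝ) : VTAAEstimator σ β (Space σ β m ⌊κ⌋₊) :=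
  estimator m ⌊κ⌋₊ hm hG zero (walkSteps κ m) αinv

/-- Without amplification the success probability is `p_succ` up to constants and a cutoff; it is at
most `1 / 9`, and the intermediate amplitudes are such that amplification by `3` per stage does not
overshoot. -/
theorem exists_plainAmp_solNormEstimator {m : ℕ} (hm : 1 ≤ m) {G : Matrix β σ ℂ}
    (hG : Gᴴ * G = 1) {zero : σ} {αA αinv αp : ℝ} {A : Matrix σ σ ℂ} {b : EuclideanSpace ℂ σ}
    {OA : Matrix.unitaryGroup β ℂ} {OB : Matrix.unitaryGroup σ ℂ}
    (hI : IsInstance zero G αA αinv αp A b OA OB) (hαA : 0 < αA) (hαinv : 0 < αinv) :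
    ∃ S : ℝ, 0 ≤ S ∧ S ^ 2 ≤ 1 / 9 ∧ psucc A b αinv / 729 ≤ S ^ 2 ∧
      S ^ 2 ≤ 9 / 9 ^ m + 20 * psucc A b αinv ∧
      ∀ l, (solNormEstimator m hm hG zero (αA * αinv) αinv).plainAmp OA OB l m = S ∧
        ∑ j ∈ Finset.range m,
          9 ^ (j + 1) *
            (solNormEstimator m hm hG zero (αA * αinv) αinv).plainAmp OA OB l (j + 1) ^ 2
            ≤ 5 / 4 * (9 ^ m * S ^ 2) := by
  set κ := αA * αinv with hκdef
  have hκ : 0 ≤ κ := by positivity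
  obtain ⟨e, η, c, he, hMe, hbc, hc1, hX, hps⟩ := hI.exists_spectral hαA
  have hO : (OA : Matrix β β ℂ) * (OA : Matrix β β ℂ)ᴴ = 1 := Matrix.mem_unitaryGroup_iff.1 OA.2
  have hb : b.ofLp = (OB : Matrix σ σ ℂ) *ᵥ Pi.single zero 1 := by rw [hI.state_prep]
  set μ : ℕ → ℝ := fun i => vnorm (activeVec G ⌊κ⌋₊ (walkOp G OA) (walkSteps κ m)
    ((1 / 3 : ℂ) • b.ofLp) i) ^ 2 with hμdef
  have hμanti : ∀ j, μ (j + 1) ≤ μ j := by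
    intro j
    have := vnorm_stopPart_sq (N := ⌊κ⌋₊) hG (walkOp_isometry hG OA) (walkSteps κ m)
      ((1 / 3 : ℂ) • b.ofLp) j
    simp only [hμdef]
    linarith [sq_nonneg (vnorm (stopPart G ⌊κ⌋₊ (walkOp G OA) (walkSteps κ m)
      ((1 / 3 : ℂ) • b.ofLp) j))]
  have hμ0 : ∀ j, 0 ≤ μ j := fun j => sq_nonneg _
  have hμeq : μ = fun j => ∑ p, (‖c p‖ ^ 2 / 9) *
      (∏ i ∈ Finset.range j, chebFilter (walkSteps κ m (i + 1)) (η p)) ^ 2 := by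
    funext j
    have h1 : (1 / 3 : ℂ) • b.ofLp = ∑ p, (1 / 3 * c p) • e p := by
      rw [hbc, Finset.smul_sum]
      exact Finset.sum_congr rfl fun p _ => smul_smul _ _ _
    simp only [hμdef]
    rw [h1, activeVec_eq_sum hG hO (walkSteps_le hκ m) hMe, vnorm_sum_ortho_sq he]
    refine Finset.sum_congr rfl fun p _ => ?_
    rw [norm_mul, norm_mul, Complex.norm_real, Real.norm_eq_abs, mul_pow, sq_abs,
      mul_pow, show ‖(1 / 3 : ℂ)‖ = 1 / 3 by norm_num]
    ring
  have hamp : ∀ l j, 0 < j → j ≤ m →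
      (solNormEstimator m hm hG zero κ αinv).plainAmp OA OB l j ^ 2 = goodMass μ m j :=
    fun l j hj0 hj => plainAmp_estimator_sq OA OB hm hG zero (walkSteps κ m) αinv l hj0 hj hb
  have hgm : 0 ≤ goodMass μ m m := by rw [← hamp 0 m hm le_rfl]; exact sq_nonneg _
  have hsum : 9 ^ m * goodMass μ m m = ∑ p, (‖c p‖ ^ 2 / 9) * (9 ^ m * goodMass (fun j =>
      (∏ i ∈ Finset.range j, chebFilter (walkSteps κ m (i + 1)) (η p)) ^ 2) m m) := by
    rw [hμeq, goodMass_sum, Finset.mul_sum]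
    exact Finset.sum_congr rfl fun p _ => by ring
  have h9 : (0 : ℝ) < 9 ^ m := by positivity
  refine ⟨√(goodMass μ m m), Real.sqrt_nonneg _, ?_, ?_, ?_, fun l => ⟨?_, ?_⟩⟩
  · rw [Real.sq_sqrt hgm]
    refine (goodMass_le hμanti m).trans (le_of_eq ?_)
    rw [hμeq]
    simp only [Finset.range_zero, Finset.prod_empty, one_pow, mul_one]
    rw [← Finset.sum_div, hc1]
  · rw [Real.sq_sqrt hgm]
    have h : 9 ^ m * (psucc A b αinv / 729) ≤ 9 ^ m * goodMass μ m m := by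
      rw [hsum, hps, Finset.sum_div, Finset.mul_sum]
      refine Finset.sum_le_sum fun p _ => ?_
      refine le_trans (le_of_eq ?_) (mul_le_mul_of_nonneg_left
        (goodMass_filter_bounds hκ (hX p) m).1 (by positivity))
      ring
    exact le_of_mul_le_mul_left h h9
  · rw [Real.sq_sqrt hgm]
    have h : 9 ^ m * goodMass μ m m ≤ 9 ^ m * (9 / 9 ^ m + 20 * psucc A b αinv) := by
      calc _ ≤ ∑ p, (‖c p‖ ^ 2 / 9) * (81 + 180 * (9 ^ m / (κ ^ 2 * Real.sin (η p) ^ 2))) := by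
            rw [hsum]
            exact Finset.sum_le_sum fun p _ => mul_le_mul_of_nonneg_left
              (goodMass_filter_bounds hκ (hX p) m).2 (by positivity)
        _ = 9 * ∑ p, ‖c p‖ ^ 2 + 9 ^ m * 20 * ∑ p, ‖c p‖ ^ 2 / (κ ^ 2 * Real.sin (η p) ^ 2) := by
            rw [Finset.mul_sum, Finset.mul_sum, ← Finset.sum_add_distrib]
            exact Finset.sum_congr rfl fun p _ => by ring
        _ = _ := by
            rw [hc1, ← hps]
            field_simp
    exact le_of_mul_le_mul_left h h9
  · have h0 : 0 ≤ (solNormEstimator m hm hG zero κ αinv).plainAmp OA OB l m := vnorm_nonneg _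
    rw [← hamp l m hm le_rfl, Real.sqrt_sq h0]
  · rw [Real.sq_sqrt hgm]
    refine le_trans (le_of_eq (Finset.sum_congr rfl fun j hj => ?_)) (sum_goodMass_le hμanti hμ0 m)
    rw [hamp l (j + 1) (Nat.succ_pos j) (Finset.mem_range.1 hj)]

/-- The value output at level `l` is within a constant factor of the solution norm if `l` is one of
the three levels at which the algorithm stops with probability greater than `1 / 2`. -/
theorem half_lt_prob_solNormEstimator {m : ℕ} (hm : 1 ≤ m) {G : Matrix β σ ℂ}
    (hG : Gᴴ * G = 1) {zero : σ} {αA αinv αp : ℝ} {A : Matrix σ σ ℂ} {b : EuclideanSpace ℂ σ}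
    {OA : Matrix.unitaryGroup β ℂ} {OB : Matrix.unitaryGroup σ ℂ}
    (hI : IsInstance zero G αA αinv αp A b OA OB) (hαA : 0 < αA) (hαinv : 0 < αinv)
    (hαp : 0 < αp) (hm27 : 27 / √αp ≤ 3 ^ m) :
    1 / 2 < (solNormEstimator m hm hG zero (αA * αinv) αinv).algorithm.prob OA OB
      {y : ℝ | IsMultApprox 135 y (solNorm A b) ∧
        IsMultApprox 135 (y / αinv) √(psucc A b αinv)} := by
  obtain ⟨S, hS0, hS9, hSlow, hSup, hplain⟩ :=
    exists_plainAmp_solNormEstimator hm hG hI hαA hαinv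
  set E := solNormEstimator m hm hG zero (αA * αinv) αinv with hE
  have h9 : ∀ n, (9 : ℝ) ^ n = (3 ^ n) ^ 2 := fun n => by
    rw [← pow_mul, mul_comm, pow_mul]; norm_num
  -- the amplitude `S` compared with `t = √p_succ`
  obtain ⟨t, ht0, htp, hsol⟩ : ∃ t : ℝ, 0 < t ∧ psucc A b αinv = t ^ 2 ∧
      solNorm A b = αinv * t := by
    refine ⟨solNorm A b / αinv, ?_, rfl, by field_simp⟩
    have h1 : 0 < psucc A b αinv := hαp.trans_le hI.le_psucc
    have h2 : 0 ≤ solNorm A b / αinv := div_nonneg (norm_nonneg _) hαinv.le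
    exact lt_of_le_of_ne h2 fun h => by rw [psucc, ← h] at h1; norm_num at h1
  have hsqrt : √(psucc A b αinv) = t := by rw [htp, Real.sqrt_sq ht0.le]
  have htα : √αp ≤ t := by rw [← hsqrt]; exact Real.sqrt_le_sqrt hI.le_psucc
  have hα0 : 0 < √αp := Real.sqrt_pos.2 hαp
  rw [htp] at hSlow hSup
  have hS_low : t ≤ 27 * S := by
    refine (pow_le_pow_iff_left₀ ht0.le (by positivity) two_ne_zero).1 ?_
    rw [mul_pow]
    linarith
  have hm27' : 27 ≤ 3 ^ m * t := by
    rw [div_le_iff₀ hα0] at hm27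
    exact hm27.trans (mul_le_mul_of_nonneg_left htα (by positivity))
  have hS_up : S ≤ 5 * t := by
    refine (pow_le_pow_iff_left₀ hS0 (by positivity) two_ne_zero).1 ?_
    have h1 : (9 : ℝ) / 9 ^ m ≤ t ^ 2 := by
      rw [div_le_iff₀ (by positivity), h9]
      nlinarith
    rw [mul_pow]
    nlinarith
  have hSpos : 0 < S := by linarith
  have hS3 : 3 * S ≤ 1 := by
    refine (pow_le_pow_iff_left₀ (by positivity) zero_le_one two_ne_zero).1 ?_
    rw [mul_pow]
    linarith
  -- the level at which `3 ^ l * S` is closest to one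
  obtain ⟨n, hn1, hn2⟩ := exists_nat_pow_near (x := 1 / S) (y := (3 : ℝ))
    (by rw [le_div_iff₀ hSpos]; linarith) (by norm_num)
  rw [le_div_iff₀ hSpos] at hn1
  rw [div_lt_iff₀ hSpos] at hn2
  have hn0 : 1 ≤ n := by
    by_contra h
    have : n = 0 := by omega
    subst this
    norm_num at hn2
    linarith
  have hnm : n ≤ m := by
    have h1 : (3 : ℝ) ^ n ≤ 3 ^ m := by
      have : 3 ^ n * S ≤ 3 ^ m * S := by nlinarith [show (0 : ℝ) < 3 ^ m by positivity]
      exact le_of_mul_le_mul_right this hSpos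
    exact (pow_le_pow_iff_right₀ (by norm_num)).1 h1
  have hsmall : ∀ l ≤ n, 3 ^ l * S ≤ 1 := fun l hl =>
    (mul_le_mul_of_nonneg_right (pow_le_pow_right₀ (by norm_num) hl) hS0).trans hn1
  have hbounds : ∀ l ≤ n, 22 / 27 * (3 ^ l * S) ≤ E.successAmp OA OB l ∧
      E.successAmp OA OB l ≤ 3 ^ l * S := by
    intro l hl
    have h1 : E.plainAmp OA OB l E.m = S := (hplain l).1
    have := E.successAmp_bounds OA OB (l := l) (hl.trans hnm)
      (by rw [h1]; exact (hplain l).2) (by rw [h1]; exact hsmall l hl)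
    rwa [h1] at this
  refine E.half_lt_prob_algorithm OA OB _ n hn0 hnm (fun _ => rfl)
    (Real.sqrt_pos.2 (by norm_num)) le_rfl (fun l hl => ?_) ?_ (fun l hl hl2 => ?_)
  · have h1 := (hbounds l hl).2
    have h2 : 0 ≤ E.successAmp OA OB l := norm_nonneg _
    rw [le_div_iff₀ (by positivity), h9, h9, ← mul_pow, ← one_mul ((3 : ℝ) ^ l)]
    refine pow_le_pow_left₀ (by positivity) ?_ 2
    calc E.successAmp OA OB l * 3 ^ n ≤ 3 ^ l * S * 3 ^ n :=
          mul_le_mul_of_nonneg_right h1 (by positivity)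
      _ = (3 ^ n * S) * 3 ^ l := by ring
      _ ≤ 1 * 3 ^ l := mul_le_mul_of_nonneg_right hn1 (by positivity)
  · refine pow_le_pow_left₀ (by norm_num) (le_trans ?_ (hbounds n le_rfl).1) 2
    rw [pow_succ] at hn2
    linarith
  · change IsMultApprox 135 (αinv / 3 ^ l) (solNorm A b) ∧
      IsMultApprox 135 (αinv / 3 ^ l / αinv) √(psucc A b αinv)
    have h3l : (0 : ℝ) < 3 ^ l := by positivity
    have hA := hsmall l hl
    have hB : 1 ≤ 27 * (3 ^ l * S) := by
      have : (3 : ℝ) ^ (n + 1) ≤ 3 ^ (l + 3) := pow_le_pow_right₀ (by norm_num) (by omega)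
      have h4 : 3 ^ (n + 1) * S ≤ 3 ^ (l + 3) * S := mul_le_mul_of_nonneg_right this hS0
      rw [pow_add (3 : ℝ) l 3] at h4
      linarith
    have hr1 : 1 / 135 ≤ 1 / 3 ^ l / t := by
      rw [div_div, div_le_div_iff₀ (by norm_num) (by positivity)]
      nlinarith
    have hr2 : 1 / 3 ^ l / t ≤ 135 := by
      rw [div_div, div_le_iff₀ (by positivity)]
      nlinarith
    have he1 : αinv / 3 ^ l / (αinv * t) = 1 / 3 ^ l / t := by field_simp
    have he2 : αinv / 3 ^ l / αinv = 1 / 3 ^ l := by field_simp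
    refine ⟨⟨by positivity, by rw [hsol]; positivity, ?_, ?_⟩,
      ⟨by positivity, by rw [hsqrt]; exact ht0, ?_, ?_⟩⟩
    · rw [hsol, he1]; exact hr1
    · rw [hsol, he1]; exact hr2
    · rw [hsqrt, he2]; exact hr1
    · rw [hsqrt, he2]; exact hr2

theorem costA_solNormEstimator_le {m : ℕ} (hm : 1 ≤ m) {G : Matrix β σ ℂ} (hG : Gᴴ * G = 1)
    (zero : σ) {κ : ℝ} (hκ : 0 ≤ κ) (αinv : ℝ) :
    ((solNormEstimator m hm hG zero κ αinv).algorithm.costA : ℝ) ≤ 192 * κ * m ^ 2 := by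
  have h := (solNormEstimator m hm hG zero κ αinv).costA_algorithm_le (κ := 2 * κ)
    (fun _ => rfl) rfl
    (fun l j hj => ?_)
  · refine h.trans (le_of_eq ?_)
    change 96 * (2 * κ) * (m : ℝ) ^ 2 = _
    ring
  · have h1 := walkSteps_cost hκ (Nat.succ_le_of_lt hj)
    change ((stageCircuit m ⌊κ⌋₊ hG (walkSteps κ m (j + 1)) (j + 1)).costA : ℝ) * 3 ^ m ≤ _
    rw [stageCircuit_costA]
    push_cast
    change (walkSteps κ m (j + 1) : ℝ) * 3 ^ m ≤ κ * 3 ^ (j + 1) at h1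
    linarith

end Final

end QLS

end

theorem mainTheorem3 :
    ∃ C c : ℝ, 0 < C ∧ 1 ≤ c ∧
      ∀ (σ β : Type) [Fintype σ] [DecidableEq σ] [Fintype β] [DecidableEq β]
        (zero : σ) (G : Matrix β σ ℂ) (αA αinv αp : ℝ),
        Gᴴ * G = 1 → 0 < αA → 0 < αinv → 1 ≤ αA * αinv → 0 < αp → αp ≤ 1 →
        ∃ (W : Type) (_ : Fintype W) (_ : DecidableEq W) (E : QLS.VTAAEstimator σ β W),
          ((E.algorithm.costB : ℝ) ≤ C * (1 / √αp)) ∧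
          ((E.algorithm.costA : ℝ) ≤
            C * (αA * αinv) * Real.log (2 + 1 / √αp) ^ 2 *
              Real.log (2 + Real.log (2 + 1 / √αp)) ^ 2) ∧
          ∀ (A : Matrix σ σ ℂ) (b : EuclideanSpace ℂ σ)
            (OA : Matrix.unitaryGroup β ℂ) (OB : Matrix.unitaryGroup σ ℂ),
            QLS.IsInstance zero G αA αinv αp A b OA OB →
            1 / 2 < E.algorithm.prob OA OB
              {y : ℝ | QLS.IsMultApprox c y (QLS.solNorm A b) ∧
                QLS.IsMultApprox c (y / αinv) √(QLS.psucc A b αinv)} := by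
  refine ⟨4800, 135, by norm_num, by norm_num, ?_⟩
  intro σ β _ _ _ _ zero G αA αinv αp hG hαA hαinv hκ1 hαp hαp1
  have hκ : 0 ≤ αA * αinv := by linarith
  have hα0 : 0 < √αp := Real.sqrt_pos.2 hαp
  have hα1 : 1 ≤ 1 / √αp := by
    rw [le_div_iff₀ hα0, one_mul]
    exact Real.sqrt_le_one.2 hαp1
  have h27 : 27 / √αp = 27 * (1 / √αp) := by ring
  -- the number of stages
  obtain ⟨n, hn1, hn2⟩ := exists_nat_pow_near (x := 27 / √αp) (y := (3 : ℝ))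
    (by rw [h27]; linarith) (by norm_num)
  have hm3 : (3 : ℝ) ^ (n + 1) ≤ 81 * (1 / √αp) := by
    rw [pow_succ]
    linarith
  refine ⟨QLS.Space σ β (n + 1) ⌊αA * αinv⌋₊, inferInstance, inferInstance,
    QLS.solNormEstimator (n + 1) (Nat.succ_pos n) hG zero (αA * αinv) αinv, ?_, ?_, ?_⟩
  · have h1 := (QLS.solNormEstimator (n + 1) (Nat.succ_pos n) hG zero (αA * αinv)
      αinv).costB_algorithm_le (fun _ => rfl) rfl
    have h2 : ((QLS.solNormEstimator (n + 1) (Nat.succ_pos n) hG zero (αA * αinv)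
        αinv).algorithm.costB : ℝ) ≤ 48 * 3 ^ (n + 1) := by exact_mod_cast h1
    linarith
  · refine (QLS.costA_solNormEstimator_le (Nat.succ_pos n) hG zero hκ αinv).trans ?_
    set L := Real.log (2 + 1 / √αp) with hL
    have hlog3 : 1 ≤ Real.log 3 := by
      rw [Real.le_log_iff_exp_le (by norm_num)]
      linarith [Real.exp_one_lt_d9]
    have hL1 : 1 ≤ L := hlog3.trans (Real.log_le_log (by norm_num) (by linarith))
    have hLL : 1 ≤ Real.log (2 + L) :=
      hlog3.trans (Real.log_le_log (by norm_num) (by linarith))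
    have hmL : ((n + 1 : ℕ) : ℝ) ≤ 5 * L := by
      have h1 : ((n + 1 : ℕ) : ℝ) * Real.log 3 ≤ 4 * Real.log 3 + L := by
        rw [← Real.log_pow]
        have h2 : Real.log (81 * (1 / √αp)) = 4 * Real.log 3 + Real.log (1 / √αp) := by
          rw [Real.log_mul (by norm_num) (by positivity), show (81 : ℝ) = 3 ^ 4 by norm_num,
            Real.log_pow]
          norm_num
        refine (Real.log_le_log (by positivity) hm3).trans ?_
        rw [h2]
        have := Real.log_le_log (show 0 < 1 / √αp by positivity)
          (show 1 / √αp ≤ 2 + 1 / √αp by linarith)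
        linarith
      nlinarith
    have hmL2 : ((n + 1 : ℕ) : ℝ) ^ 2 ≤ 25 * L ^ 2 := by
      refine (pow_le_pow_left₀ (by positivity) hmL 2).trans (le_of_eq (by ring))
    calc 192 * (αA * αinv) * ((n + 1 : ℕ) : ℝ) ^ 2
        ≤ 192 * (αA * αinv) * (25 * L ^ 2) := mul_le_mul_of_nonneg_left hmL2 (by positivity)
      _ = 4800 * (αA * αinv) * L ^ 2 := by ring
      _ ≤ 4800 * (αA * αinv) * L ^ 2 * Real.log (2 + L) ^ 2 :=
          le_mul_of_one_le_right (by positivity) (one_le_pow₀ hLL)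
  · intro A b OA OB hI
    exact QLS.half_lt_prob_solNormEstimator (Nat.succ_pos n) hG hI hαA hαinv hαp hn2.le
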